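/- Let $\Bbbk$ be a field and let $X$ be a path-connected topological space with a base point $x_0$, such that for some $N$ the singular homology with coefficients in $\Bbbk$ satisfies $H_n(X)=0$ for all $n>N$. Let $C^*(X)$ be the differential graded algebra of singular cochains of $X$ with coefficients in $\Bbbk$, with the Alexander--Whitney cup product, augmented to $\Bbbk$ by restriction to $x_0$; let $H^*(X)$ be its cohomology algebra, with the induced augmentation; and let the singular homology $H_*(X)$, with $H_n(X)$ placed in cohomological degree $-n$, be the right $H^*(X)$-module given by the cap product. For a differential graded algebra $A$, a left differential graded $A$-module $P$ is semifree if it has a basis over the underlying graded algebra of $A$, consisting of homogeneous elements and divided into layers indexed by $0,1,2,\dots$, such that the differential maps each basis element into the $A$-span of the basis elements in strictly lower layers. A semifree resolution of a left $A$-module $M$ is a quasi-isomorphism $P\to M$ of differential graded $A$-modules with $P$ semifree. For a left $A$-module $M$ put $\mathrm{Ext}_A(M,L)=H(\mathrm{Hom}_A(P,L))$ for left $A$-modules $L$ and $\mathrm{Tor}^A(M,L)=H(L\otimes_A P)$ for right $A$-modules $L$, where $P\to M$ is any semifree resolution; here $\dim$ denotes the total dimension over $\Bbbk$ of a graded vector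 space, and $H^*(X)$ is regarded as a differential graded algebra with zero differential. A graded algebra $H$ over $\Bbbk$ is a Poincaré duality algebra if for some $m\ge 0$ it is concentrated in degrees $0,\dots,m$, $H^m=\Bbbk\,\alpha$ with $\alpha\neq 0$, and for $0\le i\le m$ the pairing $\langle\beta,\gamma\rangle$ defined by $\beta\gamma=\langle\beta,\gamma\rangle\,\alpha$ for $\beta\in H^i$, $\gamma\in H^{m-i}$ induces an isomorphism $H^i\to\mathrm{Hom}_{\Bbbk}(H^{m-i},\Bbbk)$. Then the following conditions are equivalent: (i) $X$ is Gorenstein at $\Bbbk$, that is, $\dim\mathrm{Ext}_{C^*(X)}(\Bbbk,C^*(X))=1$; (ii) $\dim\mathrm{Tor}^{H^*(X)}(\Bbbk,H_*(X))=1$; (iii) $H^*(X)$ is a Poincaré duality algebra. -/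

import Mathlib

open scoped TensorProduct DirectSum

namespace Gor

/-! ### Graded vector spaces and complexes -/

section Complexes

variable {k : Type*} [Field k] {V : Type*} [AddCommGroup V] [Module k V]

/-- `V = ⨁ n, gr n` is a cochain complex of `k`-vector spaces with differential `d` of
degree `+1`. Homological degree `m` is cohomological degree `-m`. -/
structure IsComplex (gr : ℤ → Submodule k V) (d : V →ₗ[k] V) : Prop where
  internal : DirectSum.IsInternal gr
  d_mem : ∀ n : ℤ, ∀ x ∈ gr n, d x ∈ gr (n + 1)
  d_d : ∀ x, d (d x) = 0

theorem graded_induction {gr : ℤ → Submodule k V} (h : DirectSum.IsInternal gr)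
    {p : V → Prop} (x : V) (hom : ∀ n, ∀ x ∈ gr n, p x) (add : ∀ x y, p x → p y → p (x + y)) :
    p x := by
  have hx : x ∈ iSup gr := by rw [h.submodule_iSup_eq_top]; trivial
  exact Submodule.iSup_induction gr (motive := p) hx hom (hom 0 0 (Submodule.zero_mem _)) add

/-- A family of submodules is a grading as soon as it spans and admits linear projections. -/
theorem isInternal_of_proj {gr : ℤ → Submodule k V} (q : ℤ → V →ₗ[k] V)
    (hq : ∀ n, ∀ x ∈ gr n, q n x = x) (hq' : ∀ n m, m ≠ n → ∀ x ∈ gr m, q n x = 0)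
    (htop : ∀ x, x ∈ iSup gr) : DirectSum.IsInternal gr := by
  have key : ∀ (x : ⨁ n, gr n) (n : ℤ), q n (DirectSum.coeLinearMap gr x) = x n := by
    intro x n
    induction x using DirectSum.induction_on with
    | zero => simp
    | of i x =>
      rw [DirectSum.coeLinearMap_of]
      by_cases h : i = n
      · subst h; rw [hq _ _ x.2, DirectSum.of_eq_same]
      · rw [hq' _ _ h _ x.2, DirectSum.of_eq_of_ne _ _ _ (Ne.symm h)]; rfl
    | add x y hx hy => rw [map_add, map_add, hx, hy]; rfl
  constructor
  · change Function.Injective (DirectSum.coeLinearMap gr)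
    rw [injective_iff_map_eq_zero]
    intro x hx
    ext n
    rw [← key, hx, map_zero]; rfl
  · intro x
    have : x ∈ LinearMap.range (DirectSum.coeLinearMap gr) := by
      rw [DirectSum.range_coeLinearMap]; exact htop x
    exact this

/-- The decomposition of a graded vector space into its components. -/
noncomputable def decomp {gr : ℤ → Submodule k V} (h : DirectSum.IsInternal gr) :
    V ≃ₗ[k] ⨁ n, gr n :=
  (LinearEquiv.ofBijective (DirectSum.coeLinearMap gr)
    (show Function.Bijective (DirectSum.coeLinearMap gr) from h)).symm

/-- The projection of a graded vector space onto its component of degree `n`. -/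
noncomputable def proj {gr : ℤ → Submodule k V} (h : DirectSum.IsInternal gr) (n : ℤ) :
    V →ₗ[k] V :=
  (gr n).subtype ∘ₗ DirectSum.component k ℤ (fun n => gr n) n ∘ₗ
    (decomp h).toLinearMap

/-- The involution `x ↦ (-1)^(deg x) x` of a graded vector space. -/
noncomputable def parity {gr : ℤ → Submodule k V} (h : DirectSum.IsInternal gr) : V →ₗ[k] V :=
  DirectSum.toModule k ℤ V (fun n => n.negOnePow • (gr n).subtype) ∘ₗ
    (decomp h).toLinearMap

section
variable {gr : ℤ → Submodule k V} (h : DirectSum.IsInternal gr)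

theorem decomp_of_mem {n : ℤ} {x : V} (hx : x ∈ gr n) :
    decomp h x = DirectSum.lof k ℤ (fun n => gr n) n ⟨x, hx⟩ := by
  rw [decomp, LinearEquiv.symm_apply_eq, LinearEquiv.ofBijective_apply, DirectSum.coeLinearMap_lof]

theorem parity_of_mem {n : ℤ} {x : V} (hx : x ∈ gr n) : parity h x = n.negOnePow • x := by
  simp [parity, decomp_of_mem h hx]

theorem proj_mem (n : ℤ) (x : V) : proj h n x ∈ gr n := by
  simp [proj]

theorem proj_of_mem {n : ℤ} {x : V} (hx : x ∈ gr n) : proj h n x = x := by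
  simp [proj, decomp_of_mem h hx]

theorem proj_of_mem_ne {n m : ℤ} (hmn : m ≠ n) {x : V} (hx : x ∈ gr m) : proj h n x = 0 := by
  simp only [proj, LinearMap.comp_apply, LinearEquiv.coe_coe, decomp_of_mem h hx]
  rw [DirectSum.component.of, dif_neg hmn]; simp

theorem parity_parity (x : V) : parity h (parity h x) = x := by
  refine graded_induction (p := fun x => parity h (parity h x) = x) h x (fun n x hx => ?_)
    (fun x y hx hy => by rw [map_add, map_add, hx, hy])
  rw [parity_of_mem h hx, Units.smul_def, map_zsmul, parity_of_mem h hx, ← Units.smul_def,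
    smul_smul, Int.units_mul_self, one_smul]

end

section
variable {gr : ℤ → Submodule k V} {d : V →ₗ[k] V} (h : IsComplex gr d)

theorem d_parity (x : V) : d (parity h.internal x) = -parity h.internal (d x) := by
  refine graded_induction (p := fun x => d (parity h.internal x) = -parity h.internal (d x))
    h.internal x (fun n x hx => ?_)
    (fun x y hx hy => by simp only [map_add, hx, hy]; abel)
  rw [parity_of_mem h.internal hx, parity_of_mem h.internal (h.d_mem n x hx),
    Int.negOnePow_succ, Units.smul_def, map_zsmul, Units.neg_smul, neg_neg, Units.smul_def]

theorem d_proj (n : ℤ) (x : V) : d (proj h.internal n x) = proj h.internal (n + 1) (d x) := by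
  refine graded_induction
    (p := fun x => d (proj h.internal n x) = proj h.internal (n + 1) (d x))
    h.internal x (fun m x hx => ?_)
    (fun x y hx hy => by simp only [map_add, hx, hy])
  by_cases hm : m = n
  · subst hm
    rw [proj_of_mem h.internal hx, proj_of_mem h.internal (h.d_mem _ _ hx)]
  · rw [proj_of_mem_ne h.internal hm hx,
      proj_of_mem_ne h.internal (by omega) (h.d_mem _ _ hx), map_zero]

end

/-- The homology `ker d / im d` of a linear endomorphism `d` with `d² = 0`. -/
abbrev Homology (d : V →ₗ[k] V) : Type _ :=
  ↥(LinearMap.ker d) ⧸ (LinearMap.range d).comap (LinearMap.ker d).subtype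

/-- The class of a cycle. -/
abbrev Homology.mk (d : V →ₗ[k] V) (z : LinearMap.ker d) : Homology d :=
  Submodule.Quotient.mk z

/-- The homology classes of degree `n`: those represented by a cycle of degree `n`. -/
def Homology.gr (gr : ℤ → Submodule k V) (d : V →ₗ[k] V) (n : ℤ) : Submodule k (Homology d) :=
  ((gr n).comap (LinearMap.ker d).subtype).map (Submodule.mkQ _)

/-- The map induced in homology by a morphism of complexes. -/
def Homology.map {W : Type*} [AddCommGroup W] [Module k W] {d : V →ₗ[k] V} {d' : W →ₗ[k] W}
    (f : V →ₗ[k] W) (hf : ∀ x, d' (f x) = f (d x)) : Homology d →ₗ[k] Homology d' :=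
  Submodule.mapQ _ _
    (f.restrict (p := LinearMap.ker d) (q := LinearMap.ker d') (fun x hx => by
      rw [LinearMap.mem_ker] at hx ⊢; rw [hf, hx, map_zero]))
    (by
      rintro ⟨x, hx⟩ ⟨y, hy⟩
      exact ⟨f y, by rw [hf, hy]; rfl⟩)

theorem Homology.isInternal {gr : ℤ → Submodule k V} {d : V →ₗ[k] V} (h : IsComplex gr d) :
    DirectSum.IsInternal (Homology.gr gr d) := by
  have hker : ∀ n, ∀ x ∈ LinearMap.ker d, proj h.internal n x ∈ LinearMap.ker d := by
    intro n x hx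
    rw [LinearMap.mem_ker] at hx ⊢
    rw [d_proj h, hx, map_zero]
  refine isInternal_of_proj (fun n => Submodule.mapQ _ _
    ((proj h.internal n).restrict (hker n)) ?_) ?_ ?_ ?_
  · rintro ⟨x, hx⟩ ⟨y, hy⟩
    refine ⟨proj h.internal (n - 1) y, ?_⟩
    rw [d_proj h, hy, sub_add_cancel]; rfl
  · rintro n _ ⟨x, hx, rfl⟩
    simp only [Submodule.mkQ_apply, Submodule.mapQ_apply]
    congr 1
    exact Subtype.ext (proj_of_mem h.internal hx)
  · rintro n m hmn _ ⟨x, hx, rfl⟩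
    simp only [Submodule.mkQ_apply, Submodule.mapQ_apply]
    rw [Submodule.Quotient.mk_eq_zero]
    have : (proj h.internal n).restrict (hker n) x = 0 :=
      Subtype.ext (proj_of_mem_ne h.internal hmn hx)
    rw [this]; exact Submodule.zero_mem _
  · intro x
    obtain ⟨⟨z, hz⟩, rfl⟩ := Submodule.Quotient.mk_surjective _ x
    classical
    -- a cycle is the sum of its homogeneous components, which are cycles
    have hsum : ∀ z : V, ∃ s : Finset ℤ, z = ∑ n ∈ s, proj h.internal n z := by
      intro z
      have := (decomp h.internal).symm_apply_apply z
      rw [decomp, LinearEquiv.symm_symm, LinearEquiv.ofBijective_apply, DirectSum.coeLinearMap_eq_dfinsuppSum] at this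
      exact ⟨_, this.symm⟩
    obtain ⟨s, hs⟩ := hsum z
    have e : (⟨z, hz⟩ : LinearMap.ker d) = ∑ n ∈ s, ⟨proj h.internal n z, hker n z hz⟩ := by
      apply Subtype.ext
      rw [AddSubmonoidClass.coe_finsetSum]
      exact hs
    rw [e, ← Submodule.mkQ_apply, map_sum]
    refine Submodule.sum_mem _ fun n _ => Submodule.mem_iSup_of_mem n ?_
    exact ⟨_, proj_mem h.internal n z, rfl⟩

theorem Homology.isComplex {gr : ℤ → Submodule k V} {d : V →ₗ[k] V} (h : IsComplex gr d) :
    IsComplex (Homology.gr gr d) 0 where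
  internal := Homology.isInternal h
  d_mem _ _ _ := Submodule.zero_mem _
  d_d _ := rfl

/-- A bilinear map satisfying the Leibniz rule induces a bilinear map in homology. -/
noncomputable def Homology.map₂ {U W : Type*} [AddCommGroup U] [Module k U] [AddCommGroup W]
    [Module k W] {grU : ℤ → Submodule k U} {dU : U →ₗ[k] U} {dV : V →ₗ[k] V} {dW : W →ₗ[k] W}
    (hU : IsComplex grU dU)
    (b : U →ₗ[k] V →ₗ[k] W)
    (hb : ∀ u v, dW (b u v) = b (dU u) v + b (parity hU.internal u) (dV v)) :
    Homology dU →ₗ[k] Homology dV →ₗ[k] Homology dW :=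
  Submodule.liftQ _
    (LinearMap.flip (Submodule.liftQ _
      (LinearMap.flip (LinearMap.mk₂ k
        (fun (u : LinearMap.ker dU) (v : LinearMap.ker dV) =>
          (Homology.mk dW ⟨b u v, by
            rw [LinearMap.mem_ker, hb, LinearMap.mem_ker.1 u.2, LinearMap.mem_ker.1 v.2]
            simp⟩))
        (fun _ _ _ => congrArg (Homology.mk dW) (Subtype.ext (by simp)))
        (fun _ _ _ => congrArg (Homology.mk dW) (Subtype.ext (by simp)))
        (fun _ _ _ => congrArg (Homology.mk dW) (Subtype.ext (by simp)))
        (fun _ _ _ => congrArg (Homology.mk dW) (Subtype.ext (by simp)))))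
      (by
        rintro ⟨v, hv⟩ ⟨v', hv'⟩
        refine LinearMap.ext fun ⟨u, hu⟩ => ?_
        refine (Submodule.Quotient.mk_eq_zero _).2 ⟨b (parity hU.internal u) v', ?_⟩
        have hu0 : dU u = 0 := hu
        change dW _ = b u v
        rw [hb, d_parity hU, hu0, parity_parity, hv']
        simp)))
    (by
      rintro ⟨u, hu⟩ ⟨u', hu'⟩
      refine LinearMap.ext fun x => ?_
      obtain ⟨⟨v, hv⟩, rfl⟩ := Submodule.Quotient.mk_surjective _ x
      refine (Submodule.Quotient.mk_eq_zero _).2 ⟨b u' v, ?_⟩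
      have hv0 : dV v = 0 := hv
      change dW _ = b u v
      rw [hb, hv0, hu']
      simp)

theorem Homology.map₂_mk {U W : Type*} [AddCommGroup U] [Module k U] [AddCommGroup W]
    [Module k W] {grU : ℤ → Submodule k U} {dU : U →ₗ[k] U} {dV : V →ₗ[k] V} {dW : W →ₗ[k] W}
    (hU : IsComplex grU dU)
    (b : U →ₗ[k] V →ₗ[k] W)
    (hb : ∀ u v, dW (b u v) = b (dU u) v + b (parity hU.internal u) (dV v))
    (u : LinearMap.ker dU) (v : LinearMap.ker dV) (w : LinearMap.ker dW) (hw : w = b u v) :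
    Homology.map₂ hU b hb (Homology.mk dU u) (Homology.mk dV v) = Homology.mk dW w := by
  have : w = ⟨b u v, hw ▸ w.2⟩ := Subtype.ext hw
  rw [this]
  rfl

end Complexes

/-! ### Differential graded algebras and modules -/

universe v w w' p

/-- A differential graded algebra over `k`, with differential of degree `+1`. -/
structure DGAlgebra (k : Type v) [Field k] where
  carrier : Type w
  [ring : Ring carrier]
  [algebra : Algebra k carrier]
  gr : ℤ → Submodule k carrier
  d : carrier →ₗ[k] carrier
  isComplex : IsComplex gr d
  one_mem : 1 ∈ gr 0
  mul_mem : ∀ (m n : ℤ) (a b : carrier), a ∈ gr m → b ∈ gr n → a * b ∈ gr (m + n)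
  leibniz : ∀ (m : ℤ) (a b : carrier), a ∈ gr m → d (a * b) = d a * b + m.negOnePow • (a * d b)

instance (k : Type v) [Field k] : CoeSort (DGAlgebra.{v, w} k) (Type w) := ⟨DGAlgebra.carrier⟩

attribute [instance] DGAlgebra.ring DGAlgebra.algebra

variable {k : Type v} [Field k]

/-- A left differential graded module over a differential graded algebra. -/
structure DGModule (A : DGAlgebra.{v, w} k) where
  carrier : Type p
  [addCommGroup : AddCommGroup carrier]
  [moduleField : Module k carrier]
  [module : Module A carrier]
  [isScalarTower : IsScalarTower k A carrier]
  gr : ℤ → Submodule k carrier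
  d : carrier →ₗ[k] carrier
  isComplex : IsComplex gr d
  smul_mem : ∀ (m n : ℤ) (a : A) (x : carrier), a ∈ A.gr m → x ∈ gr n → a • x ∈ gr (m + n)
  leibniz : ∀ (m : ℤ) (a : A) (x : carrier), a ∈ A.gr m →
    d (a • x) = A.d a • x + m.negOnePow • (a • d x)

instance (A : DGAlgebra.{v, w} k) : CoeSort (DGModule.{v, w, p} A) (Type p) := ⟨DGModule.carrier⟩

attribute [instance] DGModule.addCommGroup DGModule.moduleField DGModule.module
  DGModule.isScalarTower

/-- A right differential graded module over a differential graded algebra; the right action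
`x · a` is written as the left action of the opposite algebra. -/
structure DGRightModule (A : DGAlgebra.{v, w} k) where
  carrier : Type p
  [addCommGroup : AddCommGroup carrier]
  [moduleField : Module k carrier]
  [module : Module (A.carrier)ᵐᵒᵖ carrier]
  [isScalarTower : IsScalarTower k (A.carrier)ᵐᵒᵖ carrier]
  gr : ℤ → Submodule k carrier
  d : carrier →ₗ[k] carrier
  isComplex : IsComplex gr d
  smul_mem : ∀ (m n : ℤ) (x : carrier) (a : A), x ∈ gr m → a ∈ A.gr n →
    MulOpposite.op a • x ∈ gr (m + n)
  leibniz : ∀ (m : ℤ) (x : carrier) (a : A), x ∈ gr m →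
    d (MulOpposite.op a • x) = MulOpposite.op a • d x + m.negOnePow • (MulOpposite.op (A.d a) • x)

instance (A : DGAlgebra.{v, w} k) : CoeSort (DGRightModule.{v, w, p} A) (Type p) :=
  ⟨DGRightModule.carrier⟩

attribute [instance] DGRightModule.addCommGroup DGRightModule.moduleField DGRightModule.module
  DGRightModule.isScalarTower

/-- A differential graded algebra as a left module over itself. -/
abbrev DGAlgebra.self (A : DGAlgebra.{v, w} k) : DGModule.{v, w, w} A where
  carrier := A
  gr := A.gr
  d := A.d
  isComplex := A.isComplex
  smul_mem := A.mul_mem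
  leibniz := A.leibniz

/-- An augmentation `A → k` of a differential graded algebra. -/
structure DGAlgebra.Augmentation (A : DGAlgebra.{v, w} k) where
  toAlgHom : A →ₐ[k] k
  map_gr : ∀ n : ℤ, n ≠ 0 → ∀ a ∈ A.gr n, toAlgHom a = 0
  map_d : ∀ a, toAlgHom (A.d a) = 0

/-- The field `k`, in degree `0`. -/
def fieldGr (k : Type v) [Field k] (n : ℤ) : Submodule k k := if n = 0 then ⊤ else ⊥

theorem fieldIsComplex : IsComplex (fieldGr k) (0 : k →ₗ[k] k) where
  internal := by
    refine isInternal_of_proj (fun n => if n = 0 then LinearMap.id else 0) ?_ ?_ ?_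
    · intro n x hx
      by_cases h : n = 0
      · simp [h]
      · simp only [fieldGr, if_neg h, Submodule.mem_bot] at hx
        simp [h, hx]
    · intro n m hmn x hx
      by_cases h : n = 0
      · have hm : m ≠ 0 := fun h' => hmn (h'.trans h.symm)
        simp only [fieldGr, if_neg hm, Submodule.mem_bot] at hx
        simp [hx]
      · simp [h]
    · intro x
      exact Submodule.mem_iSup_of_mem 0 (by simp [fieldGr])
  d_mem _ _ _ := Submodule.zero_mem _
  d_d _ := rfl

/-- The ground field as a left module over an augmented differential graded algebra. -/
def DGAlgebra.Augmentation.fieldModule {A : DGAlgebra.{v, w} k} (ε : A.Augmentation) :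
    DGModule.{v, w, v} A :=
  letI : Module A k := Module.compHom k ε.toAlgHom.toRingHom
  have smul_def : ∀ (a : A) (x : k), a • x = ε.toAlgHom a * x := fun _ _ => rfl
  { carrier := k
    isScalarTower := ⟨fun c a x => by simp only [smul_def, map_smul, smul_eq_mul, mul_assoc]⟩
    gr := fieldGr k
    d := 0
    isComplex := fieldIsComplex
    smul_mem := fun m n a x ha hx => by
      rw [smul_def]
      by_cases hm : m = 0
      · subst hm
        rw [zero_add, ← smul_eq_mul]
        exact Submodule.smul_mem _ _ hx
      · rw [ε.map_gr m hm a ha, zero_mul]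
        exact Submodule.zero_mem _
    leibniz := fun m a x _ => by
      simp [smul_def, ε.map_d] }

/-- The module `P` is semifree: `P = A ⊗ V` as a module over the underlying graded algebra,
where `V` has a homogeneous basis `e` divided into successive layers (`rk` is the number of
the layer) such that `d` maps each basis element into the `A`-span of the lower layers. -/
def DGModule.IsSemifree {A : DGAlgebra.{v, w} k} (P : DGModule.{v, w, p} A) : Prop :=
  ∃ (ι : Type p) (e : Module.Basis ι A P) (deg : ι → ℤ) (rk : ι → ℕ),
    (∀ i, e i ∈ P.gr (deg i)) ∧
      ∀ i, P.d (e i) ∈ Submodule.span A.carrier (e '' {j | rk j < rk i})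

/-- A morphism of differential graded modules (of degree `0`). -/
structure DGModule.Hom {A : DGAlgebra.{v, w} k} (P : DGModule.{v, w, p} A)
    (M : DGModule.{v, w, w'} A) where
  toLinearMap : P →ₗ[A.carrier] M
  map_gr : ∀ n, ∀ x ∈ P.gr n, toLinearMap x ∈ M.gr n
  map_d : ∀ x, M.d (toLinearMap x) = toLinearMap (P.d x)

/-- The map induced in homology by a morphism of differential graded modules. -/
def DGModule.Hom.homologyMap {A : DGAlgebra.{v, w} k} {P : DGModule.{v, w, p} A}
    {M : DGModule.{v, w, w'} A} (f : P.Hom M) : Homology P.d →ₗ[k] Homology M.d :=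
  Homology.map (f.toLinearMap.restrictScalars k) f.map_d

/-- A semifree resolution of `M`: a quasi-isomorphism `P → M` from a semifree module. -/
structure SemifreeResolution {A : DGAlgebra.{v, w} k} (M : DGModule.{v, w, w'} A) where
  P : DGModule.{v, w, max w w'} A
  isSemifree : P.IsSemifree
  π : P.Hom M
  quasiIso : Function.Bijective π.homologyMap

/-! ### Ext -/

section Ext

variable {A : DGAlgebra.{v, w} k} (P : DGModule.{v, w, p} A) (N : DGModule.{v, w, w'} A)

/-- The `A`-linear maps of degree `n` from `P` to `N`: those satisfying
`f (a x) = (-1)^(n * deg a) a f(x)`. -/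
def homDeg (n : ℤ) : Submodule k (P →ₗ[k] N) where
  carrier := {f | (∀ m, ∀ x ∈ P.gr m, f x ∈ N.gr (m + n)) ∧
    ∀ m, ∀ a ∈ A.gr m, ∀ x, f (a • x) = (n * m).negOnePow • (a • f x)}
  add_mem' hf hg := ⟨fun m x hx => Submodule.add_mem _ (hf.1 m x hx) (hg.1 m x hx),
    fun m a ha x => by
      simp only [LinearMap.add_apply, hf.2 m a ha x, hg.2 m a ha x, smul_add]⟩
  zero_mem' := ⟨fun _ _ _ => Submodule.zero_mem _, fun _ _ _ _ => by simp⟩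
  smul_mem' c f hf := ⟨fun m x hx => Submodule.smul_mem _ _ (hf.1 m x hx),
    fun m a ha x => by
      simp only [LinearMap.smul_apply, hf.2 m a ha x]
      rw [smul_comm c (n * m).negOnePow, smul_algebra_smul_comm]⟩

/-- The differential `f ↦ d f - (-1)^n f d` on the maps of degree `n`. -/
def homD (n : ℤ) : (P →ₗ[k] N) →ₗ[k] (P →ₗ[k] N) :=
  LinearMap.llcomp k P N N N.d - n.negOnePow • LinearMap.lcomp k N P.d

/-- The cocycles of degree `n` of `Hom_A(P, N)`. -/
def homCocycles (n : ℤ) : Submodule k (P →ₗ[k] N) := homDeg P N n ⊓ LinearMap.ker (homD P N n)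

/-- The coboundaries of degree `n` of `Hom_A(P, N)`. -/
def homCoboundaries (n : ℤ) : Submodule k (P →ₗ[k] N) :=
  (homDeg P N (n - 1)).map (homD P N (n - 1))

/-- The graded vector space `H(Hom_A(P, N))`. -/
abbrev HomHomology : Type _ :=
  ⨁ n : ℤ, ↥(homCocycles P N n) ⧸ (homCoboundaries P N n).comap (homCocycles P N n).subtype

end Ext

/-- `dim Ext_A(M, N) = c`, where `Ext_A(M, N) = H(Hom_A(P, N))` for any semifree resolution
`P` of `M`, and `dim` is the total dimension of a graded vector space. -/
def DimExtEq {A : DGAlgebra.{v, w} k} (M : DGModule.{v, w, w'} A) (N : DGModule.{v, w, p} A)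
    (c : Cardinal) : Prop :=
  Nonempty (SemifreeResolution M) ∧
    ∀ R : SemifreeResolution M, Module.rank k (HomHomology R.P N) = c

/-! ### Tor -/

section Tor

variable {A : DGAlgebra.{v, w} k} (N : DGRightModule.{v, w, w'} A) (P : DGModule.{v, w, p} A)

/-- The relations `x a ⊗ y = x ⊗ a y` defining `N ⊗_A P` as a quotient of `N ⊗_k P`. -/
def tensorRel : Submodule k (N ⊗[k] P) :=
  Submodule.span k {t | ∃ (x : N) (a : A) (y : P),
    t = (MulOpposite.op a • x) ⊗ₜ[k] y - x ⊗ₜ[k] (a • y)}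

/-- The differential `x ⊗ y ↦ d x ⊗ y + (-1)^(deg x) x ⊗ d y` of `N ⊗_k P`. -/
noncomputable def tensorPreD : N ⊗[k] P →ₗ[k] N ⊗[k] P :=
  TensorProduct.map N.d LinearMap.id + TensorProduct.map (parity N.isComplex.internal) P.d

/-- The Leibniz rule of a right module in terms of the parity involution. -/
theorem DGRightModule.leibniz_parity (x : N) (a : A) :
    N.d (MulOpposite.op a • x) = MulOpposite.op a • N.d x +
      MulOpposite.op (A.d a) • parity N.isComplex.internal x := by
  refine graded_induction (p := fun x => N.d (MulOpposite.op a • x) = MulOpposite.op a • N.d x +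
      MulOpposite.op (A.d a) • parity N.isComplex.internal x) N.isComplex.internal x
    (fun n x hx => ?_) (fun x y hx hy => by simp only [smul_add, map_add, hx, hy]; abel)
  rw [N.leibniz n x a hx, parity_of_mem N.isComplex.internal hx, Units.smul_def, Units.smul_def,
    smul_comm (MulOpposite.op (A.d a)) ((n.negOnePow : ℤˣ) : ℤ) x]

theorem DGAlgebra.leibniz_parity (a b : A) :
    A.d (a * b) = A.d a * b + parity A.isComplex.internal a * A.d b := by
  refine graded_induction (p := fun a => A.d (a * b) = A.d a * b +
      parity A.isComplex.internal a * A.d b) A.isComplex.internal a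
    (fun n x hx => ?_) (fun x y hx hy => by simp only [add_mul, map_add, hx, hy]; abel)
  rw [A.leibniz n x b hx, parity_of_mem A.isComplex.internal hx, Units.smul_def, Units.smul_def,
    smul_mul_assoc]

theorem DGRightModule.parity_smul (m : ℤ) (x : N) (a : A) (ha : a ∈ A.gr m) :
    parity N.isComplex.internal (MulOpposite.op a • x) =
      m.negOnePow • (MulOpposite.op a • parity N.isComplex.internal x) := by
  refine graded_induction (p := fun x => parity N.isComplex.internal (MulOpposite.op a • x) =
      m.negOnePow • (MulOpposite.op a • parity N.isComplex.internal x)) N.isComplex.internal x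
    (fun n x hx => ?_) (fun x y hx hy => by simp only [smul_add, map_add, hx, hy])
  rw [parity_of_mem _ (N.smul_mem n m x a hx ha), parity_of_mem _ hx, Int.negOnePow_add,
    mul_comm, mul_smul]
  simp only [Units.smul_def]
  rw [smul_comm (MulOpposite.op a) ((n.negOnePow : ℤˣ) : ℤ) x]

theorem tensorPreD_rel : tensorRel N P ≤ (tensorRel N P).comap (tensorPreD N P) := by
  refine Submodule.span_le.2 ?_
  rintro _ ⟨x, a, y, rfl⟩
  have mem : ∀ (x : N) (a : A) (y : P),
      (MulOpposite.op a • x) ⊗ₜ[k] y - x ⊗ₜ[k] (a • y) ∈ tensorRel N P :=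
    fun x a y => Submodule.subset_span ⟨x, a, y, rfl⟩
  change tensorPreD N P _ ∈ tensorRel N P
  refine graded_induction (p := fun a => tensorPreD N P
    ((MulOpposite.op a • x) ⊗ₜ[k] y - x ⊗ₜ[k] (a • y)) ∈ tensorRel N P)
    A.isComplex.internal a (fun m a ha => ?_) (fun a b ha hb => ?_)
  · have e : tensorPreD N P ((MulOpposite.op a • x) ⊗ₜ[k] y - x ⊗ₜ[k] (a • y)) =
        ((MulOpposite.op a • N.d x) ⊗ₜ[k] y - N.d x ⊗ₜ[k] (a • y)) +
        ((MulOpposite.op (A.d a) • parity N.isComplex.internal x) ⊗ₜ[k] y -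
          parity N.isComplex.internal x ⊗ₜ[k] (A.d a • y)) +
        m.negOnePow • ((MulOpposite.op a • parity N.isComplex.internal x) ⊗ₜ[k] P.d y -
          parity N.isComplex.internal x ⊗ₜ[k] (a • P.d y)) := by
      simp only [tensorPreD, map_sub, LinearMap.add_apply, TensorProduct.map_tmul,
        LinearMap.id_apply, N.leibniz_parity, N.parity_smul m x a ha, P.leibniz m a y ha,
        TensorProduct.add_tmul, TensorProduct.tmul_add, smul_sub, Units.smul_def,
        TensorProduct.smul_tmul', TensorProduct.tmul_smul]
      abel
    rw [e]
    refine Submodule.add_mem _ (Submodule.add_mem _ (mem _ _ _) (mem _ _ _)) ?_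
    rw [Units.smul_def]
    exact zsmul_mem (mem _ _ _) _
  · have e : (MulOpposite.op (a + b) • x) ⊗ₜ[k] y - x ⊗ₜ[k] ((a + b) • y) =
        ((MulOpposite.op a • x) ⊗ₜ[k] y - x ⊗ₜ[k] (a • y)) +
        ((MulOpposite.op b • x) ⊗ₜ[k] y - x ⊗ₜ[k] (b • y)) := by
      simp only [MulOpposite.op_add, add_smul, TensorProduct.add_tmul, TensorProduct.tmul_add]
      abel
    rw [e, map_add]
    exact Submodule.add_mem _ ha hb

/-- The complex `N ⊗_A P`. -/
abbrev TensorOver : Type _ := (N ⊗[k] P) ⧸ tensorRel N P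

/-- The differential of `N ⊗_A P`. -/
noncomputable def tensorD : TensorOver N P →ₗ[k] TensorOver N P :=
  Submodule.mapQ _ _ (tensorPreD N P) (tensorPreD_rel N P)

end Tor

/-- `dim Tor^A(M, N) = c`, where `M` is a left module, `N` is a right module,
`Tor^A(M, N) = H(N ⊗_A P)` for any semifree resolution `P` of `M`, and `dim` is the total
dimension of a graded vector space. -/
def DimTorEq {A : DGAlgebra.{v, w} k} (M : DGModule.{v, w, w'} A) (N : DGRightModule.{v, w, p} A)
    (c : Cardinal) : Prop :=
  Nonempty (SemifreeResolution M) ∧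
    ∀ R : SemifreeResolution M, Module.rank k (Homology (tensorD N R.P)) = c

/-- An augmented differential graded algebra is Gorenstein if `dim Ext_A(k, A) = 1`. -/
def DGAlgebra.Augmentation.IsGorenstein {A : DGAlgebra.{v, w} k} (ε : A.Augmentation) : Prop :=
  DimExtEq ε.fieldModule A.self 1

/-- The graded algebra `H = ⨁ gr n` is a Poincaré duality algebra: it is concentrated in degrees
`0, …, N`, its component of degree `N` is `k α` with `α ≠ 0`, and for `i + j = N` the pairing
`β γ = ⟨β, γ⟩ α` defines an isomorphism `Φ` from the component of degree `i` onto the dual of the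
component of degree `j`. -/
def IsPoincareDualityAlgebra {H : Type*} [Ring H] [Algebra k H] (gr : ℤ → Submodule k H) : Prop :=
  ∃ N : ℤ, 0 ≤ N ∧ (∀ n, n < 0 ∨ N < n → gr n = ⊥) ∧
    ∃ α : H, α ≠ 0 ∧ gr N = Submodule.span k {α} ∧
      ∀ i j : ℤ, 0 ≤ i → 0 ≤ j → i + j = N →
        ∃ Φ : gr i ≃ₗ[k] Module.Dual k (gr j),
          ∀ (β : gr i) (γ : gr j), (β * γ : H) = Φ β γ • α

/-! ### The homology algebra -/

section HomologyAlgebra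

variable (A : DGAlgebra.{v, w} k)

/-- The multiplication of `H(A)` as a bilinear map. -/
noncomputable def DGAlgebra.homologyMul :
    Homology A.d →ₗ[k] Homology A.d →ₗ[k] Homology A.d :=
  Homology.map₂ A.isComplex (LinearMap.mul k A) A.leibniz_parity

theorem DGAlgebra.d_one : A.d 1 = 0 := by
  have h := A.leibniz_parity 1 1
  rw [parity_of_mem _ A.one_mem] at h
  simpa using h

theorem DGAlgebra.mul_mem_ker (x y : LinearMap.ker A.d) :
    (x * y : A) ∈ LinearMap.ker A.d := by
  rw [LinearMap.mem_ker, A.leibniz_parity, LinearMap.mem_ker.1 x.2, LinearMap.mem_ker.1 y.2]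
  simp

theorem DGAlgebra.homologyMul_mk (x y : LinearMap.ker A.d) :
    A.homologyMul (Homology.mk A.d x) (Homology.mk A.d y) =
      Homology.mk A.d ⟨x * y, A.mul_mem_ker x y⟩ :=
  Homology.map₂_mk _ _ _ x y _ rfl

noncomputable instance DGAlgebra.homologyRing : Ring (Homology A.d) :=
  { (inferInstance : AddCommGroup (Homology A.d)) with
    mul := fun x y => A.homologyMul x y
    one := Homology.mk A.d ⟨1, LinearMap.mem_ker.2 A.d_one⟩
    left_distrib := fun x y z => map_add _ _ _
    right_distrib := fun x y z => LinearMap.map_add₂ _ _ _ _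
    zero_mul := fun x => LinearMap.map_zero₂ _ _
    mul_zero := fun x => map_zero _
    mul_assoc := fun x y z => by
      obtain ⟨x, rfl⟩ := Submodule.Quotient.mk_surjective _ x
      obtain ⟨y, rfl⟩ := Submodule.Quotient.mk_surjective _ y
      obtain ⟨z, rfl⟩ := Submodule.Quotient.mk_surjective _ z
      change A.homologyMul (A.homologyMul _ _) _ = A.homologyMul _ (A.homologyMul _ _)
      simp only [homologyMul_mk, mul_assoc]
    one_mul := fun x => by
      obtain ⟨x, rfl⟩ := Submodule.Quotient.mk_surjective _ x
      exact (A.homologyMul_mk ⟨1, LinearMap.mem_ker.2 A.d_one⟩ x).trans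
        (congrArg (Homology.mk A.d) (Subtype.ext (one_mul (x : A))))
    mul_one := fun x => by
      obtain ⟨x, rfl⟩ := Submodule.Quotient.mk_surjective _ x
      exact (A.homologyMul_mk x ⟨1, LinearMap.mem_ker.2 A.d_one⟩).trans
        (congrArg (Homology.mk A.d) (Subtype.ext (mul_one (x : A)))) }

theorem DGAlgebra.homology_mk_mul (x y : LinearMap.ker A.d) :
    Homology.mk A.d x * Homology.mk A.d y = Homology.mk A.d ⟨x * y, A.mul_mem_ker x y⟩ :=
  A.homologyMul_mk x y

noncomputable instance DGAlgebra.homologyAlgebra : Algebra k (Homology A.d) :=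
  Algebra.ofModule (fun r x y => LinearMap.map_smul₂ A.homologyMul r x y)
    (fun r x y => map_smul (A.homologyMul x) r y)

/-- The homology `H(A)`, a graded algebra regarded as a differential graded algebra with zero
differential. -/
noncomputable def DGAlgebra.homology : DGAlgebra.{v, w} k where
  carrier := Homology A.d
  gr := Homology.gr A.gr A.d
  d := 0
  isComplex := Homology.isComplex A.isComplex
  one_mem := ⟨⟨1, LinearMap.mem_ker.2 A.d_one⟩, A.one_mem, rfl⟩
  mul_mem := by
    rintro m n _ _ ⟨x, hx, rfl⟩ ⟨y, hy, rfl⟩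
    exact ⟨⟨x * y, A.mul_mem_ker x y⟩, A.mul_mem m n _ _ hx hy, (A.homology_mk_mul x y).symm⟩
  leibniz := by intros; simp

/-- The augmentation of `H(A)` induced by an augmentation of `A`. -/
noncomputable def DGAlgebra.Augmentation.homology {A : DGAlgebra.{v, w} k} (ε : A.Augmentation) :
    A.homology.Augmentation where
  toAlgHom := AlgHom.ofLinearMap
    (Submodule.liftQ _ (ε.toAlgHom.toLinearMap ∘ₗ (LinearMap.ker A.d).subtype) (by
      rintro ⟨x, hx⟩ ⟨y, hy⟩
      rw [LinearMap.mem_ker, LinearMap.comp_apply, ← hy]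
      exact ε.map_d y) : Homology A.d →ₗ[k] k)
    (map_one ε.toAlgHom)
    (by
      intro x y
      obtain ⟨x, rfl⟩ := Submodule.Quotient.mk_surjective _ x
      obtain ⟨y, rfl⟩ := Submodule.Quotient.mk_surjective _ y
      exact (congrArg _ (A.homology_mk_mul x y)).trans (map_mul ε.toAlgHom (x : A) (y : A)))
  map_gr := by
    rintro n hn _ ⟨x, hx, rfl⟩
    exact ε.map_gr n hn _ hx
  map_d _ := map_zero _

variable {A} (M : DGRightModule.{v, w, w'} A)

/-- The right action of `A` on `M` as a bilinear map. -/
def DGRightModule.act : M →ₗ[k] A →ₗ[k] M :=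
  LinearMap.mk₂ k (fun x a => MulOpposite.op a • x)
    (fun _ _ _ => smul_add _ _ _)
    (fun c x a => by
      rw [← algebraMap_smul (A.carrier)ᵐᵒᵖ c x, ← algebraMap_smul (A.carrier)ᵐᵒᵖ c, smul_smul,
        smul_smul, Algebra.commutes])
    (fun _ _ _ => by rw [MulOpposite.op_add, add_smul])
    (fun c x a => by rw [MulOpposite.op_smul, smul_assoc])

/-- The right action of `H(A)` on `H(M)` as a bilinear map. -/
noncomputable def DGRightModule.homologyAct :
    Homology M.d →ₗ[k] Homology A.d →ₗ[k] Homology M.d :=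
  Homology.map₂ M.isComplex M.act M.leibniz_parity

theorem DGRightModule.op_smul_mem_ker (x : LinearMap.ker M.d) (a : LinearMap.ker A.d) :
    MulOpposite.op (a : A) • (x : M) ∈ LinearMap.ker M.d := by
  rw [LinearMap.mem_ker, M.leibniz_parity, LinearMap.mem_ker.1 x.2, LinearMap.mem_ker.1 a.2]
  simp

theorem DGRightModule.homologyAct_mk (x : LinearMap.ker M.d) (a : LinearMap.ker A.d) :
    M.homologyAct (Homology.mk M.d x) (Homology.mk A.d a) =
      Homology.mk M.d ⟨MulOpposite.op (a : A) • (x : M), M.op_smul_mem_ker x a⟩ :=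
  Homology.map₂_mk _ _ _ x a _ rfl

noncomputable instance DGRightModule.homologyModule :
    Module (Homology A.d)ᵐᵒᵖ (Homology M.d) where
  smul a x := M.homologyAct x a.unop
  smul_zero _ := LinearMap.map_zero₂ _ _
  smul_add _ _ _ := LinearMap.map_add₂ _ _ _ _
  zero_smul x := map_zero (M.homologyAct x)
  add_smul a b x := map_add (M.homologyAct x) a.unop b.unop
  one_smul x := by
    obtain ⟨x, rfl⟩ := Submodule.Quotient.mk_surjective _ x
    refine (M.homologyAct_mk x ⟨1, LinearMap.mem_ker.2 A.d_one⟩).trans ?_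
    congr 1
    exact Subtype.ext (one_smul _ _)
  mul_smul a b x := by
    obtain ⟨x, rfl⟩ := Submodule.Quotient.mk_surjective _ x
    obtain ⟨a', ha⟩ := Submodule.Quotient.mk_surjective _ a.unop
    obtain ⟨b', hb⟩ := Submodule.Quotient.mk_surjective _ b.unop
    change M.homologyAct _ (A.homologyMul b.unop a.unop) =
      M.homologyAct (M.homologyAct _ b.unop) a.unop
    rw [← ha, ← hb]
    simp only [A.homologyMul_mk, M.homologyAct_mk]
    congr 1
    exact Subtype.ext (mul_smul (MulOpposite.op (a' : A)) (MulOpposite.op (b' : A)) (x : M))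

/-- The homology `H(M)` as a right module over `H(A)`. -/
noncomputable def DGRightModule.homology : DGRightModule.{v, w, w'} A.homology :=
  letI : Module (A.homology.carrier)ᵐᵒᵖ (Homology M.d) := M.homologyModule
  { carrier := Homology M.d
    isScalarTower := ⟨fun c a x => map_smul (M.homologyAct x) c a.unop⟩
    gr := Homology.gr M.gr M.d
    d := 0
    isComplex := Homology.isComplex M.isComplex
    smul_mem := by
      rintro m n _ _ ⟨x, hx, rfl⟩ ⟨a, ha, rfl⟩
      exact ⟨⟨MulOpposite.op (a : A) • (x : M), M.op_smul_mem_ker x a⟩,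
        M.smul_mem m n _ _ hx ha, (M.homologyAct_mk x a).symm⟩
    leibniz := by
      intro m x a _
      have : A.homology.d a = 0 := rfl
      rw [this]
      simp }

end HomologyAlgebra

/-! ### Singular chains and cochains -/

section Simplicial

open CategoryTheory Simplicial Finset

universe u

variable (k) (S : SSet.{u})

section Operators

variable {S}

/-- The simplex with vertices `v_(φ 0), …, v_(φ m)`. -/
def pull {m n : ℕ} (φ : Fin (m + 1) →o Fin (n + 1)) (σ : S _⦋n⦌) : S _⦋m⦌ :=
  S.map (SimplexCategory.mkHom φ).op σ

theorem pull_pull {l m n : ℕ} (φ : Fin (l + 1) →o Fin (m + 1)) (ψ : Fin (m + 1) →o Fin (n + 1))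
    (σ : S _⦋n⦌) : pull φ (pull ψ σ) = pull (ψ.comp φ) σ := by
  change _ = S.map ((SimplexCategory.mkHom φ ≫ SimplexCategory.mkHom ψ).op) σ
  rw [op_comp, S.map_comp]
  rfl

theorem pull_id {n : ℕ} (σ : S _⦋n⦌) : pull OrderHom.id σ = σ := by
  change S.map (𝟙 (Opposite.op ⦋n⦌)) σ = σ
  rw [S.map_id]
  rfl

/-- The map `j ↦ a + j`, cut off at `n`. -/
def segHom (a m n : ℕ) : Fin (m + 1) →o Fin (n + 1) where
  toFun j := ⟨min (a + j) n, by omega⟩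
  monotone' i j h := by
    have : (i : ℕ) ≤ j := h
    simp only [Fin.mk_le_mk]
    omega

/-- The increasing map that omits the value `i`. -/
def faceHom (i n : ℕ) : Fin (n + 1) →o Fin (n + 2) where
  toFun j := ⟨if (j : ℕ) < i then j else j + 1, by split <;> omega⟩
  monotone' i j h := by
    have : (i : ℕ) ≤ j := h
    simp only [Fin.mk_le_mk]
    split <;> split <;> omega

theorem segHom_val (a m n : ℕ) (j : Fin (m + 1)) : (segHom a m n j : ℕ) = min (a + j) n := rfl

theorem faceHom_val (i n : ℕ) (j : Fin (n + 1)) :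
    (faceHom i n j : ℕ) = if (j : ℕ) < i then (j : ℕ) else j + 1 := rfl

/-- For a simplex `σ = [v_0, …, v_n]` and `a + m ≤ n`, the simplex `[v_a, …, v_(a + m)]`.
(Otherwise the missing vertices are replaced by `v_n`; such values are never used.) -/
def seg {n : ℕ} (σ : S _⦋n⦌) (a m : ℕ) : S _⦋m⦌ := pull (segHom a m n) σ

/-- The simplex `[v_0, …, v_(i-1), v_(i+1), …, v_(n+1)]`. -/
def face {n : ℕ} (σ : S _⦋n + 1⦌) (i : ℕ) : S _⦋n⦌ := pull (faceHom i n) σ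

theorem face_eq {n : ℕ} (σ : S _⦋n + 1⦌) (i : Fin (n + 2)) : face σ i = S.δ i σ := by
  change pull _ σ = pull (Fin.succAboveOrderEmb i).toOrderHom σ
  refine congrArg (fun φ => pull φ σ) (OrderHom.ext _ _ (funext fun j => Fin.ext ?_))
  change (if (j : ℕ) < i then (j : ℕ) else j + 1) = (Fin.succAbove i j : Fin (n + 2))
  simp only [Fin.succAbove, Fin.lt_def, Fin.val_castSucc]
  split <;> simp

theorem pull_congr {m n : ℕ} {φ ψ : Fin (m + 1) →o Fin (n + 1)} (σ : S _⦋n⦌)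
    (h : ∀ j, (φ j : ℕ) = ψ j) : pull φ σ = pull ψ σ := by
  have : φ = ψ := by ext j; exact h j
  rw [this]

theorem seg_seg {n : ℕ} (σ : S _⦋n⦌) (a m b l : ℕ) (h : b + l ≤ m) :
    seg (seg σ a m) b l = seg σ (a + b) l := by
  unfold seg
  rw [pull_pull]
  refine pull_congr _ fun j => ?_
  have := j.2
  simp only [OrderHom.comp_coe, Function.comp_apply, segHom_val]
  omega

theorem seg_full {n : ℕ} (σ : S _⦋n⦌) : seg σ 0 n = σ := by
  refine Eq.trans (pull_congr _ fun j => ?_) (pull_id σ)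
  have := j.2
  simp only [segHom_val, OrderHom.id_coe, id]
  omega

theorem face_face {n : ℕ} (σ : S _⦋n + 2⦌) (i j : ℕ) (h : i ≤ j) :
    face (face σ i) j = face (face σ (j + 1)) i := by
  unfold face
  rw [pull_pull, pull_pull]
  refine pull_congr _ fun l => ?_
  simp only [OrderHom.comp_coe, Function.comp_apply, faceHom_val]
  grind

theorem seg_face_left {n : ℕ} (σ : S _⦋n + 1⦌) (i p : ℕ) (hp : p ≤ n) :
    seg (face σ i) 0 p = face (seg σ 0 (p + 1)) i := by
  unfold face seg
  rw [pull_pull, pull_pull]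
  refine pull_congr _ fun l => ?_
  have := l.2
  simp only [OrderHom.comp_coe, Function.comp_apply, segHom_val, faceHom_val]
  grind

theorem seg_face_left' {n : ℕ} (σ : S _⦋n + 1⦌) (i p : ℕ) (hp : p ≤ n) (hi : p < i) :
    seg (face σ i) 0 p = seg σ 0 p := by
  unfold face seg
  rw [pull_pull]
  refine pull_congr _ fun l => ?_
  have := l.2
  simp only [OrderHom.comp_coe, Function.comp_apply, segHom_val, faceHom_val]
  grind

theorem seg_face_right {n : ℕ} (σ : S _⦋n + 1⦌) (i p q : ℕ) (hp : p + q = n) (hi : i ≤ p) :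
    seg (face σ i) p q = seg σ (p + 1) q := by
  unfold face seg
  rw [pull_pull]
  refine pull_congr _ fun l => ?_
  have := l.2
  simp only [OrderHom.comp_coe, Function.comp_apply, segHom_val, faceHom_val]
  grind

theorem seg_face_right' {n : ℕ} (σ : S _⦋n + 1⦌) (i p q : ℕ) (hp : p + q = n) :
    seg (face σ (p + i)) p q = face (seg σ p (q + 1)) i := by
  unfold face seg
  rw [pull_pull, pull_pull]
  refine pull_congr _ fun l => ?_
  have := l.2
  simp only [OrderHom.comp_coe, Function.comp_apply, segHom_val, faceHom_val]
  grind

theorem face_seg_last {n : ℕ} (σ : S _⦋n⦌) (p : ℕ) : face (seg σ 0 (p + 1)) (p + 1) = seg σ 0 p := by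
  unfold face seg
  rw [pull_pull]
  refine pull_congr _ fun l => ?_
  have := l.2
  simp only [OrderHom.comp_coe, Function.comp_apply, segHom_val, faceHom_val]
  grind

theorem face_seg_zero {n : ℕ} (σ : S _⦋n⦌) (p q : ℕ) :
    face (seg σ p (q + 1)) 0 = seg σ (p + 1) q := by
  unfold face seg
  rw [pull_pull]
  refine pull_congr _ fun l => ?_
  have := l.2
  simp only [OrderHom.comp_coe, Function.comp_apply, segHom_val, faceHom_val]
  grind

end Operators

/-- Families of `k`-valued cochains on the simplices of `S`, one in each dimension. -/
def FullCochain : Type (max u v) := ∀ n : ℕ, S _⦋n⦌ → k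

noncomputable instance : AddCommGroup (FullCochain k S) :=
  inferInstanceAs (AddCommGroup (∀ n : ℕ, S _⦋n⦌ → k))

noncomputable instance : Module k (FullCochain k S) :=
  inferInstanceAs (Module k (∀ n : ℕ, S _⦋n⦌ → k))

namespace FullCochain

variable {k S}

@[ext] theorem ext {f g : FullCochain k S} (h : ∀ n σ, f n σ = g n σ) : f = g :=
  funext fun n => funext fun σ => h n σ

@[simp] theorem add_apply (f g : FullCochain k S) (n : ℕ) (σ : S _⦋n⦌) :
    (f + g) n σ = f n σ + g n σ := rfl
@[simp] theorem zero_apply (n : ℕ) (σ : S _⦋n⦌) : (0 : FullCochain k S) n σ = 0 := rfl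
@[simp] theorem smul_apply (c : k) (f : FullCochain k S) (n : ℕ) (σ : S _⦋n⦌) :
    (c • f) n σ = c * f n σ := rfl

/-- The cup product, given by the Alexander-Whitney diagonal:
`(f g)(σ) = ∑_{p + q = n} f([v_0, …, v_p]) g([v_p, …, v_n])` for `σ = [v_0, …, v_n]`. -/
def cup (f g : FullCochain k S) : FullCochain k S := fun n σ =>
  ∑ pq ∈ antidiagonal n, f pq.1 (seg σ 0 pq.1) * g pq.2 (seg σ pq.1 pq.2)

/-- The cochain equal to `1` on each vertex. -/
def unit : FullCochain k S := fun n _ => if n = 0 then 1 else 0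

theorem cup_assoc (f g h : FullCochain k S) : cup (cup f g) h = cup f (cup g h) := by
  ext n σ
  simp only [cup, sum_mul, mul_sum]
  rw [sum_sigma', sum_sigma']
  refine sum_nbij' (fun x => ⟨(x.2.1, x.2.2 + x.1.2), (x.2.2, x.1.2)⟩)
    (fun x => ⟨(x.1.1 + x.2.1, x.2.2), (x.1.1, x.2.1)⟩) ?_ ?_ ?_ ?_ ?_
  · rintro ⟨⟨a, b⟩, ⟨c, e⟩⟩ hx
    simp only [mem_sigma, HasAntidiagonal.mem_antidiagonal] at hx ⊢
    obtain ⟨h1, h2⟩ := hx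
    exact ⟨by omega, by trivial⟩
  · rintro ⟨⟨a, b⟩, ⟨c, e⟩⟩ hx
    simp only [mem_sigma, HasAntidiagonal.mem_antidiagonal] at hx ⊢
    obtain ⟨h1, h2⟩ := hx
    exact ⟨by omega, by trivial⟩
  · rintro ⟨⟨a, b⟩, ⟨c, e⟩⟩ hx
    simp only [mem_sigma, HasAntidiagonal.mem_antidiagonal] at hx
    obtain ⟨_, rfl⟩ := hx
    rfl
  · rintro ⟨⟨a, b⟩, ⟨c, e⟩⟩ hx
    simp only [mem_sigma, HasAntidiagonal.mem_antidiagonal] at hx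
    obtain ⟨_, rfl⟩ := hx
    rfl
  · rintro ⟨⟨a, b⟩, ⟨c, e⟩⟩ hx
    simp only [mem_sigma, HasAntidiagonal.mem_antidiagonal] at hx
    obtain ⟨_, rfl⟩ := hx
    dsimp only
    rw [seg_seg _ _ _ _ _ (by omega), seg_seg _ _ _ _ _ (by omega), seg_seg _ _ _ _ _ (by omega),
      seg_seg _ _ _ _ _ (by omega), mul_assoc]
    simp

noncomputable instance : Ring (FullCochain k S) :=
  { (inferInstance : AddCommGroup (FullCochain k S)) with
    mul := cup
    one := unit
    left_distrib := fun f g h => by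
      ext n σ
      change cup f (g + h) n σ = cup f g n σ + cup f h n σ
      simp [cup, mul_add, sum_add_distrib]
    right_distrib := fun f g h => by
      ext n σ
      change cup (f + g) h n σ = cup f h n σ + cup g h n σ
      simp [cup, add_mul, sum_add_distrib]
    zero_mul := fun f => by
      ext n σ
      change cup 0 f n σ = 0
      simp [cup]
    mul_zero := fun f => by
      ext n σ
      change cup f 0 n σ = 0
      simp [cup]
    mul_assoc := cup_assoc
    one_mul := fun f => by
      ext n σ
      change cup unit f n σ = f n σ
      rw [cup, sum_eq_single (0, n)]
      · simp [unit, seg_full]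
      · rintro ⟨a, b⟩ hab hne
        simp only [HasAntidiagonal.mem_antidiagonal] at hab
        have : a ≠ 0 := by
          rintro rfl
          exact hne (by simp_all)
        simp [unit, this]
      · simp
    mul_one := fun f => by
      ext n σ
      change cup f unit n σ = f n σ
      rw [cup, sum_eq_single (n, 0)]
      · simp [unit, seg_full]
      · rintro ⟨a, b⟩ hab hne
        simp only [HasAntidiagonal.mem_antidiagonal] at hab
        have : b ≠ 0 := by
          rintro rfl
          exact hne (by simp_all)
        simp [unit, this]
      · simp }

theorem mul_apply (f g : FullCochain k S) (n : ℕ) (σ : S _⦋n⦌) :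
    (f * g) n σ = ∑ pq ∈ antidiagonal n, f pq.1 (seg σ 0 pq.1) * g pq.2 (seg σ pq.1 pq.2) := rfl

theorem one_apply (n : ℕ) (σ : S _⦋n⦌) : (1 : FullCochain k S) n σ = if n = 0 then 1 else 0 := rfl

noncomputable instance : Algebra k (FullCochain k S) :=
  Algebra.ofModule
    (fun c f g => by
      ext n σ
      simp only [mul_apply, smul_apply, mul_sum, mul_assoc])
    (fun c f g => by
      ext n σ
      simp only [mul_apply, smul_apply, mul_sum, mul_left_comm])

/-- The underlying function of `coboundary`. -/
def coboundaryFun (f : FullCochain k S) : FullCochain k S := fun n => match n with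
  | 0 => fun _ => 0
  | n + 1 => fun σ => ∑ i : Fin (n + 2), (-1) ^ (i : ℕ) * f n (S.δ i σ)

/-- The coboundary `(δ f)(σ) = ∑ i, (-1)^i f(σ with the i-th vertex removed)`. -/
def coboundary : FullCochain k S →ₗ[k] FullCochain k S where
  toFun := coboundaryFun
  map_add' f g := by
    ext n σ
    cases n <;> simp [coboundaryFun, mul_add, sum_add_distrib]
  map_smul' c f := by
    ext n σ
    cases n <;> simp [coboundaryFun, mul_sum, mul_left_comm]

theorem coboundary_zero (f : FullCochain k S) (σ : S _⦋0⦌) : coboundary f 0 σ = 0 := rfl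

theorem coboundary_succ (f : FullCochain k S) (n : ℕ) (σ : S _⦋n + 1⦌) :
    coboundary f (n + 1) σ = ∑ i ∈ range (n + 2), (-1) ^ i * f n (face σ i) := by
  rw [← Fin.sum_univ_eq_sum_range (fun i => (-1) ^ i * f n (face σ i))]
  simp only [face_eq]
  rfl

theorem coboundary_coboundary (f : FullCochain k S) : coboundary (coboundary f) = 0 := by
  ext n σ
  match n with
  | 0 => rfl
  | 1 =>
    rw [coboundary_succ]
    simp [coboundary_zero]
  | n + 2 =>
    simp only [coboundary_succ, mul_sum, zero_apply]
    rw [sum_sigma']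
    refine sum_involution
      (fun x _ => if x.1 ≤ x.2 then ⟨x.2 + 1, x.1⟩ else ⟨x.2, x.1 - 1⟩) ?_ ?_ ?_ ?_
    · rintro ⟨i, j⟩ hx
      simp only
      split
      · rename_i h
        simp only [face_face σ i j h]
        ring
      · rename_i h
        obtain ⟨i, rfl⟩ : ∃ l, i = l + 1 := ⟨i - 1, by omega⟩
        simp only [Nat.add_sub_cancel]
        rw [face_face σ j i (by omega)]
        ring
    · rintro ⟨i, j⟩ hx _
      simp only
      split
      · intro h
        have := congrArg Sigma.fst h
        simp only at this
        omega
      · intro h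
        have := congrArg Sigma.fst h
        simp only at this
        omega
    · rintro ⟨i, j⟩ hx
      simp only [mem_sigma, mem_range] at hx
      simp only
      split <;> simp only [mem_sigma, mem_range] <;> omega
    · rintro ⟨i, j⟩ hx
      simp only
      split
      · rename_i h
        rw [if_neg (by simp only; omega)]
        rfl
      · rename_i h
        rw [if_pos (by simp only; omega)]
        simp only [Sigma.mk.injEq, heq_eq_eq, and_true]
        omega

/-- The sign involution `f ↦ (-1)^(deg f) f`. -/
def sign (f : FullCochain k S) : FullCochain k S := fun n σ => (-1) ^ n * f n σ

theorem coboundary_mul (f g : FullCochain k S) :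
    coboundary (f * g) = coboundary f * g + sign f * coboundary g := by
  ext n σ
  match n with
  | 0 => simp [coboundary_zero, mul_apply]
  | n + 1 =>
    rw [add_apply, mul_apply, mul_apply, coboundary_succ, Nat.sum_antidiagonal_succ,
      Nat.sum_antidiagonal_succ']
    simp only [coboundary_zero, zero_mul, mul_zero, zero_add, mul_apply, sign]
    simp only [coboundary_succ, mul_sum, sum_mul]
    rw [sum_comm, ← sum_add_distrib]
    refine sum_congr rfl ?_
    rintro ⟨p, q⟩ hpq
    simp only [HasAntidiagonal.mem_antidiagonal] at hpq
    simp only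
    subst hpq
    have e1 : p + q + 2 = (p + 1) + (q + 1) := by ring
    rw [e1, sum_range_add, sum_range_succ (n := p + 1), sum_range_succ' (n := q + 1)]
    rw [face_seg_last, face_seg_zero]
    have h1 : ∀ i ∈ range (p + 1), (-1 : k) ^ i * (f p (seg (face σ i) 0 p) *
        g q (seg (face σ i) p q)) =
        (-1) ^ i * f p (face (seg σ 0 (p + 1)) i) * g q (seg σ (p + 1) q) := by
      intro i hi
      rw [mem_range] at hi
      rw [seg_face_left _ _ _ (by omega), seg_face_right _ _ _ _ rfl (by omega), mul_assoc]
    have h2 : ∀ i ∈ range (q + 1), (-1 : k) ^ (p + 1 + i) * (f p (seg (face σ (p + 1 + i)) 0 p) *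
        g q (seg (face σ (p + 1 + i)) p q)) =
        (-1) ^ p * f p (seg σ 0 p) * ((-1) ^ (i + 1) * g q (face (seg σ p (q + 1)) (i + 1))) := by
      intro i hi
      rw [seg_face_left' _ _ _ (by omega) (by omega), add_assoc p 1 i, 
        seg_face_right' _ _ _ _ rfl, add_comm 1 i]
      ring
    rw [sum_congr rfl h1, sum_congr rfl h2]
    ring

end FullCochain

/-- The cochains on `S`: the finite sums of cochains of the various degrees `n`, a cochain of
degree `n` being a function on the `n`-simplices of `S`. -/
def boundedCochains : Subalgebra k (FullCochain k S) where
  carrier := {f | ∃ N : ℕ, ∀ n, N < n → ∀ σ, f n σ = 0}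
  add_mem' := by
    rintro f g ⟨M, hM⟩ ⟨N, hN⟩
    refine ⟨M + N, fun n hn σ => ?_⟩
    rw [FullCochain.add_apply, hM n (by omega), hN n (by omega), add_zero]
  mul_mem' := by
    rintro f g ⟨M, hM⟩ ⟨N, hN⟩
    refine ⟨M + N, fun n hn σ => ?_⟩
    rw [FullCochain.mul_apply]
    refine sum_eq_zero fun pq h => ?_
    rw [HasAntidiagonal.mem_antidiagonal] at h
    by_cases hp : M < pq.1
    · rw [hM _ hp, zero_mul]
    · rw [hN _ (by omega), mul_zero]
  algebraMap_mem' c := by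
    refine ⟨0, fun n hn σ => ?_⟩
    rw [Algebra.algebraMap_eq_smul_one, FullCochain.smul_apply, FullCochain.one_apply,
      if_neg (by omega), mul_zero]

namespace FullCochain

variable {k S}

/-- The underlying function of `component`. -/
def componentFun (m : ℤ) (f : FullCochain k S) : FullCochain k S := fun n σ =>
  if (n : ℤ) = m then f n σ else 0

/-- The component of degree `m`. -/
def component (m : ℤ) : FullCochain k S →ₗ[k] FullCochain k S where
  toFun := componentFun m
  map_add' f g := by
    ext n σ
    by_cases h : (n : ℤ) = m <;> simp [componentFun, h]
  map_smul' c f := by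
    ext n σ
    by_cases h : (n : ℤ) = m <;> simp [componentFun, h]

theorem component_apply (m : ℤ) (f : FullCochain k S) (n : ℕ) (σ : S _⦋n⦌) :
    component m f n σ = if (n : ℤ) = m then f n σ else 0 := rfl

theorem sum_apply {ι : Type*} (s : Finset ι) (f : ι → FullCochain k S) (n : ℕ) (σ : S _⦋n⦌) :
    (∑ i ∈ s, f i) n σ = ∑ i ∈ s, f i n σ := by
  classical
  induction s using Finset.induction_on with
  | empty => simp
  | insert a s ha ih => rw [sum_insert ha, sum_insert ha, add_apply, ih]

theorem component_mem (m : ℤ) (f : FullCochain k S) (hf : f ∈ boundedCochains k S) :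
    component m f ∈ boundedCochains k S := by
  obtain ⟨N, hN⟩ := hf
  refine ⟨N, fun n hn σ => ?_⟩
  rw [component_apply, hN n hn, ite_self]

theorem coboundary_mem (f : FullCochain k S) (hf : f ∈ boundedCochains k S) :
    coboundary f ∈ boundedCochains k S := by
  obtain ⟨N, hN⟩ := hf
  refine ⟨N + 1, fun n hn σ => ?_⟩
  obtain ⟨n, rfl⟩ : ∃ l, n = l + 1 := ⟨n - 1, by omega⟩
  rw [coboundary_succ]
  exact sum_eq_zero fun i _ => by rw [hN n (by omega), mul_zero]

theorem sign_mul (f g : FullCochain k S) : sign (f * g) = sign f * sign g := by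
  ext n σ
  simp only [sign, mul_apply, mul_sum]
  refine sum_congr rfl fun pq h => ?_
  rw [HasAntidiagonal.mem_antidiagonal] at h
  have e : (-1 : k) ^ n = (-1) ^ pq.1 * (-1) ^ pq.2 := by rw [← pow_add, h]
  rw [e]
  ring

theorem sign_sign (f : FullCochain k S) : sign (sign f) = f := by
  ext n σ
  simp only [sign, ← mul_assoc, ← pow_add]
  rw [Even.neg_one_pow ⟨n, rfl⟩, one_mul]

theorem sign_add (f g : FullCochain k S) : sign (f + g) = sign f + sign g := by
  ext n σ
  simp only [sign, add_apply, mul_add]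

theorem negOnePow_smul_apply (m : ℕ) (f : FullCochain k S) (n : ℕ) (σ : S _⦋n⦌) :
    ((m : ℤ).negOnePow • f) n σ = (-1) ^ m * f n σ := by
  rcases Nat.even_or_odd m with h | h
  · rw [Int.negOnePow_even _ (by exact_mod_cast h), h.neg_one_pow, one_smul, one_mul]
  · rw [Int.negOnePow_odd _ (by exact_mod_cast h), h.neg_one_pow, Units.neg_smul, one_smul,
      neg_one_mul]
    rfl

end FullCochain

/-- The cochains of degree `m`. -/
def cochainGr (m : ℤ) : Submodule k (boundedCochains k S) where
  carrier := {f | ∀ n : ℕ, (n : ℤ) ≠ m → ∀ σ, (f : FullCochain k S) n σ = 0}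
  add_mem' hf hg n hn σ := by
    rw [AddMemClass.coe_add, FullCochain.add_apply, hf n hn, hg n hn, add_zero]
  zero_mem' _ _ _ := rfl
  smul_mem' c f hf n hn σ := by
    rw [SetLike.val_smul, FullCochain.smul_apply, hf n hn, mul_zero]

theorem cochainGr_isInternal : DirectSum.IsInternal (cochainGr k S) := by
  refine isInternal_of_proj (fun m => (FullCochain.component m).restrict
    (p := (boundedCochains k S).toSubmodule) (q := (boundedCochains k S).toSubmodule)
    (FullCochain.component_mem m)) ?_ ?_ ?_
  · intro m f hf
    refine Subtype.ext (FullCochain.ext fun n σ => ?_)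
    change FullCochain.component m f.1 n σ = f.1 n σ
    rw [FullCochain.component_apply]
    split
    · rfl
    · rename_i h
      exact (hf n h σ).symm
  · intro n m hmn f hf
    refine Subtype.ext (FullCochain.ext fun l σ => ?_)
    change FullCochain.component n f.1 l σ = 0
    rw [FullCochain.component_apply]
    split
    · rename_i h
      exact hf l (by omega) σ
    · rfl
  · rintro ⟨f, hf⟩
    obtain ⟨N, hN⟩ := id hf
    have e : (⟨f, hf⟩ : boundedCochains k S) = ∑ m ∈ range (N + 1),
        ⟨FullCochain.component (m : ℤ) f, FullCochain.component_mem _ f hf⟩ := by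
      refine Subtype.ext (FullCochain.ext fun n σ => ?_)
      rw [AddSubmonoidClass.coe_finsetSum, FullCochain.sum_apply]
      simp only [FullCochain.component_apply, Nat.cast_inj]
      rw [sum_ite_eq]
      split
      · rfl
      · rename_i h
        exact hN n (by simpa using h) σ
    rw [e]
    refine Submodule.sum_mem _ fun m _ => Submodule.mem_iSup_of_mem (m : ℤ) fun n hn σ => ?_
    exact if_neg hn

/-- The differential graded algebra of cochains on a simplicial set, with the cup product. -/
noncomputable def cochainAlgebra : DGAlgebra.{v, max u v} k where
  carrier := boundedCochains k S
  gr := cochainGr k S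
  d := FullCochain.coboundary.restrict
    (p := (boundedCochains k S).toSubmodule) (q := (boundedCochains k S).toSubmodule)
    FullCochain.coboundary_mem
  isComplex :=
    { internal := cochainGr_isInternal k S
      d_mem := by
        intro m f hf n hn σ
        change FullCochain.coboundary f.1 n σ = 0
        cases n with
        | zero => rfl
        | succ n =>
          rw [FullCochain.coboundary_succ]
          exact sum_eq_zero fun i _ => by rw [hf n (by push_cast at hn; omega), mul_zero]
      d_d := fun f => Subtype.ext (FullCochain.coboundary_coboundary f.1) }
  one_mem := by
    intro n hn σ
    exact if_neg (by exact_mod_cast hn)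
  mul_mem := by
    intro a b f g hf hg n hn σ
    rw [MulMemClass.coe_mul, FullCochain.mul_apply]
    refine sum_eq_zero fun pq h => ?_
    rw [HasAntidiagonal.mem_antidiagonal] at h
    by_cases hp : (pq.1 : ℤ) = a
    · rw [hg pq.2 (by omega), mul_zero]
    · rw [hf pq.1 hp, zero_mul]
  leibniz := by
    intro m f g hf
    refine Subtype.ext ?_
    change FullCochain.coboundary (f.1 * g.1) =
      FullCochain.coboundary f.1 * g.1 + m.negOnePow • (f.1 * FullCochain.coboundary g.1)
    rw [FullCochain.coboundary_mul]
    congr 1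
    by_cases hm : 0 ≤ m
    · obtain ⟨m, rfl⟩ := Int.eq_ofNat_of_zero_le hm
      ext n σ
      rw [FullCochain.negOnePow_smul_apply, FullCochain.mul_apply, FullCochain.mul_apply, mul_sum]
      refine sum_congr rfl fun pq _ => ?_
      by_cases h : (pq.1 : ℤ) = m
      · have h' : pq.1 = m := by exact_mod_cast h
        rw [FullCochain.sign, h', mul_assoc]
      · rw [FullCochain.sign, hf pq.1 h]
        ring
    · have h0 : f.1 = 0 := FullCochain.ext fun n σ => hf n (by omega) σ
      have h1 : FullCochain.sign f.1 = 0 := by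
        rw [h0]
        exact FullCochain.ext fun n σ => mul_zero _
      rw [h1, h0, zero_mul]
      exact (smul_zero _).symm

/-- The augmentation of the cochain algebra given by a vertex `x`. -/
noncomputable def cochainAugmentation (x : S _⦋0⦌) : (cochainAlgebra k S).Augmentation where
  toAlgHom := AlgHom.ofLinearMap
    { toFun := fun f : boundedCochains k S => (f : FullCochain k S) 0 x
      map_add' := fun _ _ => rfl
      map_smul' := fun _ _ => rfl }
    (by change (1 : FullCochain k S) 0 x = 1; simp [FullCochain.one_apply])
    (fun f g => by
      change (f.1 * g.1 : FullCochain k S) 0 x = f.1 0 x * g.1 0 x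
      rw [FullCochain.mul_apply, Nat.antidiagonal_zero, sum_singleton, seg_full])
  map_gr n hn f hf := hf 0 (by exact_mod_cast hn.symm) x
  map_d _ := rfl

/-- The chains on `S`: formal linear combinations of simplices. -/
abbrev Chain : Type (max u v) := (Σ n : ℕ, S _⦋n⦌) →₀ k

namespace Chain

variable {k S}

/-- The value of a cochain on a chain. -/
noncomputable def ev (g : FullCochain k S) : Chain k S →ₗ[k] k :=
  Finsupp.linearCombination k fun x => g x.1 x.2

theorem ev_single (g : FullCochain k S) (x : Σ n : ℕ, S _⦋n⦌) (c : k) :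
    ev g (Finsupp.single x c) = c * g x.1 x.2 := by
  simp [ev]

theorem ev_add (f g : FullCochain k S) (z : Chain k S) : ev (f + g) z = ev f z + ev g z := by
  induction z using Finsupp.induction_linear with
  | zero => simp
  | add x y hx hy => simp only [map_add, hx, hy]; ring
  | single x c => simp only [ev_single, FullCochain.add_apply, mul_add]

open Classical in
/-- The indicator function of a simplex. -/
noncomputable def indicator (x : Σ n : ℕ, S _⦋n⦌) : FullCochain k S := fun n σ =>
  if (⟨n, σ⟩ : Σ n : ℕ, S _⦋n⦌) = x then 1 else 0

theorem ext_ev {z w : Chain k S} (h : ∀ g, ev g z = ev g w) : z = w := by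
  classical
  refine Finsupp.ext fun x => ?_
  have key : ∀ z : Chain k S, ev (indicator x) z = z x := by
    intro z
    induction z using Finsupp.induction_linear with
    | zero => simp
    | add x y hx hy => simp only [map_add, hx, hy, Finsupp.add_apply]
    | single y c =>
      rw [ev_single, Finsupp.single_apply, indicator]
      split <;> simp_all
  rw [← key, ← key, h]

/-- The boundary of a simplex. -/
noncomputable def boundarySimplex (x : Σ n : ℕ, S _⦋n⦌) : Chain k S := match x with
  | ⟨0, _⟩ => 0
  | ⟨n + 1, σ⟩ => ∑ i : Fin (n + 2), Finsupp.single ⟨n, S.δ i σ⟩ ((-1) ^ (i : ℕ))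

/-- The differential of the chain complex: `(-1)^(n+1)` times the alternating sum of the faces
on simplices of dimension `n`. With this sign the cap product satisfies the Leibniz rule of a
right module over the cochain algebra. -/
noncomputable def differential : Chain k S →ₗ[k] Chain k S :=
  Finsupp.linearCombination k fun x => (-1 : k) ^ (x.1 + 1) • boundarySimplex x

/-- The cap product of a simplex with a cochain:
`[v_0, …, v_n] ∩ f = ∑_{p + q = n} f([v_0, …, v_p]) [v_p, …, v_n]`. -/
noncomputable def capSimplex (f : FullCochain k S) (x : Σ n : ℕ, S _⦋n⦌) : Chain k S :=
  ∑ pq ∈ antidiagonal x.1, Finsupp.single ⟨pq.2, seg x.2 pq.1 pq.2⟩ (f pq.1 (seg x.2 0 pq.1))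

/-- The cap product with a cochain. -/
noncomputable def cap (f : FullCochain k S) : Chain k S →ₗ[k] Chain k S :=
  Finsupp.linearCombination k (capSimplex f)

theorem ev_cap (f g : FullCochain k S) (z : Chain k S) : ev g (cap f z) = ev (f * g) z := by
  induction z using Finsupp.induction_linear with
  | zero => simp
  | add x y hx hy => simp only [map_add, hx, hy]
  | single x c =>
    rw [cap, Finsupp.linearCombination_single, map_smul, ev_single, capSimplex, map_sum,
      FullCochain.mul_apply]
    simp only [ev_single, smul_eq_mul]

theorem ev_boundarySimplex (g : FullCochain k S) (x : Σ n : ℕ, S _⦋n⦌) :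
    ev g (boundarySimplex x) = FullCochain.coboundary g x.1 x.2 := by
  obtain ⟨n, σ⟩ := x
  cases n with
  | zero => exact map_zero _
  | succ n =>
    rw [boundarySimplex, map_sum]
    simp only [ev_single]
    rfl

theorem ev_differential (g : FullCochain k S) (z : Chain k S) :
    ev g (differential z) = -ev (FullCochain.sign (FullCochain.coboundary g)) z := by
  induction z using Finsupp.induction_linear with
  | zero => simp
  | add x y hx hy => simp only [map_add, hx, hy]; ring
  | single x c =>
    rw [differential, Finsupp.linearCombination_single, map_smul, map_smul, ev_boundarySimplex,
      ev_single, FullCochain.sign, pow_succ]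
    simp only [smul_eq_mul]
    ring

/-- The chains of cohomological degree `m`: the combinations of simplices of dimension `-m`. -/
def gr (k : Type v) [Field k] (S : SSet.{u}) (m : ℤ) : Submodule k (Chain k S) where
  carrier := {z | ∀ x, -(x.1 : ℤ) ≠ m → z x = 0}
  add_mem' hz hw x hx := by rw [Finsupp.add_apply, hz x hx, hw x hx, add_zero]
  zero_mem' _ _ := rfl
  smul_mem' c z hz x hx := by rw [Finsupp.smul_apply, hz x hx, smul_zero]

theorem single_mem (x : Σ n : ℕ, S _⦋n⦌) (c : k) (m : ℤ) (h : -(x.1 : ℤ) = m) :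
    Finsupp.single x c ∈ gr k S m := by
  classical
  intro y hy
  rw [Finsupp.single_apply, if_neg]
  rintro rfl
  exact hy h

theorem gr_induction {m : ℤ} {p : Chain k S → Prop} (z : Chain k S) (hz : z ∈ gr k S m)
    (h0 : p 0) (hadd : ∀ z w, p z → p w → p (z + w))
    (hsingle : ∀ (x : Σ n : ℕ, S _⦋n⦌) (c : k), -(x.1 : ℤ) = m → p (Finsupp.single x c)) : p z := by
  classical
  rw [← Finsupp.sum_single z]
  refine Finset.sum_induction _ p hadd h0 fun x hx => hsingle x _ ?_
  by_contra h
  exact (Finsupp.mem_support_iff.1 hx) (hz x h)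

theorem isInternal : DirectSum.IsInternal (gr k S) := by
  classical
  refine isInternal_of_proj
    (fun m => Finsupp.linearCombination k fun x => if -(x.1 : ℤ) = m then Finsupp.single x 1 else 0)
    ?_ ?_ ?_
  · intro m z hz
    refine gr_induction (p := fun z => Finsupp.linearCombination k
      (fun x : Σ n : ℕ, S _⦋n⦌ => if -(x.1 : ℤ) = m then Finsupp.single x (1 : k) else 0) z = z)
      z hz (map_zero _) (fun z w h1 h2 => by rw [map_add, h1, h2]) ?_
    intro x c h
    simp [h]
  · intro n m hmn z hz
    refine gr_induction (p := fun z => Finsupp.linearCombination k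
      (fun x : Σ n : ℕ, S _⦋n⦌ => if -(x.1 : ℤ) = n then Finsupp.single x (1 : k) else 0) z = 0)
      z hz (map_zero _) (fun z w h1 h2 => by rw [map_add, h1, h2, add_zero]) ?_
    intro x c h
    rw [Finsupp.linearCombination_single, if_neg (by omega), smul_zero]
  · intro z
    induction z using Finsupp.induction_linear with
    | zero => exact Submodule.zero_mem _
    | add x y hx hy => exact Submodule.add_mem _ hx hy
    | single x c => exact Submodule.mem_iSup_of_mem _ (single_mem x c _ rfl)

theorem isComplex : IsComplex (gr k S) (differential : Chain k S →ₗ[k] Chain k S) where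
  internal := isInternal
  d_mem m z hz := by
    refine gr_induction (p := fun z => differential z ∈ gr k S (m + 1)) z hz ?_ ?_ ?_
    · rw [map_zero]; exact Submodule.zero_mem _
    · intro z w h1 h2
      rw [map_add]; exact Submodule.add_mem _ h1 h2
    · rintro ⟨n, σ⟩ c h
      rw [differential, Finsupp.linearCombination_single]
      refine Submodule.smul_mem _ _ (Submodule.smul_mem _ _ ?_)
      cases n with
      | zero => exact Submodule.zero_mem _
      | succ n =>
        refine Submodule.sum_mem _ fun i _ => single_mem _ _ _ ?_
        simp only at h ⊢
        push_cast at h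
        omega
  d_d z := by
    refine ext_ev fun g => ?_
    rw [ev_differential, ev_differential, neg_neg, map_zero]
    have : FullCochain.coboundary (FullCochain.sign (FullCochain.coboundary g)) = 0 := by
      ext n σ
      cases n with
      | zero => rfl
      | succ n =>
        have h : FullCochain.coboundary (FullCochain.coboundary g) (n + 1) σ = 0 := by
          rw [FullCochain.coboundary_coboundary]; rfl
        rw [FullCochain.coboundary_succ] at h ⊢
        rw [FullCochain.zero_apply, ← mul_zero ((-1 : k) ^ n), ← h, mul_sum]
        refine sum_congr rfl fun i _ => ?_
        rw [FullCochain.sign]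
        ring
    rw [this]
    induction z using Finsupp.induction_linear with
    | zero => simp
    | add x y hx hy => rw [map_add, hx, hy, add_zero]
    | single x c => rw [ev_single, FullCochain.sign, FullCochain.zero_apply]; ring

theorem cap_mem (m n : ℤ) (z : Chain k S) (f : boundedCochains k S) (hz : z ∈ gr k S m)
    (hf : f ∈ cochainGr k S n) : cap f.1 z ∈ gr k S (m + n) := by
  refine gr_induction (p := fun z => cap f.1 z ∈ gr k S (m + n)) z hz ?_ ?_ ?_
  · rw [map_zero]; exact Submodule.zero_mem _
  · intro z w h1 h2
    rw [map_add]; exact Submodule.add_mem _ h1 h2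
  · rintro ⟨l, σ⟩ c h
    rw [cap, Finsupp.linearCombination_single]
    refine Submodule.smul_mem _ _ (Submodule.sum_mem _ fun pq hpq => ?_)
    rw [HasAntidiagonal.mem_antidiagonal] at hpq
    simp only at h hpq ⊢
    by_cases hp : (pq.1 : ℤ) = n
    · exact single_mem _ _ _ (by simp only; omega)
    · rw [hf pq.1 hp, Finsupp.single_zero]
      exact Submodule.zero_mem _

theorem differential_cap (m : ℤ) (z : Chain k S) (hz : z ∈ gr k S m) (f : FullCochain k S) :
    differential (cap f z) =
      cap f (differential z) + m.negOnePow • cap (FullCochain.coboundary f) z := by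
  refine ext_ev fun g => ?_
  rw [map_add, Units.smul_def, map_zsmul]
  rw [ev_differential, ev_cap, ev_cap, ev_differential, ev_cap, FullCochain.coboundary_mul,
    FullCochain.sign_add, FullCochain.sign_mul (FullCochain.sign f), FullCochain.sign_sign, ev_add]
  have : ev (FullCochain.sign (FullCochain.coboundary f * g)) z =
      ((m.negOnePow : ℤˣ) : ℤ) • ev (FullCochain.coboundary f * g) z := by
    refine gr_induction (p := fun z => ev (FullCochain.sign (FullCochain.coboundary f * g)) z =
      ((m.negOnePow : ℤˣ) : ℤ) • ev (FullCochain.coboundary f * g) z) z hz (by simp)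
      (fun z w h1 h2 => by rw [map_add, map_add, h1, h2, smul_add]) ?_
    rintro ⟨n, σ⟩ c rfl
    rw [ev_single, ev_single, FullCochain.sign, Int.negOnePow_neg, Int.coe_negOnePow_natCast,
      zsmul_eq_mul]
    push_cast
    ring
  rw [this]
  ring

end Chain

/-- The chains as a right differential graded module over the cochain algebra, by the cap
product. -/
noncomputable def chainModule : DGRightModule.{v, max u v, max u v} (cochainAlgebra k S) :=
  letI : Module (cochainAlgebra k S).carrierᵐᵒᵖ (Chain k S) :=
    { smul := fun a z => Chain.cap (show boundedCochains k S from a.unop).1 z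
      smul_zero := fun a => map_zero (Chain.cap _)
      smul_add := fun a => map_add (Chain.cap _)
      zero_smul := fun z => Chain.ext_ev fun g => by
        refine (Chain.ev_cap 0 g z).trans ?_
        rw [zero_mul, ← sub_self (0 : FullCochain k S), map_zero]
        have := Chain.ev_add (0 : FullCochain k S) 0 z
        rw [add_zero] at this
        rw [sub_self]
        exact left_eq_add.1 this
      add_smul := fun a b z => Chain.ext_ev fun g => by
        refine (Chain.ev_cap (a.unop.1 + b.unop.1) g z).trans ?_
        rw [add_mul, Chain.ev_add, map_add]
        exact congrArg₂ _ (Chain.ev_cap _ _ _).symm (Chain.ev_cap _ _ _).symm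
      one_smul := fun z => Chain.ext_ev fun g => by
        refine (Chain.ev_cap 1 g z).trans ?_
        rw [one_mul]
      mul_smul := fun a b z => Chain.ext_ev fun g => by
        refine (Chain.ev_cap (b.unop.1 * a.unop.1) g z).trans ?_
        refine Eq.trans ?_ (Chain.ev_cap a.unop.1 g _).symm
        refine Eq.trans ?_ (Chain.ev_cap b.unop.1 _ z).symm
        rw [mul_assoc] }
  { carrier := Chain k S
    isScalarTower := ⟨fun c a z => Chain.ext_ev fun g => by
      refine (Chain.ev_cap (c • a.unop.1) g z).trans ?_
      rw [map_smul]
      refine Eq.trans ?_ (congrArg (c • ·) (Chain.ev_cap a.unop.1 g z).symm)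
      rw [smul_mul_assoc]
      induction z using Finsupp.induction_linear with
      | zero => simp
      | add x y hx hy => simp only [map_add, hx, hy, smul_add]
      | single x e =>
        simp only [Chain.ev_single, FullCochain.smul_apply, smul_eq_mul]
        ring⟩
    gr := Chain.gr k S
    d := Chain.differential
    isComplex := Chain.isComplex
    smul_mem := fun m n z f hz hf => Chain.cap_mem m n z f hz hf
    leibniz := fun m z f hz => Chain.differential_cap m z hz f.1 }

end Simplicial

/-! ### Spaces -/

section Spaces

open CategoryTheory Simplicial

universe u

variable (k) (X : Type u) [TopologicalSpace X]

/-- The singular cochain algebra `C^*(X)`. -/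
noncomputable def singularCochains : DGAlgebra.{v, max u v} k :=
  cochainAlgebra k (TopCat.toSSet.obj (TopCat.of X))

/-- The singular chains `C_*(X)`, a right `C^*(X)`-module by the cap product; the chains of
dimension `n` have degree `-n`. -/
noncomputable def singularChains : DGRightModule.{v, max u v, max u v} (singularCochains k X) :=
  chainModule k (TopCat.toSSet.obj (TopCat.of X))

/-- The singular cohomology algebra `H^*(X)`. -/
noncomputable def singularCohomology : DGAlgebra.{v, max u v} k := (singularCochains k X).homology

/-- The singular homology `H_*(X)`, a right `H^*(X)`-module by the cap product; the classes of
dimension `n` have degree `-n`. -/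
noncomputable def singularHomology : DGRightModule.{v, max u v, max u v} (singularCohomology k X) :=
  (singularChains k X).homology

variable {X}

/-- The augmentation of `C^*(X)` given by a base point: restriction of cochains to the base
point. -/
noncomputable def singularAugmentation (x₀ : X) : (singularCochains k X).Augmentation :=
  cochainAugmentation k (TopCat.toSSet.obj (TopCat.of X))
    ((TopCat.toSSetObjEquiv (TopCat.of X) (Opposite.op ⦋0⦌)).symm (ContinuousMap.const _ x₀))

end Spaces

end Gor

/-!
Write `A = C^*(X)` and `L = C_*(X)`. All three conditions are equivalent to

* (F) `L` is quasi-free of rank one: for some homogeneous cycle `ω` of `L`, the map `a ↦ ω a`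
  from `A` to `L` is a quasi-isomorphism,

which only depends on homology: it says that `H_*(X)` is a free `H^*(X)`-module on one homogeneous
class (`DGRightModule.isQuasiFree_homology_iff`).

*Ext and Tor.* Evaluation identifies `A` with the graded dual of `L`, compatibly with the actions
(`isDualPairing_chainPairing`). Hence `Hom_A(P, A)` is the graded dual of `L ⊗_A P` for every
semifree `P`, and `Ext_A(k, A)` is the graded dual of `Tor^A(k, L)`; one is of dimension one if and
only if the other is (`isGorenstein_iff`).

*Tor of dimension one.* For a cohomologically connected algebra `A` and a right module `L` with
bounded below homology, `dim Tor^A(k, L) = 1` if and only if (F) holds (`dimTorEq_one_iff`). This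
applies to `C_*(X)` over `C^*(X)` and to `H_*(X)` over `H^*(X)`. That (F) is sufficient follows by
filtering a semifree resolution by its layers. For the converse, take a class `ω` of lowest degree
in `H(L)`. A semifree resolution of `k` can be chosen with a basis in nonnegative degrees, one
element of which, of degree `0`, is a cycle generating the homology; therefore nonzero classes of
lowest degree survive in `Tor` (`ConnectedModel.mem_range_of_single_mem_range`). So `ω` generates
`Tor(k, L)`, and `Tor(k, cone) = 0` for the mapping cone of `a ↦ ω a`. If the cone were not acyclic,
its own lowest class would survive in `Tor`; so it is acyclic, which is (F).

The resolution of `k` is a bar construction. As `A` is only connected in cohomology, it uses a basis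
of the augmentation ideal of a quasi-isomorphic subalgebra that is `k` in degree `0`
(`ConnectedModel`). Instead of writing down the bar differential, it is defined by recursion on the
length of words from the contracting homotopy that it should have (`ConnectedModel.D`). Weights `2`
and `3` on the basis, with boundaries combinations of cycles of weight `2`, make the words into
the layers of a semifree module.

*Poincaré duality.* When the differentials vanish and `A` is dual to `L`, an element `ω` of
degree `-m` of `L` defines the functional `γ ↦ γ(ω)` on `A^m`, and `γ(ω β) = (β γ)(ω)`.
If `L` is free on `ω`, the components `A^i` and `A^(m - i)` are each isomorphic to the dual of the
other, so they are finite-dimensional by the Erdős–Kaplansky theorem, and the pairing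
`(β, γ) ↦ (β γ)(ω)` is perfect; conversely, perfectness of this pairing says that `β ↦ ω β` is
bijective.
-/

namespace Gor

universe v w w' p

/-! ### Twisted complexes -/

section Twisted

variable {k : Type v} [Field k]

/-- A differential graded algebra as a right module over itself. -/
abbrev DGAlgebra.selfRight (A : DGAlgebra.{v, w} k) : DGRightModule.{v, w, w} A where
  carrier := A
  gr := A.gr
  d := A.d
  isComplex := A.isComplex
  smul_mem m n x a hx ha := A.mul_mem m n x a hx ha
  leibniz m x a hx := A.leibniz m x a hx

variable {A : DGAlgebra.{v, w} k} {ι : Type p} (N : DGRightModule.{v, w, w'} A)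

theorem DGRightModule.parity_smul_parity (x : N) (a : A) :
    parity N.isComplex.internal (MulOpposite.op a • x) =
      MulOpposite.op (parity A.isComplex.internal a) • parity N.isComplex.internal x := by
  refine graded_induction (p := fun a => parity N.isComplex.internal (MulOpposite.op a • x) =
      MulOpposite.op (parity A.isComplex.internal a) • parity N.isComplex.internal x)
    A.isComplex.internal a (fun n a ha => ?_)
    (fun a b ha hb => by simp only [map_add, MulOpposite.op_add, add_smul, ha, hb])
  rw [N.parity_smul n x a ha, parity_of_mem _ ha]
  simp only [Units.smul_def]
  exact ((map_zsmul (N.act (parity N.isComplex.internal x)) _ a)).symm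

theorem DGRightModule.act_apply (x : N) (a : A) : N.act x a = MulOpposite.op a • x := rfl

/-- The map `(x, ∑ a_i e_i) ↦ ∑ (x a_i) e_i`: the image of `x ⊗ y` in the twisted complex, where
`y` is given by its coordinates. -/
noncomputable def DGRightModule.coordAct : N →ₗ[k] (ι →₀ A) →ₗ[k] (ι →₀ N) :=
  LinearMap.mk₂ k (fun x v => Finsupp.mapRange.linearMap (N.act x) v)
    (fun _ _ _ => Finsupp.ext fun _ => by simp)
    (fun _ _ _ => Finsupp.ext fun _ => by simp)
    (fun _ _ _ => map_add _ _ _)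
    (fun _ _ _ => map_smul _ _ _)

@[simp] theorem DGRightModule.coordAct_apply (x : N) (v : ι →₀ A) (i : ι) :
    N.coordAct x v i = MulOpposite.op (v i) • x := rfl

theorem DGRightModule.coordAct_single (x : N) (i : ι) (a : A) :
    N.coordAct x (Finsupp.single i a) = Finsupp.single i (MulOpposite.op a • x) := by
  refine Finsupp.ext fun j => ?_
  classical
  rw [coordAct_apply, Finsupp.single_apply, Finsupp.single_apply]
  split <;> simp

theorem DGRightModule.coordAct_smul (x : N) (a : A) (v : ι →₀ A) :
    N.coordAct (MulOpposite.op a • x) v = N.coordAct x (a • v) := by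
  refine Finsupp.ext fun j => ?_
  simp [mul_smul]

/-- The differential of `N ⊗ V`, where `V` has the basis `(e_i)` and `d e_i = ∑ (D i j) e_j`. -/
noncomputable def twD (D : ι → ι →₀ A) : (ι →₀ N) →ₗ[k] (ι →₀ N) :=
  Finsupp.lsum k fun i =>
    Finsupp.lsingle i ∘ₗ N.d + N.coordAct.flip (D i) ∘ₗ parity N.isComplex.internal

theorem twD_single (D : ι → ι →₀ A) (i : ι) (x : N) :
    twD N D (Finsupp.single i x) =
      Finsupp.single i (N.d x) + N.coordAct (parity N.isComplex.internal x) (D i) := by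
  simp [twD]

/-- The Leibniz rule for `x ⊗ y`. -/
theorem twD_coordAct (D : ι → ι →₀ A) (x : N) (v : ι →₀ A) :
    twD N D (N.coordAct x v) = N.coordAct (N.d x) v +
      N.coordAct (parity N.isComplex.internal x) (twD A.selfRight D v) := by
  induction v using Finsupp.induction_linear with
  | zero => simp
  | add v v' h h' => simp only [map_add, h, h']; abel
  | single i a =>
    rw [N.coordAct_single, twD_single, N.leibniz_parity, N.parity_smul_parity, N.coordAct_smul,
      twD_single, N.coordAct_single, map_add, N.coordAct_single, Finsupp.single_add, add_assoc]
    congr 2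

/-- The `twD` of `A` itself satisfies the Leibniz rule of a left module. -/
theorem twD_smul (D : ι → ι →₀ A) (a : A) (v : ι →₀ A) :
    twD A.selfRight D (a • v) = A.d a • v + parity A.isComplex.internal a • twD A.selfRight D v :=
  twD_coordAct A.selfRight D a v

/-- The data of a semifree module with a basis indexed by `ι`: the degree and the layer of each
basis element, and the coordinates `D i` of its differential. -/
structure Twisting (A : DGAlgebra.{v, w} k) (ι : Type p) where
  D : ι → ι →₀ A
  deg : ι → ℤ
  rk : ι → ℕ
  mem : ∀ i j, D i j ∈ A.gr (deg i + 1 - deg j)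
  lt : ∀ i j, D i j ≠ 0 → rk j < rk i
  sq : ∀ i, twD A.selfRight D (D i) = 0

namespace Twisting

variable (T : Twisting A ι)

/-- The differential of the twisted complex `N ⊗ V`. -/
noncomputable abbrev d : (ι →₀ N) →ₗ[k] (ι →₀ N) := twD N T.D

theorem d_d (t : ι →₀ N) : T.d N (T.d N t) = 0 := by
  induction t using Finsupp.induction_linear with
  | zero => simp
  | add v v' h h' => simp only [map_add, h, h', add_zero]
  | single i x =>
    rw [d, twD_single, map_add, twD_single, twD_coordAct, T.sq, N.isComplex.d_d,
      d_parity N.isComplex]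
    simp

/-- The component of degree `n` of the twisted complex. -/
def gr (n : ℤ) : Submodule k (ι →₀ N) where
  carrier := {t | ∀ i, t i ∈ N.gr (n - T.deg i)}
  add_mem' hs ht i := Submodule.add_mem _ (hs i) (ht i)
  zero_mem' _ := Submodule.zero_mem _
  smul_mem' c _ ht i := Submodule.smul_mem _ c (ht i)

variable {N} in
theorem single_mem {i : ι} {n : ℤ} {x : N} (hx : x ∈ N.gr (n - T.deg i)) :
    Finsupp.single i x ∈ T.gr N n := by
  classical
  intro j
  rw [Finsupp.single_apply]
  split
  · rename_i h; exact h ▸ hx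
  · exact Submodule.zero_mem _

theorem gr_isInternal : DirectSum.IsInternal (T.gr N) := by
  classical
  refine isInternal_of_proj (fun n => Finsupp.lsum k fun i =>
    Finsupp.lsingle i ∘ₗ proj N.isComplex.internal (n - T.deg i)) ?_ ?_ ?_
  · intro n t ht
    rw [Finsupp.lsum_apply]
    conv_rhs => rw [← Finsupp.sum_single t]
    exact Finsupp.sum_congr fun i _ => by
      simp [proj_of_mem N.isComplex.internal (ht i)]
  · intro n m hmn t ht
    rw [Finsupp.lsum_apply]
    refine Finset.sum_eq_zero fun i _ => ?_
    simp [proj_of_mem_ne N.isComplex.internal (n := n - T.deg i) (m := m - T.deg i) (by omega)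
      (ht i)]
  · intro t
    induction t using Finsupp.induction_linear with
    | zero => exact Submodule.zero_mem _
    | add x y hx hy => exact Submodule.add_mem _ hx hy
    | single i x =>
      refine graded_induction (p := fun x => Finsupp.single i x ∈ iSup (T.gr N))
        N.isComplex.internal x (fun n x hx => ?_) (fun x y hx hy => ?_)
      · exact Submodule.mem_iSup_of_mem (n + T.deg i) (T.single_mem (by simpa using hx))
      · rw [Finsupp.single_add]; exact Submodule.add_mem _ hx hy

variable {N} in
theorem coordAct_mem {m n : ℤ} {x : N} {v : ι →₀ A} (hx : x ∈ N.gr m)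
    (hv : v ∈ T.gr A.selfRight n) : N.coordAct x v ∈ T.gr N (m + n) := by
  intro i
  have := N.smul_mem m (n - T.deg i) x (v i) hx (hv i)
  rwa [← add_sub_assoc] at this

theorem D_mem (i : ι) : T.D i ∈ T.gr A.selfRight (T.deg i + 1) := fun j => T.mem i j

theorem isComplex : IsComplex (T.gr N) (T.d N) where
  internal := T.gr_isInternal N
  d_mem n t ht := by
    rw [← Finsupp.sum_single t, Finsupp.sum, map_sum]
    refine Submodule.sum_mem _ fun i _ => ?_
    rw [d, twD_single]
    refine Submodule.add_mem _ (T.single_mem ?_) ?_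
    · have := N.isComplex.d_mem _ _ (ht i)
      rwa [show n - T.deg i + 1 = n + 1 - T.deg i by ring] at this
    · have h : parity N.isComplex.internal (t i) ∈ N.gr (n - T.deg i) := by
        rw [parity_of_mem _ (ht i), Units.smul_def]
        exact zsmul_mem (ht i) _
      have := T.coordAct_mem h (T.D_mem i)
      rwa [show n - T.deg i + (T.deg i + 1) = n + 1 by ring] at this
  d_d := T.d_d N

/-- The component at `j` of the differential is the differential of the component at `j`,
up to contributions of the components of higher rank. -/
theorem d_apply (t : ι →₀ N) (j : ι) :
    T.d N t j = N.d (t j) +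
      ∑ i ∈ t.support, MulOpposite.op (T.D i j) • parity N.isComplex.internal (t i) := by
  classical
  have h : T.d N t = t.sum fun i x => twD N T.D (Finsupp.single i x) := by
    conv_lhs => rw [← Finsupp.sum_single t, Finsupp.sum, map_sum]
    rfl
  rw [h, Finsupp.sum, Finsupp.finsetSum_apply]
  simp only [twD_single, Finsupp.add_apply, N.coordAct_apply]
  rw [Finset.sum_add_distrib]
  congr 1
  rw [Finset.sum_eq_single j]
  · simp
  · intro i _ hij
    rw [Finsupp.single_apply, if_neg hij]
  · intro hj
    simp [Finsupp.notMem_support_iff.1 hj]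

/-- Filtration by layers: a relative cycle of the twisted complex modulo the submodule
`⨁ i, Y i` is a relative boundary if this holds in each component. The submodule `G` allows
for restrictions on the degree. -/
theorem exists_sub_d_mem (Y : ι → Submodule k N)
    (hY : ∀ i j, ∀ x ∈ Y i, MulOpposite.op (T.D i j) • parity N.isComplex.internal x ∈ Y j)
    (G : Submodule k (ι →₀ N))
    (hG : ∀ t ∈ G, ∀ i, N.d (t i) ∈ Y i →
      ∃ s, t i - N.d s ∈ Y i ∧ T.d N (Finsupp.single i s) ∈ G)
    (t : ι →₀ N) (ht : t ∈ G) (hdt : ∀ i, T.d N t i ∈ Y i) :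
    ∃ s, ∀ i, (t - T.d N s) i ∈ Y i := by
  classical
  have key : ∀ r : ℕ, ∀ t ∈ G, (∀ i, T.d N t i ∈ Y i) → (∀ i, r ≤ T.rk i → t i ∈ Y i) →
      ∃ s, ∀ i, (t - T.d N s) i ∈ Y i := by
    intro r
    induction r with
    | zero => exact fun t _ _ h => ⟨0, fun i => by simpa using h i (Nat.zero_le _)⟩
    | succ r ih =>
      intro t ht hdt hr
      have hcomp : ∀ i, T.rk i = r → N.d (t i) ∈ Y i := by
        intro i hi
        have h := hdt i
        rw [T.d_apply] at h
        refine (Submodule.add_mem_iff_left _ (Submodule.sum_mem _ fun j _ => ?_)).1 h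
        by_cases hD : T.D j i = 0
        · rw [hD]; simp
        · exact hY j i _ (hr j (by have := T.lt j i hD; omega))
      choose! s hs hs' using fun (i : ι) (hi : T.rk i = r) => hG t ht i (hcomp i hi)
      let I := t.support.filter fun i => T.rk i = r
      let u : ι →₀ N := ∑ i ∈ I, Finsupp.single i (s i)
      have hu : T.d N u ∈ G := by
        rw [map_sum]
        exact Submodule.sum_mem _ fun i hi => hs' i (Finset.mem_filter.1 hi).2
      obtain ⟨s', hs''⟩ := ih (t - T.d N u) (Submodule.sub_mem _ ht hu)
        (fun i => by rw [map_sub, T.d_d, sub_zero]; exact hdt i) (fun i hi => by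
          have hdu : T.d N u i = if i ∈ I then N.d (s i) else 0 := by
            rw [map_sum, Finsupp.finsetSum_apply]
            have : ∀ j ∈ I, T.d N (Finsupp.single j (s j)) i = if j = i then N.d (s j) else 0 := by
              intro j hj
              rw [d, twD_single, Finsupp.add_apply, N.coordAct_apply, Finsupp.single_apply]
              have : T.D j i = 0 := by
                by_contra h
                have := T.lt j i h
                have := (Finset.mem_filter.1 hj).2
                omega
              simp [this]
            rw [Finset.sum_congr rfl this, Finset.sum_ite_eq']
          rw [Finsupp.sub_apply, hdu]
          split
          · rename_i h
            exact hs i (Finset.mem_filter.1 h).2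
          · rename_i h
            rw [sub_zero]
            rcases hi.eq_or_lt with h' | h'
            · by_cases h0 : t i = 0
              · rw [h0]; exact Submodule.zero_mem _
              · exact absurd (Finset.mem_filter.2 ⟨Finsupp.mem_support_iff.2 h0, h'.symm⟩) h
            · exact hr i h')
      refine ⟨u + s', fun i => ?_⟩
      rw [map_add, ← sub_sub]
      exact hs'' i
  refine key (t.support.sup T.rk + 1) t ht hdt fun i hi => ?_
  have : t i = 0 := by
    by_contra h
    have := Finset.le_sup (f := T.rk) (Finsupp.mem_support_iff.2 h)
    omega
  rw [this]
  exact Submodule.zero_mem _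

/-- Tensoring with a semifree module preserves acyclicity. -/
theorem exists_eq_d (hN : ∀ x, N.d x = 0 → ∃ y, x = N.d y) (t : ι →₀ N) (ht : T.d N t = 0) :
    ∃ s, t = T.d N s := by
  obtain ⟨s, hs⟩ := T.exists_sub_d_mem N (fun _ => ⊥) (by simp) ⊤
    (fun t _ i hi => by
      obtain ⟨y, hy⟩ := hN _ ((Submodule.mem_bot k).1 hi)
      exact ⟨y, by rw [Submodule.mem_bot, ← hy, sub_self], trivial⟩) t trivial
    (fun i => by rw [ht]; exact Submodule.zero_mem _)
  exact ⟨s, sub_eq_zero.1 (Finsupp.ext fun i => (Submodule.mem_bot k).1 (hs i))⟩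

end Twisting

/-! ### Semifree modules in coordinates -/

section Coordinates

variable {P : DGModule.{v, w, p} A} (e : Module.Basis ι A P)

/-- The Leibniz rule of a left module in terms of the parity involution. -/
theorem DGModule.leibniz_parity (P : DGModule.{v, w, p} A) (a : A) (x : P) :
    P.d (a • x) = A.d a • x + parity A.isComplex.internal a • P.d x := by
  refine graded_induction (p := fun a => P.d (a • x) = A.d a • x +
      parity A.isComplex.internal a • P.d x) A.isComplex.internal a
    (fun n a ha => ?_) (fun a b ha hb => by simp only [add_smul, map_add, ha, hb]; abel)
  rw [P.leibniz n a x ha, parity_of_mem A.isComplex.internal ha, Units.smul_def, Units.smul_def,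
    smul_assoc]

theorem basis_induction {p : P → Prop} (y : P) (zero : p 0) (smul : ∀ (a : A) i, p (a • e i))
    (add : ∀ x y, p x → p y → p (x + y)) : p y := by
  rw [← e.linearCombination_repr y, Finsupp.linearCombination_apply]
  exact Finset.sum_induction _ p add zero fun i _ => smul _ i

theorem repr_d (y : P) :
    e.repr (P.d y) = twD A.selfRight (fun i => e.repr (P.d (e i))) (e.repr y) := by
  refine basis_induction e (p := fun y => e.repr (P.d y) =
    twD A.selfRight (fun i => e.repr (P.d (e i))) (e.repr y)) y (by simp) (fun a i => ?_)
    (fun x y hx hy => by simp only [map_add, hx, hy])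
  rw [P.leibniz_parity, map_add, map_smul, map_smul, map_smul, twD_smul]
  congr 1
  · rw [e.repr_self, twD_single, A.d_one, parity_of_mem _ A.one_mem]
    refine Finsupp.ext fun j => ?_
    simp only [Finsupp.single_zero, zero_add, Int.negOnePow_zero, one_smul]
    exact congrArg (parity A.isComplex.internal a * ·) (one_mul _).symm

/-- The coordinates of homogeneous elements are homogeneous. -/
theorem repr_mem {deg : ι → ℤ} (he : ∀ i, e i ∈ P.gr (deg i)) {n : ℤ} {y : P} (hy : y ∈ P.gr n)
    (i : ι) : e.repr y i ∈ A.gr (n - deg i) := by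
  have key : ∀ y : P, proj P.isComplex.internal n y =
      (e.repr y).sum fun i a => proj A.isComplex.internal (n - deg i) a • e i := by
    intro y
    conv_lhs => rw [← e.linearCombination_repr y, Finsupp.linearCombination_apply]
    rw [Finsupp.sum, Finsupp.sum, map_sum]
    refine Finset.sum_congr rfl fun i _ => ?_
    refine graded_induction (p := fun a => proj P.isComplex.internal n (a • e i) =
      proj A.isComplex.internal (n - deg i) a • e i) A.isComplex.internal _
      (fun m a ha => ?_) (fun a b ha hb => by simp only [add_smul, map_add, ha, hb])
    by_cases h : m = n - deg i
    · subst h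
      rw [proj_of_mem _ ha, proj_of_mem]
      simpa using P.smul_mem _ _ a (e i) ha (he i)
    · rw [proj_of_mem_ne _ h ha, zero_smul]
      exact proj_of_mem_ne _ (by omega) (P.smul_mem _ _ a (e i) ha (he i))
  have h := key y
  rw [proj_of_mem _ hy] at h
  have h' : e.repr y = (e.repr y).sum fun i a =>
      Finsupp.single i (proj A.isComplex.internal (n - deg i) a) := by
    conv_lhs => rw [h]
    rw [Finsupp.sum, Finsupp.sum, map_sum]
    simp
  classical
  have h'' : e.repr y i = proj A.isComplex.internal (n - deg i) (e.repr y i) := by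
    conv_lhs => rw [h']
    rw [Finsupp.sum_apply, Finsupp.sum, Finset.sum_eq_single i]
    · simp
    · intro j _ hj; rw [Finsupp.single_apply, if_neg hj]
    · intro hi; simp [Finsupp.notMem_support_iff.1 hi]
  rw [h'']
  exact proj_mem _ _ _

/-- A semifree module is given by a twisting. -/
theorem DGModule.IsSemifree.exists_twisting {P : DGModule.{v, w, p} A} (hP : P.IsSemifree) :
    ∃ (ι : Type p) (e : Module.Basis ι A P) (T : Twisting A ι),
      (∀ i, T.D i = e.repr (P.d (e i))) ∧ ∀ i, e i ∈ P.gr (T.deg i) := by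
  obtain ⟨ι, e, deg, rk, he, hd⟩ := hP
  refine ⟨ι, e, ⟨fun i => e.repr (P.d (e i)), deg, rk, ?_, ?_, ?_⟩, fun _ => rfl, he⟩
  · exact fun i j => repr_mem e he (P.isComplex.d_mem _ _ (he i)) j
  · intro i j hij
    by_contra h
    refine hij ?_
    have := (Module.Basis.mem_span_image e).1 (hd i)
    exact Finsupp.notMem_support_iff.1 fun hj => h (this hj)
  · intro i
    rw [← repr_d, P.isComplex.d_d, map_zero]

/-- `N ⊗_A P` in terms of a basis of `P`. -/
noncomputable def tensorEquiv : TensorOver N P ≃ₗ[k] (ι →₀ N) :=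
  LinearEquiv.ofLinearMap
    (Submodule.liftQ _
      (TensorProduct.lift (N.coordAct.compl₂ (e.repr.toLinearMap.restrictScalars k)))
      (by
        refine Submodule.span_le.2 ?_
        rintro _ ⟨x, a, y, rfl⟩
        simp [N.coordAct_smul]))
    (Finsupp.lsum k fun i => (tensorRel N P).mkQ ∘ₗ (TensorProduct.mk k N P).flip (e i))
    (by
      refine Finsupp.lhom_ext fun i x => ?_
      rw [LinearMap.comp_apply, Finsupp.lsum_single]
      change N.coordAct x (e.repr (e i)) = _
      rw [e.repr_self, N.coordAct_single, MulOpposite.op_one, one_smul, LinearMap.id_apply])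
    (by
      refine Submodule.linearMap_qext _ (TensorProduct.ext' fun x y => ?_)
      change Finsupp.lsum k (fun i => (tensorRel N P).mkQ ∘ₗ (TensorProduct.mk k N P).flip (e i))
        (N.coordAct x (e.repr y)) = (tensorRel N P).mkQ (x ⊗ₜ y)
      refine basis_induction e (p := fun y => Finsupp.lsum k (fun i => (tensorRel N P).mkQ ∘ₗ
        (TensorProduct.mk k N P).flip (e i)) (N.coordAct x (e.repr y)) =
          (tensorRel N P).mkQ (x ⊗ₜ y)) y (by simp) (fun a i => ?_)
        (fun y z hy hz => by simp only [TensorProduct.tmul_add, map_add, hy, hz])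
      rw [map_smul, ← N.coordAct_smul, e.repr_self, N.coordAct_single, MulOpposite.op_one,
        one_smul, Finsupp.lsum_single]
      exact (Submodule.Quotient.eq _).2 (Submodule.subset_span ⟨x, a, e i, rfl⟩))

theorem tensorEquiv_mk (x : N) (y : P) :
    tensorEquiv N e ((tensorRel N P).mkQ (x ⊗ₜ y)) = N.coordAct x (e.repr y) := rfl

theorem tensorEquiv_d (t : TensorOver N P) :
    tensorEquiv N e (tensorD N P t) =
      twD N (fun i => e.repr (P.d (e i))) (tensorEquiv N e t) := by
  obtain ⟨t, rfl⟩ := Submodule.mkQ_surjective _ t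
  induction t using TensorProduct.induction_on with
  | zero => simp
  | add x y hx hy => simp only [map_add, hx, hy]
  | tmul x y =>
    rw [tensorEquiv_mk, twD_coordAct, ← repr_d]
    change tensorEquiv N e ((tensorRel N P).mkQ (tensorPreD N P (x ⊗ₜ y))) = _
    simp only [tensorPreD, LinearMap.add_apply, TensorProduct.map_tmul, map_add, tensorEquiv_mk,
      LinearMap.id_apply]

end Coordinates

end Twisted

/-- Isomorphic complexes have isomorphic homology. -/
noncomputable def homologyEquiv {k : Type*} [Field k] {V W : Type*} [AddCommGroup V] [Module k V]
    [AddCommGroup W] [Module k W] {d : V →ₗ[k] V} {d' : W →ₗ[k] W} (e : V ≃ₗ[k] W)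
    (he : ∀ x, e (d x) = d' (e x)) : Homology d ≃ₗ[k] Homology d' :=
  have he' : ∀ x, d (e.symm x) = e.symm (d' x) := fun x => by
    rw [LinearEquiv.eq_symm_apply, he, LinearEquiv.apply_symm_apply]
  LinearEquiv.ofLinearMap (Homology.map e.toLinearMap fun x => (he x).symm)
    (Homology.map e.symm.toLinearMap he')
    (by
      refine Submodule.linearMap_qext _ (LinearMap.ext fun x => congrArg (Homology.mk d') ?_)
      exact Subtype.ext (e.apply_symm_apply _))
    (by
      refine Submodule.linearMap_qext _ (LinearMap.ext fun x => congrArg (Homology.mk d) ?_)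
      exact Subtype.ext (e.symm_apply_apply _))

/-! ### Mapping cones -/

section Cone

variable {k : Type v} [Field k]

theorem map_sign_smul {U V F : Type*} [AddCommGroup U] [AddCommGroup V] [FunLike F U V]
    [AddMonoidHomClass F U V] (f : F) (s : ℤˣ) (u : U) : f (s • u) = s • f u := by
  rw [Units.smul_def, map_zsmul, Units.smul_def]

section Abstract

variable {U V W : Type*} [AddCommGroup U] [Module k U] [AddCommGroup V] [Module k V]
  [AddCommGroup W] [Module k W]

/-- Every cycle is a boundary. -/
def IsAcyclic (d : U →ₗ[k] U) : Prop := ∀ x, d x = 0 → x ∈ LinearMap.range d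

/-- The map `f`, which is assumed to commute with the differentials up to a sign, is bijective
in homology. -/
structure IsQuasiIso (dU : U →ₗ[k] U) (dV : V →ₗ[k] V) (f : U →ₗ[k] V) : Prop where
  inj : ∀ u, dU u = 0 → f u ∈ LinearMap.range dV → u ∈ LinearMap.range dU
  surj : ∀ v, dV v = 0 → ∃ u, dU u = 0 ∧ v - f u ∈ LinearMap.range dV

/-- A map is a quasi-isomorphism if and only if its mapping cone `W ≃ U × V` is acyclic. -/
theorem isAcyclic_cone_iff {dU : U →ₗ[k] U} {dV : V →ₗ[k] V} {f : U →ₗ[k] V} {s : ℤˣ}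
    (hf : ∀ u, dV (f u) = -(s • f (dU u))) {D : W →ₗ[k] W} (e : W ≃ₗ[k] U × V)
    (he : ∀ w, e (D w) = (s • dU (e w).1, f (e w).1 + dV (e w).2)) :
    IsAcyclic D ↔ IsQuasiIso dU dV f := by
  have hs : ∀ u : U, s • s • u = u := fun u => by
    rw [smul_smul, Int.units_mul_self, one_smul]
  constructor
  · intro h
    constructor
    · rintro u hu ⟨v, hv⟩
      obtain ⟨w, hw⟩ := h (e.symm (u, -v)) (e.injective (by
        rw [he, e.apply_symm_apply, map_zero]
        simp [hu, hv]))
      have := congrArg e hw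
      rw [he, e.apply_symm_apply] at this
      refine ⟨s • (e w).1, ?_⟩
      rw [map_sign_smul]
      exact congrArg Prod.fst this
    · intro v hv
      obtain ⟨w, hw⟩ := h (e.symm (0, v)) (e.injective (by
        rw [he, e.apply_symm_apply, map_zero]
        simp [hv]))
      have := congrArg e hw
      rw [he, e.apply_symm_apply] at this
      obtain ⟨h1, h2⟩ := Prod.ext_iff.1 this
      refine ⟨(e w).1, ?_, (e w).2, ?_⟩
      · have h3 := congrArg (s • ·) h1
        simp only [hs, smul_zero] at h3
        exact h3
      · simp only at h2
        rw [← h2, add_sub_cancel_left]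
  · intro h w hw
    have hw' := congrArg e hw
    rw [he, map_zero] at hw'
    obtain ⟨h1, h2⟩ := Prod.ext_iff.1 hw'
    simp only [Prod.fst_zero, Prod.snd_zero] at h1 h2
    have h1' : dU (e w).1 = 0 := by rw [← hs (dU _), h1, smul_zero]
    obtain ⟨u, hu⟩ := h.inj _ h1' ⟨-(e w).2, by rw [map_neg, eq_comm, eq_neg_iff_add_eq_zero, h2]⟩
    obtain ⟨u', hu', v', hv'⟩ := h.surj ((e w).2 - f (s • u)) (by
      rw [map_sub, hf, map_sign_smul, map_sign_smul, smul_smul, Int.units_mul_self, one_smul, hu,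
        sub_neg_eq_add, add_comm, h2])
    refine ⟨e.symm (s • u + u', v'), e.injective ?_⟩
    rw [he, e.apply_symm_apply]
    refine Prod.ext ?_ ?_
    · simp only [map_add, hu', add_zero]
      rw [map_sign_smul, hs, hu]
    · simp only [map_add, hv']
      abel

theorem Homology.mk_eq_zero_iff {V : Type*} [AddCommGroup V] [Module k V] {d : V →ₗ[k] V}
    {z : LinearMap.ker d} : Homology.mk d z = 0 ↔ (z : V) ∈ LinearMap.range d :=
  Submodule.Quotient.mk_eq_zero _

theorem Homology.mk_eq_mk_iff {V : Type*} [AddCommGroup V] [Module k V] {d : V →ₗ[k] V}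
    {z z' : LinearMap.ker d} :
    Homology.mk d z = Homology.mk d z' ↔ (z - z' : V) ∈ LinearMap.range d :=
  Submodule.Quotient.eq _

theorem rank_homology_eq_one_iff (d : U →ₗ[k] U) : Module.rank k (Homology d) = 1 ↔
    ∃ z, d z = 0 ∧ z ∉ LinearMap.range d ∧
      ∀ x, d x = 0 → ∃ c : k, x - c • z ∈ LinearMap.range d := by
  rw [Module.rank_eq_one_iff_finrank_eq_one]
  constructor
  · intro h
    obtain ⟨z, hz, hz'⟩ := finrank_eq_one_iff'.1 h
    obtain ⟨⟨z, hzd⟩, rfl⟩ := Submodule.Quotient.mk_surjective _ z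
    refine ⟨z, hzd, fun h0 => hz (Homology.mk_eq_zero_iff.2 h0), fun x hx => ?_⟩
    obtain ⟨c, hc⟩ := hz' (Submodule.Quotient.mk ⟨x, hx⟩)
    exact ⟨c, Homology.mk_eq_mk_iff.1 hc.symm⟩
  · rintro ⟨z, hz, hz0, hz'⟩
    refine finrank_eq_one_iff'.2 ⟨Homology.mk d ⟨z, hz⟩,
      fun h => hz0 (Homology.mk_eq_zero_iff.1 h), fun x => ?_⟩
    obtain ⟨⟨x, hx⟩, rfl⟩ := Submodule.Quotient.mk_surjective _ x
    obtain ⟨c, hc⟩ := hz' x hx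
    exact ⟨c, (Homology.mk_eq_mk_iff.2 hc).symm⟩

end Abstract

variable {A : DGAlgebra.{v, w} k} {ι : Type p} (L : DGRightModule.{v, w, w'} A)

/-- The mapping cone of the map `A → L`, `a ↦ ω a`, for a cycle `ω` of degree `n`. -/
noncomputable def cone (n : ℤ) (ω : L) (hω : ω ∈ L.gr n) (hd : L.d ω = 0) :
    DGRightModule.{v, w, max w w'} A where
  carrier := A × L
  gr j := (A.gr (j - n + 1)).prod (L.gr j)
  d := ((n + 1).negOnePow • A.d ∘ₗ LinearMap.fst k A L).prod
    (L.act ω ∘ₗ LinearMap.fst k A L + L.d ∘ₗ LinearMap.snd k A L)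
  isComplex :=
    { internal := by
        refine isInternal_of_proj (fun j => (proj A.isComplex.internal (j - n + 1)).prodMap
          (proj L.isComplex.internal j)) ?_ ?_ ?_
        · rintro j ⟨a, x⟩ ⟨ha, hx⟩
          exact Prod.ext (proj_of_mem _ ha) (proj_of_mem _ hx)
        · rintro j m hj ⟨a, x⟩ ⟨ha, hx⟩
          exact Prod.ext (proj_of_mem_ne _ (by omega) ha) (proj_of_mem_ne _ hj hx)
        · rintro ⟨a, x⟩
          have h1 : ∀ a : A, ((a, 0) : A × L) ∈
              ⨆ j, (A.gr (j - n + 1)).prod (L.gr j) := fun a =>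
            graded_induction (p := fun a => ((a, 0) : A × L) ∈
              ⨆ j, (A.gr (j - n + 1)).prod (L.gr j)) A.isComplex.internal a
              (fun j a ha => Submodule.mem_iSup_of_mem (j + n - 1)
                ⟨by rwa [show j + n - 1 - n + 1 = j by ring], Submodule.zero_mem _⟩)
              (fun a b ha hb => by simpa using Submodule.add_mem _ ha hb)
          have h2 : ∀ x : L, ((0, x) : A × L) ∈
              ⨆ j, (A.gr (j - n + 1)).prod (L.gr j) := fun x =>
            graded_induction (p := fun x => ((0, x) : A × L) ∈
              ⨆ j, (A.gr (j - n + 1)).prod (L.gr j)) L.isComplex.internal x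
              (fun j x hx => Submodule.mem_iSup_of_mem j ⟨Submodule.zero_mem _, hx⟩)
              (fun a b ha hb => by simpa using Submodule.add_mem _ ha hb)
          simpa using Submodule.add_mem _ (h1 a) (h2 x)
      d_mem := by
        rintro j ⟨a, x⟩ ⟨ha, hx⟩
        refine ⟨?_, Submodule.add_mem _ ?_ (L.isComplex.d_mem _ _ hx)⟩
        · have := A.isComplex.d_mem _ _ ha
          rw [show j - n + 1 + 1 = j + 1 - n + 1 by ring] at this
          change (n + 1).negOnePow • A.d a ∈ _
          rw [Units.smul_def]
          exact zsmul_mem this _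
        · have := L.smul_mem _ _ ω a hω ha
          rwa [show n + (j - n + 1) = j + 1 by ring] at this
      d_d := by
        rintro ⟨a, x⟩
        refine Prod.ext ?_ ?_
        · change (n + 1).negOnePow • A.d ((n + 1).negOnePow • A.d a) = 0
          rw [map_sign_smul, A.isComplex.d_d, smul_zero, smul_zero]
        · change L.act ω ((n + 1).negOnePow • A.d a) + L.d (L.act ω a + L.d x) = 0
          rw [map_add, L.isComplex.d_d, L.act_apply ω a, L.leibniz n ω a hω, hd, smul_zero,
            map_sign_smul, L.act_apply, Int.negOnePow_succ, Units.neg_smul]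
          abel }
  smul_mem j m := by
    rintro ⟨b, x⟩ a ⟨hb, hx⟩ ha
    refine ⟨?_, L.smul_mem _ _ x a hx ha⟩
    have := A.mul_mem _ _ b a hb ha
    rwa [show j - n + 1 + m = j + m - n + 1 by ring] at this
  leibniz j := by
    rintro ⟨b, x⟩ a ⟨hb, hx⟩
    refine Prod.ext ?_ ?_
    · change (n + 1).negOnePow • A.d (b * a) =
        ((n + 1).negOnePow • A.d b) * a + j.negOnePow • (b * A.d a)
      rw [A.leibniz _ b a hb, smul_add, smul_smul, ← Int.negOnePow_add,
        show n + 1 + (j - n + 1) = j + (1 + 1) by ring, Int.negOnePow_add j,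
        Int.negOnePow_even (1 + 1) ⟨1, rfl⟩, mul_one, Units.smul_def, Units.smul_def,
        Units.smul_def, smul_mul_assoc]
    · change L.act ω (b * a) + L.d (MulOpposite.op a • x) = MulOpposite.op a • (L.act ω b + L.d x) +
        j.negOnePow • (MulOpposite.op (A.d a) • x)
      rw [L.leibniz _ x a hx, smul_add, L.act_apply, L.act_apply, MulOpposite.op_mul, mul_smul,
        add_assoc]

variable {n : ℤ} {ω : L} (hω : ω ∈ L.gr n) (hd : L.d ω = 0)

include hω hd in
theorem d_act (a : A) : L.d (L.act ω a) = -((n + 1).negOnePow • L.act ω (A.d a)) := by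
  rw [L.act_apply, L.leibniz n ω a hω, hd, smul_zero, zero_add, Int.negOnePow_succ,
    Units.neg_smul, neg_neg]
  rfl

theorem isAcyclic_cone : IsAcyclic (cone L n ω hω hd).d ↔ IsQuasiIso A.d L.d (L.act ω) :=
  isAcyclic_cone_iff (d_act L hω hd) (LinearEquiv.refl k (A × L)) fun _ => rfl

/-- The twisted complex of a cone is a cone. -/
noncomputable def coneEquiv : (ι →₀ cone L n ω hω hd) ≃ₗ[k] (ι →₀ A) × (ι →₀ L) :=
  LinearEquiv.ofLinearMap
    ((Finsupp.mapRange.linearMap (LinearMap.fst k A L)).prod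
      (Finsupp.mapRange.linearMap (LinearMap.snd k A L)))
    ((Finsupp.mapRange.linearMap (LinearMap.inl k A L)).coprod
      (Finsupp.mapRange.linearMap (LinearMap.inr k A L)))
    (LinearMap.ext fun t => Prod.ext (Finsupp.ext fun i => add_zero (t.1 i))
      (Finsupp.ext fun i => zero_add (t.2 i)))
    (LinearMap.ext fun t => Finsupp.ext fun i =>
      Prod.ext (add_zero (t i).1) (zero_add (t i).2))

theorem parity_cone (a : A) (x : L) : parity (cone L n ω hω hd).isComplex.internal (a, x) =
    ((n + 1).negOnePow • parity A.isComplex.internal a, parity L.isComplex.internal x) := by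
  have h1 : parity (cone L n ω hω hd).isComplex.internal (a, 0) =
      ((n + 1).negOnePow • parity A.isComplex.internal a, 0) := by
    refine graded_induction (p := fun a => parity (cone L n ω hω hd).isComplex.internal (a, 0) =
      ((n + 1).negOnePow • parity A.isComplex.internal a, 0)) A.isComplex.internal a
      (fun j a ha => ?_) (fun a b ha hb => ?_)
    · have h : ((a, 0) : A × L) ∈ (cone L n ω hω hd).gr (j + (n + 1) - 2) :=
        ⟨by rwa [show j + (n + 1) - 2 - n + 1 = j by ring], Submodule.zero_mem _⟩
      refine (parity_of_mem _ h).trans ?_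
      rw [parity_of_mem _ ha, smul_smul, ← Int.negOnePow_add,
        Int.negOnePow_sub, Int.negOnePow_even 2 ⟨1, rfl⟩, mul_one, add_comm]
      exact Prod.ext rfl (smul_zero (n + 1 + j).negOnePow : (n + 1 + j).negOnePow • (0 : L) = 0)
    · have e : ((a + b, 0) : A × L) = (a, 0) + (b, 0) := by simp
      rw [map_add, smul_add]
      refine (congrArg _ e).trans ((map_add _ _ _).trans ?_)
      rw [ha, hb]
      exact Prod.ext rfl (add_zero _)
  have h2 : parity (cone L n ω hω hd).isComplex.internal (0, x) =
      (0, parity L.isComplex.internal x) := by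
    refine graded_induction (p := fun x => parity (cone L n ω hω hd).isComplex.internal (0, x) =
      (0, parity L.isComplex.internal x)) L.isComplex.internal x
      (fun j x hx => ?_) (fun x y hx hy => ?_)
    · have h : ((0, x) : A × L) ∈ (cone L n ω hω hd).gr j := ⟨Submodule.zero_mem _, hx⟩
      refine (parity_of_mem _ h).trans ?_
      rw [parity_of_mem _ hx]
      exact Prod.ext (smul_zero j.negOnePow : j.negOnePow • (0 : A) = 0) rfl
    · have e : ((0, x + y) : A × L) = (0, x) + (0, y) := by simp
      rw [map_add]
      refine (congrArg _ e).trans ((map_add _ _ _).trans ?_)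
      rw [hx, hy]
      exact Prod.ext (add_zero _) rfl
  have e : ((a, x) : A × L) = (a, 0) + (0, x) := by simp
  refine (congrArg _ e).trans ((map_add _ _ _).trans ?_)
  rw [h1, h2]
  exact Prod.ext (add_zero _) (zero_add _)

theorem coneEquiv_d (T : Twisting A ι) (t : ι →₀ cone L n ω hω hd) :
    coneEquiv L hω hd (T.d _ t) = ((n + 1).negOnePow • T.d A.selfRight (coneEquiv L hω hd t).1,
      L.coordAct ω (coneEquiv L hω hd t).1 + T.d L (coneEquiv L hω hd t).2) := by
  induction t using Finsupp.induction_linear with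
  | zero => simp only [map_zero, Prod.fst_zero, Prod.snd_zero, smul_zero, add_zero]; rfl
  | add s t hs ht =>
    simp only [map_add, hs, ht, Prod.fst_add, Prod.snd_add, smul_add]
    refine Prod.ext rfl ?_
    simp only [Prod.mk_add_mk]
    abel
  | single i z =>
    obtain ⟨a, x⟩ := z
    have h1 : (coneEquiv L hω hd (Finsupp.single i (a, x))).1 = Finsupp.single i a :=
      Finsupp.mapRange_single (hf := rfl)
    have h2 : (coneEquiv L hω hd (Finsupp.single i (a, x))).2 = Finsupp.single i x :=
      Finsupp.mapRange_single (hf := rfl)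
    let z' : cone L n ω hω hd := ((n + 1).negOnePow • A.d a, L.act ω a + L.d x)
    let y : cone L n ω hω hd := ((n + 1).negOnePow • parity A.isComplex.internal a,
      parity L.isComplex.internal x)
    have h3 : T.d (cone L n ω hω hd) (Finsupp.single i (a, x)) =
        Finsupp.single i z' + (cone L n ω hω hd).coordAct y (T.D i) := by
      refine (twD_single _ _ i _).trans (congrArg₂ (· + ·) rfl ?_)
      exact congrArg (fun z => (cone L n ω hω hd).coordAct z (T.D i)) (parity_cone L hω hd a x)
    have h4 : coneEquiv L hω hd (Finsupp.single i z') =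
        (Finsupp.single i ((n + 1).negOnePow • A.d a), Finsupp.single i (L.act ω a + L.d x)) :=
      Prod.ext (Finsupp.mapRange_single (hf := rfl)) (Finsupp.mapRange_single (hf := rfl))
    have h5 : coneEquiv L hω hd ((cone L n ω hω hd).coordAct y (T.D i)) =
        (A.selfRight.coordAct ((n + 1).negOnePow • parity A.isComplex.internal a) (T.D i),
          L.coordAct (parity L.isComplex.internal x) (T.D i)) :=
      Prod.ext (Finsupp.ext fun j => rfl) (Finsupp.ext fun j => rfl)
    rw [h1, h2, L.coordAct_single, h3, map_add, h4, h5, Twisting.d, Twisting.d, twD_single,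
      twD_single, Prod.mk_add_mk, smul_add, ← add_assoc, ← Finsupp.single_add]
    refine Prod.ext (congrArg₂ (· + ·) ?_ ?_) rfl
    · exact map_sign_smul (Finsupp.singleAddHom i) _ _
    · exact map_sign_smul (A.selfRight.coordAct.flip (T.D i)) _ _

include hω hd in
theorem d_coordAct (T : Twisting A ι) (v : ι →₀ A) :
    T.d L (L.coordAct ω v) = -((n + 1).negOnePow • L.coordAct ω (T.d A.selfRight v)) := by
  rw [Twisting.d, twD_coordAct, hd, map_zero, LinearMap.zero_apply, zero_add, parity_of_mem _ hω,
    Int.negOnePow_succ, Units.neg_smul, neg_neg, Units.smul_def, map_zsmul, LinearMap.smul_apply,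
    Units.smul_def]

theorem isAcyclic_twisted_cone (T : Twisting A ι) : IsAcyclic (T.d (cone L n ω hω hd)) ↔
    IsQuasiIso (T.d A.selfRight) (T.d L) (L.coordAct ω) :=
  isAcyclic_cone_iff (d_coordAct L hω hd T) (coneEquiv L hω hd) (coneEquiv_d L hω hd T)

end Cone

/-! ### A connected model of a cohomologically connected algebra -/

section Model

variable {k : Type v} [Field k]

/-- The algebra lives in nonnegative degrees, and its cohomology in degree `0` is `k`. -/
structure DGAlgebra.IsConnected (A : DGAlgebra.{v, w} k) : Prop where
  gr_neg : ∀ n < 0, A.gr n = ⊥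
  gr_zero : ∀ a ∈ A.gr 0, A.d a = 0 → ∃ c : k, a = c • 1

/-- A basis `b` of the augmentation ideal of a differential graded subalgebra `A'` of `A` that is
`k` in degree `0` and quasi-isomorphic to `A`, together with coordinates `c` with respect to `b`
(extended to `A`) vanishing on `1`. Basis elements of weight `2` are cycles, and boundaries are
combinations of basis elements of weight `2`. -/
structure ConnectedModel (A : DGAlgebra.{v, w} k) where
  B : Type w
  b : B → A
  deg : B → ℤ
  wt : B → ℕ
  c : A →ₗ[k] B →₀ k
  b_mem : ∀ i, b i ∈ A.gr (deg i)
  deg_pos : ∀ i, 1 ≤ deg i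
  two_le_wt : ∀ i, 2 ≤ wt i
  wt_le_three : ∀ i, wt i ≤ 3
  c_b : ∀ i, c (b i) = Finsupp.single i 1
  c_one : c 1 = 0
  deg_eq : ∀ n, ∀ a ∈ A.gr n, ∀ i, c a i ≠ 0 → deg i = n
  wt_lt : ∀ i j, c (A.d (b i)) j ≠ 0 → wt j < wt i
  d_b_mem : ∀ i, A.d (b i) ∈ Submodule.span k (insert 1 (Set.range b))
  b_mul_b_mem : ∀ i j, b i * b j ∈ Submodule.span k (insert 1 (Set.range b))
  exists_sub_d_mem : ∀ a, A.d a ∈ Submodule.span k (insert 1 (Set.range b)) →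
    ∃ s, a - A.d s ∈ Submodule.span k (insert 1 (Set.range b))

/-- A subspace has a basis that extends a basis of its subspace of cycles. -/
theorem exists_basis_extending_cycles {V : Type w} [AddCommGroup V] [Module k V] (d : V →ₗ[k] V)
    (W : Submodule k V) : ∃ (J : Type w) (β : Module.Basis J k W) (wt : J → ℕ),
      (∀ j, 2 ≤ wt j ∧ wt j ≤ 3) ∧ (∀ j, wt j = 2 → d (β j) = 0) ∧
        ∀ x : W, d x = 0 → ∀ j, β.repr x j ≠ 0 → wt j = 2 := by
  let Z : Submodule k W := LinearMap.ker (d ∘ₗ W.subtype)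
  obtain ⟨Y, hY⟩ := Z.exists_isCompl
  let β := ((Module.Basis.ofVectorSpace k Z).prod (Module.Basis.ofVectorSpace k Y)).map
    (Submodule.prodEquivOfIsCompl Z Y hY)
  refine ⟨_, β, Sum.elim (fun _ => 2) (fun _ => 3), ?_, ?_, ?_⟩
  · rintro (j | j) <;> simp
  · rintro (j | j) h
    · have : β (Sum.inl j) = Module.Basis.ofVectorSpace k Z j := by
        simp [β]
      rw [this]
      exact (Module.Basis.ofVectorSpace k Z j).2
    · simp at h
  · rintro x hx (j | j) h
    · rfl
    · refine absurd ?_ h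
      have : (Submodule.prodEquivOfIsCompl Z Y hY).symm x = (⟨x, hx⟩, 0) :=
        Submodule.prodEquivOfIsCompl_symm_apply_left Z Y hY ⟨x, hx⟩
      simp [β, this]

theorem DGAlgebra.IsConnected.exists_connectedModel {A : DGAlgebra.{v, w} k}
    (hA : A.IsConnected) : Nonempty (ConnectedModel A) := by
  classical
  -- The subalgebra is `k` in degree `0`, is `C ∩ A.gr 1` in degree `1`, where `C` is a complement
  -- of the coboundaries, and agrees with `A` in higher degrees; `V` is its augmentation ideal.
  obtain ⟨C, hC⟩ := ((A.gr 0).map A.d).exists_isCompl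
  let V : ℤ → Submodule k A := fun n => if n = 1 then C ⊓ A.gr 1 else if 2 ≤ n then A.gr n else ⊥
  have hV1 : V 1 = C ⊓ A.gr 1 := if_pos rfl
  have hV2 : ∀ n, 2 ≤ n → V n = A.gr n := fun n hn => by
    simp only [V]; rw [if_neg (by omega), if_pos hn]
  have hV0 : ∀ n, n ≤ 0 → V n = ⊥ := fun n hn => by
    simp only [V]; rw [if_neg (by omega), if_neg (by omega)]
  have hV : ∀ n, V n ≤ A.gr n := fun n => by
    rcases lt_trichotomy n 1 with h | h | h
    · rw [hV0 n (by omega)]; exact bot_le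
    · subst h; rw [hV1]; exact inf_le_right
    · rw [hV2 n (by omega)]
  choose J β wt hwt hβd hβ using fun n => exists_basis_extending_cycles A.d (V n)
  choose q hq using fun n => LinearMap.exists_leftInverse_of_injective (V n).subtype
    (LinearMap.ker_eq_bot.2 (V n).injective_subtype)
  let c : A →ₗ[k] (Σ n, J n) →₀ k := DirectSum.toModule k ℤ _ (fun n =>
    Finsupp.lmapDomain k k (Sigma.mk n) ∘ₗ (β n).repr.toLinearMap ∘ₗ q n ∘ₗ (A.gr n).subtype) ∘ₗ
    (decomp A.isComplex.internal).toLinearMap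
  have hc : ∀ n, ∀ a ∈ A.gr n, c a = Finsupp.mapDomain (Sigma.mk n) ((β n).repr (q n a)) := by
    intro n a ha
    simp only [c, LinearMap.comp_apply, LinearEquiv.coe_coe, decomp_of_mem _ ha,
      DirectSum.toModule_lof]
    rfl
  have hqV : ∀ n, ∀ x : V n, q n x = x := fun n x => LinearMap.congr_fun (hq n) x
  have hdeg : ∀ n, ∀ a ∈ A.gr n, ∀ i : Σ n, J n, c a i ≠ 0 → i.1 = n := by
    intro n a ha i hi
    by_contra h
    rw [hc n a ha, Finsupp.mapDomain_of_notMem_range] at hi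
    · exact hi rfl
    · rintro ⟨j, rfl⟩
      exact h rfl
  let b : (Σ n, J n) → A := fun i => β i.1 i.2
  let S : Submodule k A := Submodule.span k (insert 1 (Set.range b))
  have h1S : (1 : A) ∈ S := Submodule.subset_span (Set.mem_insert _ _)
  have hbS : ∀ i, b i ∈ S := fun i => Submodule.subset_span (Set.mem_insert_of_mem _ ⟨i, rfl⟩)
  have hVS : ∀ n, V n ≤ S := by
    intro n x hx
    have := (β n).linearCombination_repr ⟨x, hx⟩
    have h := congrArg (V n).subtype this
    rw [Finsupp.linearCombination_apply, Finsupp.sum, map_sum] at h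
    change _ = x at h
    rw [← h]
    refine Submodule.sum_mem _ fun j _ => ?_
    rw [map_smul]
    exact Submodule.smul_mem _ _ (hbS ⟨n, j⟩)
  have hpos : ∀ i : Σ n, J n, 1 ≤ i.1 := by
    rintro ⟨n, j⟩
    by_contra h
    have h0 : ((β n j : V n) : A) ∈ (⊥ : Submodule k A) := hV0 n (by simp at h; omega) ▸ (β n j).2
    exact (β n).ne_zero j (Subtype.ext ((Submodule.mem_bot k).1 h0))
  have hbmem : ∀ i, b i ∈ A.gr i.1 := fun i => hV i.1 (β i.1 i.2).2
  have hdS : ∀ i, A.d (b i) ∈ S := fun i => hVS (i.1 + 1) (by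
    rw [hV2 _ (by have := hpos i; omega)]
    exact A.isComplex.d_mem _ _ (hbmem i))
  have hdS' : ∀ a ∈ S, A.d a ∈ S := by
    intro a ha
    refine (Submodule.span_le (p := S.comap A.d)).2 ?_ ha
    rintro x (rfl | ⟨i, rfl⟩)
    · change A.d 1 ∈ S
      rw [A.d_one]; exact Submodule.zero_mem _
    · exact hdS i
  have hS1 : ∀ a ∈ S, proj A.isComplex.internal 1 a ∈ C := by
    intro a ha
    refine (Submodule.span_le (p := C.comap (proj A.isComplex.internal 1))).2 ?_ ha
    rintro x (rfl | ⟨i, rfl⟩)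
    · change proj A.isComplex.internal 1 1 ∈ C
      rw [proj_of_mem_ne _ (by decide : (0 : ℤ) ≠ 1) A.one_mem]; exact Submodule.zero_mem _
    · change proj A.isComplex.internal 1 (b i) ∈ C
      by_cases h : i.1 = 1
      · obtain ⟨n, j⟩ := i
        simp only at h
        subst h
        rw [proj_of_mem _ (hbmem ⟨1, j⟩)]
        have : b ⟨1, j⟩ ∈ V 1 := (β 1 j).2
        rw [hV1] at this
        exact this.1
      · rw [proj_of_mem_ne _ h (hbmem i)]; exact Submodule.zero_mem _
  refine ⟨{
    B := Σ n, J n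
    b := b
    deg := fun i => i.1
    wt := fun i => wt i.1 i.2
    c := c
    b_mem := hbmem
    deg_pos := hpos
    two_le_wt := fun i => (hwt _ _).1
    wt_le_three := fun i => (hwt _ _).2
    c_b := ?_
    c_one := ?_
    deg_eq := hdeg
    wt_lt := ?_
    d_b_mem := hdS
    b_mul_b_mem := ?_
    exists_sub_d_mem := ?_ }⟩
  · rintro ⟨n, j⟩
    rw [hc n _ (hbmem ⟨n, j⟩), hqV n (β n j), Module.Basis.repr_self, Finsupp.mapDomain_single]
  · rw [hc 0 1 A.one_mem]
    have : q 0 1 = 0 := by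
      have h : ((q 0 1 : V 0) : A) ∈ (⊥ : Submodule k A) := hV0 0 le_rfl ▸ (q 0 1).2
      exact Subtype.ext ((Submodule.mem_bot k).1 h)
    rw [this, map_zero, Finsupp.mapDomain_zero]
  · rintro ⟨n, i⟩ ⟨m, j⟩ h
    have hmem := A.isComplex.d_mem _ _ (hbmem ⟨n, i⟩)
    obtain rfl : m = n + 1 := hdeg _ _ hmem _ h
    rw [hc _ _ hmem] at h
    have hmem' : A.d (b ⟨n, i⟩) ∈ V (n + 1) := by
      rw [hV2 _ (by have := hpos ⟨n, i⟩; simp only at this; omega)]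
      exact hmem
    rw [hqV (n + 1) ⟨_, hmem'⟩, Finsupp.mapDomain_apply sigma_mk_injective] at h
    have h2 := hβ (n + 1) ⟨_, hmem'⟩ (A.isComplex.d_d _) j h
    have h3 : wt n i ≠ 2 := fun h' => by
      have h0 : A.d (b ⟨n, i⟩) = 0 := hβd n i h'
      have h0' : (⟨A.d (b ⟨n, i⟩), hmem'⟩ : V (n + 1)) = 0 := Subtype.ext h0
      rw [h0', map_zero] at h
      exact h rfl
    have := hwt n i
    simp only
    omega
  · intro i j
    refine hVS (i.1 + j.1) ?_
    rw [hV2 _ (by have := hpos i; have := hpos j; omega)]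
    exact A.mul_mem _ _ _ _ (hbmem i) (hbmem j)
  · -- reduce to degree `0` by removing a coboundary and elements of the subalgebra
    have main : ∀ a : A, ∃ s, ∃ a₀ ∈ A.gr 0, a - A.d s - a₀ ∈ S := by
      intro a
      refine graded_induction (p := fun a => ∃ s, ∃ a₀ ∈ A.gr 0, a - A.d s - a₀ ∈ S)
        A.isComplex.internal a (fun n a ha => ?_) ?_
      · rcases lt_trichotomy n 1 with h | rfl | h
        · rcases (show n ≤ 0 by omega).lt_or_eq with h' | rfl
          · rw [hA.gr_neg n h', Submodule.mem_bot] at ha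
            exact ⟨0, 0, Submodule.zero_mem _, by simp [ha]⟩
          · exact ⟨0, a, ha, by simp⟩
        · have ha' : a ∈ (A.gr 0).map A.d ⊔ C := by rw [hC.sup_eq_top]; trivial
          obtain ⟨_, ⟨s, hs, rfl⟩, x, hx, rfl⟩ := Submodule.mem_sup.1 ha'
          refine ⟨s, 0, Submodule.zero_mem _, hVS 1 ?_⟩
          rw [hV1, add_sub_cancel_left, sub_zero]
          refine ⟨hx, ?_⟩
          have := Submodule.sub_mem _ ha (A.isComplex.d_mem _ _ hs)
          rwa [add_sub_cancel_left] at this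
        · refine ⟨0, 0, Submodule.zero_mem _, hVS n ?_⟩
          rw [hV2 n (by omega)]
          simpa using ha
      · rintro x y ⟨s, x₀, hx₀, hx⟩ ⟨t, y₀, hy₀, hy⟩
        refine ⟨s + t, x₀ + y₀, Submodule.add_mem _ hx₀ hy₀, ?_⟩
        have := Submodule.add_mem _ hx hy
        rw [map_add]
        convert! this using 1
        abel
    intro a ha
    obtain ⟨s, a₀, ha₀, h⟩ := main a
    have hda₀ : A.d a₀ ∈ S := by
      have := Submodule.sub_mem _ ha (hdS' _ h)
      rw [map_sub, map_sub, A.isComplex.d_d, sub_zero, sub_sub_cancel] at this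
      exact this
    have hC0 : A.d a₀ = 0 := by
      have h1 := hS1 _ hda₀
      have h2 := A.isComplex.d_mem _ _ ha₀
      rw [zero_add] at h2
      rw [proj_of_mem _ h2] at h1
      exact (Submodule.disjoint_def.1 hC.disjoint) _ ⟨a₀, ha₀, rfl⟩ h1
    obtain ⟨c, hc⟩ := hA.gr_zero a₀ ha₀ hC0
    refine ⟨s, ?_⟩
    have := Submodule.add_mem _ h (Submodule.smul_mem _ c h1S)
    rw [hc, sub_add_cancel] at this
    exact this

end Model

/-! ### The semifree resolution of the ground field -/

section Resolution

variable {k : Type v} [Field k] {A : DGAlgebra.{v, w} k}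

theorem selfRight_coordAct {ι : Type p} (a : A) (v : ι →₀ A) :
    A.selfRight.coordAct a v = a • v := Finsupp.ext fun _ => rfl

/-- The semifree module given by a twisting. -/
noncomputable def Twisting.toModule {ι : Type p} (T : Twisting A ι) :
    DGModule.{v, w, max p w} A where
  carrier := ι →₀ A
  gr := T.gr A.selfRight
  d := T.d A.selfRight
  isComplex := T.isComplex A.selfRight
  smul_mem m n a x ha hx i := by
    have := A.mul_mem _ _ a (x i) ha (hx i)
    rwa [← add_sub_assoc] at this
  leibniz m a x ha := by
    refine (twD_smul T.D a x).trans ?_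
    rw [parity_of_mem _ ha, Units.smul_def, Units.smul_def, smul_assoc]

theorem Twisting.isSemifree {ι : Type w} (T : Twisting A ι) :
    DGModule.IsSemifree.{v, w, w} T.toModule := by
  refine ⟨ι, Finsupp.basisSingleOne, T.deg, T.rk, fun i => ?_, fun i => ?_⟩
  · exact T.single_mem (N := A.selfRight) (by rw [sub_self]; exact A.one_mem)
  · have h : T.toModule.d (Finsupp.basisSingleOne (R := A) i) = T.D i := by
      refine (twD_single A.selfRight T.D i 1).trans ?_
      rw [A.d_one, parity_of_mem _ A.one_mem, Int.negOnePow_zero, one_smul, Finsupp.single_zero,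
        zero_add, selfRight_coordAct, one_smul]
    refine (Module.Basis.mem_span_image _).2 ?_
    intro j hj
    refine T.lt i j ?_
    rw [← h]
    exact Finsupp.mem_support_iff.1 hj

namespace ConnectedModel

variable (M : ConnectedModel A)

/-- The subalgebra `A'` spanned by `1` and the basis `b`. -/
def sub : Submodule k A := Submodule.span k (insert 1 (Set.range M.b))

theorem one_mem : (1 : A) ∈ M.sub := Submodule.subset_span (Set.mem_insert _ _)

theorem b_mem_sub (i : M.B) : M.b i ∈ M.sub :=
  Submodule.subset_span (Set.mem_insert_of_mem _ ⟨i, rfl⟩)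

theorem sub_induction {p : A → Prop} {a : A} (ha : a ∈ M.sub) (one : p 1) (b : ∀ i, p (M.b i))
    (add : ∀ x y, p x → p y → p (x + y)) (smul : ∀ (c : k) x, p x → p (c • x)) : p a := by
  induction ha using Submodule.span_induction with
  | mem x hx =>
    obtain rfl | ⟨i, rfl⟩ := hx
    · exact one
    · exact b i
  | zero => simpa using smul 0 1 one
  | add x y _ _ hx hy => exact add x y hx hy
  | smul c x _ hx => exact smul c x hx

theorem d_mem {a : A} (ha : a ∈ M.sub) : A.d a ∈ M.sub :=
  M.sub_induction (p := fun a => A.d a ∈ M.sub) ha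
    (by rw [A.d_one]; exact Submodule.zero_mem _) M.d_b_mem
    (fun x y hx hy => by rw [map_add]; exact Submodule.add_mem _ hx hy)
    (fun c x hx => by rw [map_smul]; exact Submodule.smul_mem _ _ hx)

theorem parity_mem {a : A} (ha : a ∈ M.sub) : parity A.isComplex.internal a ∈ M.sub :=
  M.sub_induction (p := fun a => parity A.isComplex.internal a ∈ M.sub) ha
    (by rw [parity_of_mem _ A.one_mem, Int.negOnePow_zero, one_smul]; exact M.one_mem)
    (fun i => by
      rw [parity_of_mem _ (M.b_mem i), Units.smul_def]; exact zsmul_mem (M.b_mem_sub i) _)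
    (fun x y hx hy => by rw [map_add]; exact Submodule.add_mem _ hx hy)
    (fun c x hx => by rw [map_smul]; exact Submodule.smul_mem _ _ hx)

theorem mul_mem {a b : A} (ha : a ∈ M.sub) (hb : b ∈ M.sub) : a * b ∈ M.sub :=
  M.sub_induction (p := fun a => a * b ∈ M.sub) ha (by rwa [one_mul])
    (fun i => M.sub_induction (p := fun b => M.b i * b ∈ M.sub) hb
      (by rw [mul_one]; exact M.b_mem_sub i) (M.b_mul_b_mem i)
      (fun x y hx hy => by rw [mul_add]; exact Submodule.add_mem _ hx hy)
      (fun c x hx => by rw [mul_smul_comm]; exact Submodule.smul_mem _ _ hx))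
    (fun x y hx hy => by rw [add_mul]; exact Submodule.add_mem _ hx hy)
    (fun c x hx => by rw [smul_mul_assoc]; exact Submodule.smul_mem _ _ hx)

/-- The contraction `a [x₁|…|xₙ] ↦ [a|x₁|…|xₙ]` of the bar construction. -/
noncomputable def h : (List M.B →₀ A) →ₗ[k] (List M.B →₀ A) :=
  Finsupp.lsum k fun w =>
    Finsupp.linearCombination k (fun x => Finsupp.single (x :: w) (1 : A)) ∘ₗ M.c

theorem h_single (w : List M.B) (a : A) : M.h (Finsupp.single w a) =
    Finsupp.linearCombination k (fun x => Finsupp.single (x :: w) (1 : A)) (M.c a) := by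
  simp [h]

theorem h_nil (t : List M.B →₀ A) : M.h t [] = 0 := by
  induction t using Finsupp.induction_linear with
  | zero => simp
  | add s t hs ht => simp [hs, ht]
  | single w a =>
    rw [h_single, Finsupp.linearCombination_apply, Finsupp.sum_apply]
    exact Finset.sum_eq_zero fun x _ => by simp

theorem h_cons (t : List M.B →₀ A) (x : M.B) (w : List M.B) :
    M.h t (x :: w) = M.c (t w) x • (1 : A) := by
  classical
  induction t using Finsupp.induction_linear with
  | zero => simp
  | add s t hs ht => simp [hs, ht, add_smul]
  | single u a =>
    rw [h_single, Finsupp.linearCombination_apply, Finsupp.sum_apply, Finsupp.single_apply]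
    split
    · rename_i huw
      subst huw
      rw [Finsupp.sum, Finset.sum_eq_single x]
      · simp
      · intro y _ hy
        simp [hy]
      · intro hx
        simp [Finsupp.notMem_support_iff.1 hx]
    · rename_i huw
      rw [Finsupp.sum, map_zero, Finsupp.zero_apply, zero_smul]
      exact Finset.sum_eq_zero fun y _ => by simp [huw]

theorem h_h (t : List M.B →₀ A) : M.h (M.h t) = 0 := by
  refine Finsupp.ext fun w => ?_
  match w with
  | [] => exact M.h_nil _
  | [x] => rw [h_cons, h_nil, map_zero, Finsupp.zero_apply, zero_smul]; rfl
  | x :: y :: w =>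
    rw [h_cons, h_cons, map_smul, M.c_one, smul_zero, Finsupp.zero_apply, zero_smul]; rfl

theorem h_mem (t : List M.B →₀ A) (w : List M.B) : M.h t w ∈ M.sub := by
  match w with
  | [] => rw [h_nil]; exact Submodule.zero_mem _
  | x :: w => rw [h_cons]; exact Submodule.smul_mem _ _ M.one_mem

/-- The differential of the bar construction: it is determined by `d h + h d = 1` on the elements
`x e_w` with `x` in the basis. -/
noncomputable def D : List M.B → List M.B →₀ A
  | [] => 0
  | x :: w => Finsupp.single w (M.b x) -
      M.h (Finsupp.single w (A.d (M.b x)) + parity A.isComplex.internal (M.b x) • D w)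

theorem twD_single_D (w : List M.B) (a : A) : twD A.selfRight M.D (Finsupp.single w a) =
    Finsupp.single w (A.d a) + parity A.isComplex.internal a • M.D w := by
  rw [twD_single, selfRight_coordAct]

theorem D_cons (x : M.B) (w : List M.B) : M.D (x :: w) = Finsupp.single w (M.b x) -
    M.h (twD A.selfRight M.D (Finsupp.single w (M.b x))) := by
  rw [twD_single_D, D]

theorem single_mem_sub {w : List M.B} {a : A} (ha : a ∈ M.sub) (u : List M.B) :
    Finsupp.single w a u ∈ M.sub := by
  classical
  rw [Finsupp.single_apply]
  split
  · exact ha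
  · exact Submodule.zero_mem _

theorem D_mem (w u : List M.B) : M.D w u ∈ M.sub := by
  match w with
  | [] => exact Submodule.zero_mem _
  | x :: w =>
    rw [D]
    exact Submodule.sub_mem _ (M.single_mem_sub (M.b_mem_sub x) u) (M.h_mem _ _)

theorem twD_mem {t : List M.B →₀ A} (ht : ∀ w, t w ∈ M.sub) (u : List M.B) :
    twD A.selfRight M.D t u ∈ M.sub := by
  rw [← Finsupp.sum_single t, Finsupp.sum, map_sum, Finsupp.finsetSum_apply]
  refine Submodule.sum_mem _ fun w _ => ?_
  rw [twD_single_D]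
  exact Submodule.add_mem _ (M.single_mem_sub (M.d_mem (ht w)) u)
    (M.mul_mem (M.parity_mem (ht w)) (M.D_mem w u))

/-- The map `h` is a contraction of `A' ⊗ V` onto `k`. -/
theorem contraction (ε : A.Augmentation) {t : List M.B →₀ A} (ht : ∀ w, t w ∈ M.sub) :
    twD A.selfRight M.D (M.h t) + M.h (twD A.selfRight M.D t) =
      t - Finsupp.single [] (ε.toAlgHom (t []) • (1 : A)) := by
  classical
  let E : (List M.B →₀ A) →ₗ[k] (List M.B →₀ A) :=
    twD A.selfRight M.D ∘ₗ M.h + M.h ∘ₗ twD A.selfRight M.D - (LinearMap.id -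
      Finsupp.lsingle [] ∘ₗ (LinearMap.toSpanSingleton k A 1 ∘ₗ ε.toAlgHom.toLinearMap) ∘ₗ
        Finsupp.lapply [])
  suffices hE : E t = 0 from sub_eq_zero.1 hE
  have hE : ∀ u, E u = twD A.selfRight M.D (M.h u) + M.h (twD A.selfRight M.D u) -
    (u - Finsupp.single [] (ε.toAlgHom (u []) • (1 : A))) := fun _ => rfl
  rw [← Finsupp.sum_single t, Finsupp.sum, map_sum]
  refine Finset.sum_eq_zero fun w _ => ?_
  refine M.sub_induction (p := fun a => E (Finsupp.single w a) = 0) (ht w) ?_ ?_ ?_ ?_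
  · rw [hE, h_single, M.c_one, map_zero, map_zero, zero_add, twD_single_D, A.d_one,
      parity_of_mem _ A.one_mem, Int.negOnePow_zero, one_smul, one_smul, Finsupp.single_zero,
      zero_add]
    match w with
    | [] => simp [D]
    | x :: w => rw [D, map_sub, h_h, sub_zero, h_single, M.c_b]; simp
  · intro i
    have h0 : ε.toAlgHom (M.b i) = 0 := ε.map_gr _ (by have := M.deg_pos i; omega) _ (M.b_mem i)
    have h1 : M.h (Finsupp.single w (M.b i)) = Finsupp.single (i :: w) 1 := by
      simp [h_single, M.c_b]
    have h2 : ε.toAlgHom (Finsupp.single w (M.b i) []) = 0 := by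
      rw [Finsupp.single_apply]
      split <;> simp [h0]
    rw [hE, h1, h2, zero_smul, Finsupp.single_zero, sub_zero, twD_single_D (a := 1), A.d_one,
      parity_of_mem _ A.one_mem, Int.negOnePow_zero, one_smul, one_smul, Finsupp.single_zero,
      zero_add, D_cons]
    abel
  · intro x y hx hy
    rw [Finsupp.single_add, map_add, hx, hy, add_zero]
  · intro c x hx
    rw [← Finsupp.smul_single, map_smul, hx, smul_zero]

theorem aug_D (ε : A.Augmentation) (w : List M.B) : ε.toAlgHom (M.D w []) = 0 := by
  classical
  match w with
  | [] => exact map_zero _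
  | x :: w =>
    rw [D, Finsupp.sub_apply, h_nil, sub_zero, Finsupp.single_apply]
    split
    · exact ε.map_gr _ (by have := M.deg_pos x; omega) _ (M.b_mem x)
    · exact map_zero _

theorem aug_twD (ε : A.Augmentation) (t : List M.B →₀ A) :
    ε.toAlgHom (twD A.selfRight M.D t []) = 0 := by
  classical
  induction t using Finsupp.induction_linear with
  | zero => simp
  | add s t hs ht => rw [map_add, Finsupp.add_apply, map_add, hs, ht, add_zero]
  | single w a =>
    rw [twD_single_D, Finsupp.add_apply, map_add, Finsupp.smul_apply, smul_eq_mul, map_mul,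
      aug_D, mul_zero, add_zero, Finsupp.single_apply]
    split
    · exact ε.map_d a
    · exact map_zero _

theorem twD_twD_single (w : List M.B) (a : A) :
    twD A.selfRight M.D (twD A.selfRight M.D (Finsupp.single w a)) =
      a • twD A.selfRight M.D (M.D w) := by
  rw [twD_single_D, map_add, twD_single_D, A.isComplex.d_d, Finsupp.single_zero, zero_add, twD_smul,
    d_parity A.isComplex, parity_parity, neg_smul, add_neg_cancel_left]

/-- The differential squares to zero: on `[x|w]` this follows from the contraction formula for
`x [w]`, given that it holds for `w`. -/
theorem twD_D (ε : A.Augmentation) (w : List M.B) : twD A.selfRight M.D (M.D w) = 0 := by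
  induction w with
  | nil => exact map_zero _
  | cons x w ih =>
    have h := M.contraction ε (M.twD_mem (M.single_mem_sub (w := w) (M.b_mem_sub x)))
    rw [twD_twD_single, ih, smul_zero, map_zero, add_zero, aug_twD, zero_smul,
      Finsupp.single_zero, sub_zero] at h
    rw [D_cons, map_sub, h, sub_self]

/-- The degree of a word in the bar construction. -/
def wordDeg (w : List M.B) : ℤ := (w.map fun x => M.deg x - 1).sum

/-- The layer of a word in the bar construction: both `d` on a letter and the multiplication of two
letters lower the total weight, since `d` lowers the weight `3` to `2`, and `2 + 2 > 3`. -/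
def wordWt (w : List M.B) : ℕ := (w.map M.wt).sum

theorem wordDeg_nonneg (w : List M.B) : 0 ≤ M.wordDeg w := by
  refine List.sum_nonneg fun n hn => ?_
  obtain ⟨x, _, rfl⟩ := List.mem_map.1 hn
  have := M.deg_pos x
  omega

theorem wordDeg_cons (x : M.B) (w : List M.B) :
    M.wordDeg (x :: w) = M.deg x - 1 + M.wordDeg w := by simp [wordDeg]

theorem wordWt_cons (x : M.B) (w : List M.B) :
    M.wordWt (x :: w) = M.wt x + M.wordWt w := by simp [wordWt]

theorem D_homogeneous (w u : List M.B) :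
    M.D w u ∈ A.gr (M.wordDeg w + 1 - M.wordDeg u) := by
  classical
  induction w generalizing u with
  | nil => exact Submodule.zero_mem _
  | cons x w ih =>
    rw [D, Finsupp.sub_apply]
    refine Submodule.sub_mem _ ?_ ?_
    · rw [Finsupp.single_apply]
      split
      · rename_i h
        subst h
        rw [wordDeg_cons, show M.deg x - 1 + M.wordDeg w + 1 - M.wordDeg w = M.deg x by ring]
        exact M.b_mem x
      · exact Submodule.zero_mem _
    · match u with
      | [] => rw [h_nil]; exact Submodule.zero_mem _
      | y :: u =>
        rw [h_cons]
        by_cases h0 : M.c ((Finsupp.single w (A.d (M.b x)) +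
            parity A.isComplex.internal (M.b x) • M.D w) u) y = 0
        · rw [h0, zero_smul]; exact Submodule.zero_mem _
        · have hmem : (Finsupp.single w (A.d (M.b x)) +
              parity A.isComplex.internal (M.b x) • M.D w) u ∈
                A.gr (M.deg x + (M.wordDeg w + 1 - M.wordDeg u)) := by
            rw [Finsupp.add_apply]
            refine Submodule.add_mem _ ?_ ?_
            · rw [Finsupp.single_apply]
              split
              · rename_i h
                subst h
                have := A.isComplex.d_mem _ _ (M.b_mem x)
                rwa [add_sub_cancel_left]
              · exact Submodule.zero_mem _
            · refine A.mul_mem _ _ _ _ ?_ (ih u)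
              rw [parity_of_mem _ (M.b_mem x), Units.smul_def]
              exact zsmul_mem (M.b_mem x) _
          have := M.deg_eq _ _ hmem y h0
          rw [wordDeg_cons, wordDeg_cons,
            show M.deg x - 1 + M.wordDeg w + 1 - (M.deg y - 1 + M.wordDeg u) = 0 by omega]
          exact Submodule.smul_mem _ _ A.one_mem

/-- The coefficients of the differential vanish except in lower layers, and are scalars unless
the layer drops at least by `2`. -/
theorem D_wt (w u : List M.B) : M.D w u = 0 ∨ M.wordWt u + 2 ≤ M.wordWt w ∨
    M.wordWt u + 1 ≤ M.wordWt w ∧ ∃ c : k, M.D w u = c • 1 := by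
  classical
  induction w generalizing u with
  | nil => exact Or.inl rfl
  | cons x w ih =>
    by_cases huw : w = u
    · subst huw
      have := M.two_le_wt x
      rw [wordWt_cons]
      exact Or.inr (Or.inl (by omega))
    rw [D, Finsupp.sub_apply, Finsupp.single_apply, if_neg huw, zero_sub]
    match u with
    | [] => rw [h_nil, neg_zero]; exact Or.inl rfl
    | y :: u =>
      rw [h_cons, ← neg_smul]
      by_cases h0 : M.c ((Finsupp.single w (A.d (M.b x)) +
          parity A.isComplex.internal (M.b x) • M.D w) u) y = 0
      · rw [h0, neg_zero, zero_smul]; exact Or.inl rfl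
      refine Or.inr (Or.inr ⟨?_, _, rfl⟩)
      rw [wordWt_cons, wordWt_cons]
      rw [Finsupp.add_apply, map_add, Finsupp.add_apply] at h0
      by_cases h1 : M.c (Finsupp.single w (A.d (M.b x)) u) y = 0
      · rw [h1, zero_add, Finsupp.smul_apply, smul_eq_mul] at h0
        have := M.wt_le_three y
        have := M.two_le_wt x
        rcases ih u with h2 | h2 | ⟨h2, c, hc⟩
        · rw [h2, mul_zero, map_zero] at h0
          exact absurd rfl h0
        · omega
        · have hxy : x = y := by
            by_contra hxy
            refine h0 ?_
            rw [hc, mul_smul_comm, mul_one, parity_of_mem _ (M.b_mem x), map_smul, map_sign_smul,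
              M.c_b, Finsupp.smul_apply, Units.smul_def, Finsupp.smul_apply,
              Finsupp.single_apply, if_neg hxy, smul_zero, smul_zero]
          subst hxy
          omega
      · rw [Finsupp.single_apply] at h1
        split at h1
        · rename_i h
          subst h
          have := M.wt_lt x y h1
          omega
        · rw [map_zero] at h1
          exact absurd rfl h1

/-- The bar construction as a twisting. -/
noncomputable def twisting (ε : A.Augmentation) : Twisting A (List M.B) where
  D := M.D
  deg := M.wordDeg
  rk := M.wordWt
  mem := M.D_homogeneous
  lt w u h := by
    rcases M.D_wt w u with h' | h' | ⟨h', _⟩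
    · exact absurd h' h
    · omega
    · omega
  sq := M.twD_D ε

/-- The bar construction is acyclic up to `k`. The filtration by layers replaces a cycle with
coefficients in `A` by one with coefficients in the quasi-isomorphic `A'`, where the contraction
applies. -/
theorem exists_twD_eq (ε : A.Augmentation) {t : List M.B →₀ A} (ht : twD A.selfRight M.D t = 0)
    (hε : ε.toAlgHom (t []) = 0) : ∃ s, twD A.selfRight M.D s = t := by
  obtain ⟨s, hs⟩ := (M.twisting ε).exists_sub_d_mem A.selfRight (fun _ => M.sub)
    (fun i j x hx => M.mul_mem (M.parity_mem hx) (M.D_mem i j)) ⊤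
    (fun t _ i hi => by
      obtain ⟨s, hs⟩ := M.exists_sub_d_mem (t i) hi
      exact ⟨s, hs, trivial⟩) t trivial (fun i => by
        have : (M.twisting ε).d A.selfRight t = 0 := ht
        rw [this]
        exact Submodule.zero_mem _)
  have h1 : twD A.selfRight M.D (M.h (t - twD A.selfRight M.D s)) +
      M.h (twD A.selfRight M.D (t - twD A.selfRight M.D s)) = (t - twD A.selfRight M.D s) -
        Finsupp.single [] (ε.toAlgHom ((t - twD A.selfRight M.D s) []) • (1 : A)) :=
    M.contraction ε hs
  have h2 : twD A.selfRight M.D (t - twD A.selfRight M.D s) = 0 := by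
    have : twD A.selfRight M.D (twD A.selfRight M.D s) = 0 := (M.twisting ε).d_d A.selfRight s
    rw [map_sub, ht, this, sub_zero]
  have h3 : ε.toAlgHom ((t - twD A.selfRight M.D s) []) = 0 := by
    rw [Finsupp.sub_apply, map_sub, hε, M.aug_twD, sub_zero]
  rw [h2, h3, map_zero, add_zero, zero_smul, Finsupp.single_zero, sub_zero] at h1
  exact ⟨M.h (t - twD A.selfRight M.D s) + s, by rw [map_add, h1, sub_add_cancel]⟩

theorem twD_single_nil (c : k) :
    twD A.selfRight M.D (Finsupp.single [] (c • (1 : A))) = 0 := by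
  rw [M.twD_single_D, map_smul, A.d_one, smul_zero, Finsupp.single_zero, zero_add]
  exact smul_zero _

end ConnectedModel

end Resolution

section Resolution

variable {k : Type v} [Field k] {A : DGAlgebra.{v, max w v} k} (M : ConnectedModel A)

/-- The semifree resolution of the ground field given by the bar construction. -/
noncomputable def ConnectedModel.resolution (ε : A.Augmentation) :
    SemifreeResolution.{v, max w v, v} ε.fieldModule where
  P := (M.twisting ε).toModule
  isSemifree := (M.twisting ε).isSemifree
  π :=
    { toLinearMap :=
        { toFun := fun t : List M.B →₀ A => ε.toAlgHom (t [])
          map_add' := fun s t : List M.B →₀ A => map_add ε.toAlgHom (s []) (t [])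
          map_smul' := fun a (t : List M.B →₀ A) => map_mul ε.toAlgHom a (t []) }
      map_gr := by
        intro n (t : List M.B →₀ A) ht
        have h := ht []
        change ε.toAlgHom (t []) ∈ fieldGr k n
        by_cases hn : n = 0
        · simp [fieldGr, hn]
        · rw [ε.map_gr n hn]
          · exact Submodule.zero_mem _
          · have e : n - M.wordDeg [] = n := by simp [ConnectedModel.wordDeg]
            rw [← e]
            exact h
      map_d := fun t => (M.aug_twD ε t).symm }
  quasiIso := by
    constructor
    · rw [injective_iff_map_eq_zero]
      intro x hx
      obtain ⟨⟨t, ht⟩, rfl⟩ := Submodule.Quotient.mk_surjective _ x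
      obtain ⟨y, hy⟩ := (Submodule.Quotient.mk_eq_zero _).1 hx
      exact (Submodule.Quotient.mk_eq_zero _).2 (M.exists_twD_eq ε ht hy.symm)
    · intro x
      obtain ⟨⟨(c : k), hc⟩, rfl⟩ := Submodule.Quotient.mk_surjective _ x
      refine ⟨Submodule.Quotient.mk ⟨Finsupp.single [] (c • (1 : A)), M.twD_single_nil c⟩, ?_⟩
      refine congrArg (Submodule.Quotient.mk) (Subtype.ext ?_)
      change ε.toAlgHom (Finsupp.single [] (c • (1 : A)) []) = c
      rw [Finsupp.single_eq_same, map_smul, map_one, smul_eq_mul, mul_one]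

end Resolution

section LowestDegree

variable {k : Type v} [Field k] {A : DGAlgebra.{v, w} k} (M : ConnectedModel A)
  (ε : A.Augmentation) (N : DGRightModule.{v, w, w'} A)

/-- The lowest nonzero homology of `N` embeds into the homology of the twisted complex, since
the words have nonnegative degrees. -/
theorem ConnectedModel.mem_range_of_single_mem_range {n : ℤ}
    (hN : ∀ m < n, ∀ x ∈ N.gr m, N.d x = 0 → x ∈ LinearMap.range N.d) {x : N} (hx : x ∈ N.gr n)
    (h : Finsupp.single [] x ∈ LinearMap.range ((M.twisting ε).d N)) :
    x ∈ LinearMap.range N.d := by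
  classical
  set T := M.twisting ε
  obtain ⟨t, ht⟩ := h
  have hnil : T.deg [] = 0 := by simp [T, ConnectedModel.twisting, ConnectedModel.wordDeg]
  have hDnil : T.D [] = 0 := rfl
  have hT := T.isComplex N
  have ht' : T.d N (proj hT.internal (n - 1) t) = Finsupp.single [] x := by
    rw [d_proj hT, ht, sub_add_cancel]
    exact proj_of_mem _ (T.single_mem (by rwa [hnil, sub_zero]))
  obtain ⟨s, hs⟩ := T.exists_sub_d_mem N (fun w => if w = [] then ⊤ else ⊥)
    (fun w u y hy => by
      by_cases hw : w = []
      · subst hw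
        rw [hDnil, Finsupp.zero_apply, MulOpposite.op_zero, zero_smul]
        exact Submodule.zero_mem _
      · rw [if_neg hw, Submodule.mem_bot] at hy
        rw [hy, map_zero, smul_zero]
        exact Submodule.zero_mem _)
    (T.gr N (n - 1))
    (fun t ht w hw => by
      by_cases h : w = []
      · exact ⟨0, by rw [if_pos h]; trivial, by
          rw [Finsupp.single_zero, map_zero]; exact Submodule.zero_mem _⟩
      · rw [if_neg h, Submodule.mem_bot] at hw
        have hdeg : 0 ≤ T.deg w := M.wordDeg_nonneg w
        obtain ⟨s, hs⟩ := hN _ (by omega) _ (ht w) hw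
        refine ⟨proj N.isComplex.internal (n - 1 - T.deg w - 1) s, ?_, ?_⟩
        · rw [d_proj N.isComplex, sub_add_cancel, hs, proj_of_mem _ (ht w), sub_self]
          exact Submodule.zero_mem _
        · have := hT.d_mem (n - 1 - 1) (Finsupp.single w
            (proj N.isComplex.internal (n - 1 - T.deg w - 1) s)) (T.single_mem (by
              rw [show n - 1 - 1 - T.deg w = n - 1 - T.deg w - 1 by ring]
              exact proj_mem _ _ _))
          rwa [sub_add_cancel] at this)
    (proj hT.internal (n - 1) t) (proj_mem _ _ _) (fun w => by
      rw [ht']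
      by_cases h : w = []
      · rw [if_pos h]; trivial
      · rw [if_neg h, Finsupp.single_apply, if_neg (Ne.symm h)]
        exact Submodule.zero_mem _)
  set u := proj hT.internal (n - 1) t - T.d N s
  have hu : u = Finsupp.single [] (u []) := by
    refine Finsupp.ext fun w => ?_
    rw [Finsupp.single_apply]
    split
    · rename_i h; rw [h]
    · rename_i h
      have := hs w
      rwa [if_neg (Ne.symm h), Submodule.mem_bot] at this
  have hdu : T.d N u = Finsupp.single [] x := by rw [map_sub, ht', T.d_d, sub_zero]
  rw [hu, Twisting.d, twD_single, hDnil, map_zero, add_zero] at hdu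
  exact ⟨u [], Finsupp.single_injective _ hdu⟩

end LowestDegree

/-! ### Tor of dimension one -/

section Tor

variable {k : Type v} [Field k]

section Abstract

variable {U V : Type*} [AddCommGroup U] [Module k U] [AddCommGroup V] [Module k V]
  {dU : U →ₗ[k] U} {dV : V →ₗ[k] V} {f : U →ₗ[k] V} {s : ℤˣ}

theorem map_mem_range (hf : ∀ u, dV (f u) = -(s • f (dU u))) {u : U}
    (hu : u ∈ LinearMap.range dU) : f u ∈ LinearMap.range dV := by
  obtain ⟨u, rfl⟩ := hu
  refine ⟨-(s • f u), ?_⟩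
  rw [map_neg, map_sign_smul, hf, smul_neg, neg_neg, smul_smul, Int.units_mul_self, one_smul]

theorem IsQuasiIso.rank_eq_one (h : IsQuasiIso dU dV f) (hf : ∀ u, dV (f u) = -(s • f (dU u)))
    (hU : Module.rank k (Homology dU) = 1) : Module.rank k (Homology dV) = 1 := by
  rw [rank_homology_eq_one_iff] at hU ⊢
  obtain ⟨z, hz, hz0, hz'⟩ := hU
  refine ⟨f z, by rw [hf, hz, map_zero, smul_zero, neg_zero], fun h0 => hz0 (h.inj z hz h0),
    fun x hx => ?_⟩
  obtain ⟨u, hu, hxu⟩ := h.surj x hx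
  obtain ⟨c, hc⟩ := hz' u hu
  refine ⟨c, ?_⟩
  have := Submodule.add_mem _ hxu (map_mem_range hf hc)
  rwa [map_sub, map_smul, sub_add_sub_cancel] at this

/-- A map of complexes with one-dimensional homology is a quasi-isomorphism as soon as the image
of a generator is not a boundary. -/
theorem isQuasiIso_of_rank_eq_one (hf : ∀ u, dV (f u) = -(s • f (dU u)))
    (hV : Module.rank k (Homology dV) = 1) {z : U} (hz : dU z = 0)
    (hz' : ∀ x, dU x = 0 → ∃ c : k, x - c • z ∈ LinearMap.range dU)
    (hfz : f z ∉ LinearMap.range dV) : IsQuasiIso dU dV f := by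
  obtain ⟨y, hy, hy0, hy'⟩ := (rank_homology_eq_one_iff dV).1 hV
  have hdfz : dV (f z) = 0 := by rw [hf, hz, map_zero, smul_zero, neg_zero]
  constructor
  · intro u hu hfu
    obtain ⟨c, hc⟩ := hz' u hu
    have h1 := Submodule.sub_mem _ hfu (map_mem_range hf hc)
    rw [map_sub, map_smul, sub_sub_cancel] at h1
    by_cases h0 : c = 0
    · rwa [h0, zero_smul, sub_zero] at hc
    · have := Submodule.smul_mem _ c⁻¹ h1
      rw [smul_smul, inv_mul_cancel₀ h0, one_smul] at this
      exact absurd this hfz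
  · intro x hx
    obtain ⟨c, hc⟩ := hy' _ hdfz
    obtain ⟨c', hc'⟩ := hy' _ hx
    have h0 : c ≠ 0 := by
      rintro rfl
      rw [zero_smul, sub_zero] at hc
      exact hfz hc
    refine ⟨(c' * c⁻¹) • z, by rw [map_smul, hz, smul_zero], ?_⟩
    have := Submodule.sub_mem _ hc' (Submodule.smul_mem _ (c' * c⁻¹) hc)
    rwa [smul_sub, smul_smul, mul_assoc, inv_mul_cancel₀ h0, mul_one, sub_sub_sub_cancel_right,
      ← map_smul] at this

theorem exists_eq_sum_proj {gr : ℤ → Submodule k U} (h : DirectSum.IsInternal gr) (x : U) :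
    ∃ s : Finset ℤ, x = ∑ n ∈ s, proj h n x := by
  classical
  have := (decomp h).symm_apply_apply x
  rw [decomp, LinearEquiv.symm_symm, LinearEquiv.ofBijective_apply,
    DirectSum.coeLinearMap_eq_dfinsuppSum] at this
  exact ⟨_, this.symm⟩

theorem IsComplex.isAcyclic {gr : ℤ → Submodule k U} (h : IsComplex gr dU)
    (hgr : ∀ n, ∀ x ∈ gr n, dU x = 0 → x ∈ LinearMap.range dU) : IsAcyclic dU := by
  intro x hx
  obtain ⟨s, hs⟩ := exists_eq_sum_proj h.internal x
  rw [hs]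
  refine Submodule.sum_mem _ fun n _ => hgr n _ (proj_mem _ _ _) ?_
  rw [d_proj h, hx, map_zero]

/-- The homology vanishes in all sufficiently low degrees. -/
def IsBoundedBelow (gr : ℤ → Submodule k U) (d : U →ₗ[k] U) : Prop :=
  ∃ n₀, ∀ n < n₀, ∀ x ∈ gr n, d x = 0 → x ∈ LinearMap.range d

/-- If a complex has bounded below homology and is not acyclic, there is a lowest nonzero
homology class. -/
theorem IsComplex.exists_lowest {gr : ℤ → Submodule k U} (h : IsComplex gr dU)
    (hb : IsBoundedBelow gr dU) (hac : ¬IsAcyclic dU) :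
    ∃ n, ∃ x ∈ gr n, dU x = 0 ∧ x ∉ LinearMap.range dU ∧
      ∀ m < n, ∀ x ∈ gr m, dU x = 0 → x ∈ LinearMap.range dU := by
  obtain ⟨n₀, hn₀⟩ := hb
  obtain ⟨n, ⟨x, hx, hdx, hx'⟩, hmin⟩ := Int.exists_least_of_bdd
    (P := fun n => ∃ x ∈ gr n, dU x = 0 ∧ x ∉ LinearMap.range dU)
    ⟨n₀, fun n ⟨x, hx, hdx, hx'⟩ => by
      by_contra hn
      exact hx' (hn₀ n (by omega) x hx hdx)⟩
    (by
      by_contra hne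
      push Not at hne
      exact hac (h.isAcyclic hne))
  refine ⟨n, x, hx, hdx, hx', fun m hm y hy hdy => ?_⟩
  by_contra hy'
  have := hmin m ⟨y, hy, hdy, hy'⟩
  omega

end Abstract

/-- The homology of `L` is freely generated by one homogeneous class over the homology of `A`. -/
def DGRightModule.IsQuasiFree {A : DGAlgebra.{v, w} k} (L : DGRightModule.{v, w, w'} A) : Prop :=
  ∃ n, ∃ ω ∈ L.gr n, L.d ω = 0 ∧ IsQuasiIso A.d L.d (L.act ω)

theorem SemifreeResolution.rank_homology {A : DGAlgebra.{v, w} k} {ε : A.Augmentation}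
    (R : SemifreeResolution ε.fieldModule) : Module.rank k (Homology R.P.d) = 1 := by
  have e := LinearEquiv.ofBijective _ R.quasiIso
  have h : Module.rank k (Homology (0 : k →ₗ[k] k)) = 1 :=
    (rank_homology_eq_one_iff _).2 ⟨1, rfl, fun ⟨y, hy⟩ => zero_ne_one hy, fun x _ => ⟨x, 0, by
      rw [map_zero, smul_eq_mul, mul_one, sub_self]⟩⟩
  rw [Module.rank_eq_one_iff_finrank_eq_one] at h ⊢
  rw [e.finrank_eq]
  exact h

/-- If the homology of `L` is free of rank one, then `Tor(k, L)` has dimension one for any choice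
of a resolution. -/
theorem DGRightModule.IsQuasiFree.rank_tensor {A : DGAlgebra.{v, w} k} {ε : A.Augmentation}
    {L : DGRightModule.{v, w, w'} A} (hL : L.IsQuasiFree)
    (R : SemifreeResolution ε.fieldModule) : Module.rank k (Homology (tensorD L R.P)) = 1 := by
  obtain ⟨n, ω, hω, hd, hq⟩ := hL
  obtain ⟨ι, e, T, hT, -⟩ := R.isSemifree.exists_twisting
  have hT' : T.D = fun i => e.repr (R.P.d (e i)) := funext hT
  have h1 : Module.rank k (Homology (T.d A.selfRight)) = 1 := by
    rw [← R.rank_homology]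
    exact (homologyEquiv (e.repr.restrictScalars k) fun y => by
      rw [Twisting.d, hT']; exact repr_d e y).rank_eq.symm
  have h2 : IsQuasiIso (T.d A.selfRight) (T.d L) (L.coordAct ω) :=
    (isAcyclic_twisted_cone L hω hd T).1 fun t ht => by
      obtain ⟨s, hs⟩ := T.exists_eq_d (cone L n ω hω hd) (fun x hx => by
        obtain ⟨y, hy⟩ := (isAcyclic_cone L hω hd).2 hq x hx
        exact ⟨y, hy.symm⟩) t ht
      exact ⟨s, hs.symm⟩
  rw [← h2.rank_eq_one (d_coordAct L hω hd T) h1]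
  exact (homologyEquiv (tensorEquiv L e) fun t => by
    rw [Twisting.d, hT']; exact tensorEquiv_d L e t).rank_eq

theorem DGAlgebra.IsConnected.isBoundedBelow_cone {A : DGAlgebra.{v, w} k} (hA : A.IsConnected)
    {L : DGRightModule.{v, w, w'} A} (hL : IsBoundedBelow L.gr L.d) {n : ℤ} {ω : L}
    (hω : ω ∈ L.gr n) (hd : L.d ω = 0) :
    IsBoundedBelow (cone L n ω hω hd).gr (cone L n ω hω hd).d := by
  obtain ⟨n₀, hn₀⟩ := hL
  refine ⟨min n₀ (n - 1), fun m hm x hx hdx => ?_⟩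
  obtain ⟨a, x⟩ := x
  obtain ⟨ha, hx⟩ := hx
  obtain rfl : a = 0 := by
    have ha' : a ∈ A.gr (m - n + 1) := ha
    rwa [hA.gr_neg _ (by omega), Submodule.mem_bot] at ha'
  have hdx' : L.d x = 0 := by
    have h := congrArg Prod.snd hdx
    change L.act ω 0 + L.d x = 0 at h
    rwa [map_zero, zero_add] at h
  obtain ⟨y, hy⟩ := hn₀ m (by omega) x hx hdx'
  refine ⟨((0 : A), y), Prod.ext ?_ ?_⟩
  · change (n + 1).negOnePow • A.d 0 = 0
    rw [map_zero, smul_zero]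
  · change L.act ω 0 + L.d y = x
    rw [map_zero, zero_add, hy]

/-- If `Tor(k, L)` has dimension one, then the homology of `L` is free of rank one: a lowest
class `ω` of `L` survives in `Tor`, so that `Tor(k, cone ω) = 0`; as the lowest class of the
cone would survive as well, the cone is acyclic. -/
theorem ConnectedModel.isQuasiFree {A : DGAlgebra.{v, w} k} (hA : A.IsConnected)
    (M : ConnectedModel A) (ε : A.Augmentation) {L : DGRightModule.{v, w, w'} A}
    (hL : IsBoundedBelow L.gr L.d)
    (hrank : Module.rank k (Homology ((M.twisting ε).d L)) = 1) : L.IsQuasiFree := by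
  set T := M.twisting ε
  have hnil : T.D [] = 0 := rfl
  have hac : ¬IsAcyclic L.d := by
    intro hac
    obtain ⟨z, hz, hz0, -⟩ := (rank_homology_eq_one_iff _).1 hrank
    obtain ⟨s, hs⟩ := T.exists_eq_d L (fun x hx => by
      obtain ⟨y, hy⟩ := hac x hx
      exact ⟨y, hy.symm⟩) z hz
    exact hz0 ⟨s, hs.symm⟩
  obtain ⟨n, ω, hω, hd, hω', hlow⟩ := L.isComplex.exists_lowest hL hac
  refine ⟨n, ω, hω, hd, (isAcyclic_cone L hω hd).1 ?_⟩
  have hgen : IsQuasiIso (T.d A.selfRight) (T.d L) (L.coordAct ω) := by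
    refine isQuasiIso_of_rank_eq_one (d_coordAct L hω hd T) hrank (z := Finsupp.single [] 1) ?_
      (fun x hx => ⟨ε.toAlgHom (x []), ?_⟩) ?_
    · have := M.twD_single_nil 1
      rwa [one_smul] at this
    · refine M.exists_twD_eq ε ?_ ?_
      · have h0 := M.twD_single_nil 1
        rw [one_smul] at h0
        have hx' : twD A.selfRight M.D x = 0 := hx
        rw [map_sub, map_smul, h0, hx', smul_zero, sub_zero]
      · rw [Finsupp.sub_apply, map_sub, Finsupp.smul_apply, Finsupp.single_eq_same, map_smul,
          map_one, smul_eq_mul, mul_one, sub_self]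
    · rw [L.coordAct_single, MulOpposite.op_one, one_smul]
      exact fun h => hω' (M.mem_range_of_single_mem_range ε L hlow hω h)
  have htw := (isAcyclic_twisted_cone L hω hd T).2 hgen
  by_contra hne
  obtain ⟨m, x, hx, hdx, hx', hlow'⟩ :=
    (cone L n ω hω hd).isComplex.exists_lowest (hA.isBoundedBelow_cone hL hω hd) hne
  refine hx' (M.mem_range_of_single_mem_range ε _ hlow' hx (htw _ ?_))
  rw [Twisting.d, twD_single, hdx, hnil, Finsupp.single_zero, map_zero, add_zero]

theorem rank_tensor_resolution {A : DGAlgebra.{v, max w v} k} (M : ConnectedModel A)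
    (ε : A.Augmentation) (L : DGRightModule.{v, max w v, w'} A) :
    Module.rank k (Homology (tensorD L (M.resolution ε).P)) =
      Module.rank k (Homology ((M.twisting ε).d L)) := by
  let e : Module.Basis (List M.B) A (M.resolution ε).P :=
    (Finsupp.basisSingleOne : Module.Basis (List M.B) A (List M.B →₀ A))
  have hT : M.D = fun i => e.repr ((M.resolution ε).P.d (e i)) := by
    funext w
    change M.D w = twD A.selfRight M.D (Finsupp.single w 1)
    rw [M.twD_single_D, A.d_one, parity_of_mem _ A.one_mem, Int.negOnePow_zero, one_smul,
      one_smul, Finsupp.single_zero, zero_add]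
  exact (homologyEquiv (tensorEquiv L e) fun t => by
    change _ = twD L M.D _
    rw [hT]; exact tensorEquiv_d L e t).rank_eq

/-- `dim Tor^A(k, L) = 1` means that the homology of `L` is free of rank one. -/
theorem dimTorEq_one_iff {A : DGAlgebra.{v, max w v} k} (hA : A.IsConnected)
    (ε : A.Augmentation) {L : DGRightModule.{v, max w v, w'} A} (hL : IsBoundedBelow L.gr L.d) :
    DimTorEq ε.fieldModule L 1 ↔ L.IsQuasiFree := by
  obtain ⟨M⟩ := hA.exists_connectedModel
  constructor
  · intro h
    have := h.2 (M.resolution ε)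
    rw [rank_tensor_resolution] at this
    exact M.isQuasiFree hA ε hL this
  · exact fun h => ⟨⟨M.resolution ε⟩, fun R => h.rank_tensor R⟩

end Tor

/-! ### Duality -/

section UniversalCoefficients

variable {k : Type v} [Field k] {V : Type*} [AddCommGroup V] [Module k V]

/-- The functional `θ` vanishes on the components of degree different from `n`. -/
def VanishesOff (gr : ℤ → Submodule k V) (n : ℤ) (θ : Module.Dual k V) : Prop :=
  ∀ m, m ≠ n → ∀ z ∈ gr m, θ z = 0

variable {gr : ℤ → Submodule k V} {d : V →ₗ[k] V}

theorem vanishesOff_comp_proj (h : DirectSum.IsInternal gr) (n : ℤ) (θ : Module.Dual k V) :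
    VanishesOff gr n (θ ∘ₗ proj h n) := fun m hm z hz => by
  rw [LinearMap.comp_apply, proj_of_mem_ne h hm hz, map_zero]

theorem VanishesOff.apply_proj (h : DirectSum.IsInternal gr) {n : ℤ} {θ : Module.Dual k V}
    (hθ : VanishesOff gr n θ) (x : V) : θ (proj h n x) = θ x := by
  refine graded_induction (p := fun x => θ (proj h n x) = θ x) h x (fun m x hx => ?_)
    (fun x y hx hy => by simp only [map_add, hx, hy])
  by_cases hm : m = n
  · subst hm; rw [proj_of_mem h hx]
  · rw [proj_of_mem_ne h hm hx, map_zero, hθ m hm x hx]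

theorem VanishesOff.ext (h : DirectSum.IsInternal gr) {n : ℤ} {θ θ' : Module.Dual k V}
    (hθ : VanishesOff gr n θ) (hθ' : VanishesOff gr n θ') (heq : ∀ x ∈ gr n, θ x = θ' x) :
    θ = θ' := LinearMap.ext fun x => by
  rw [← hθ.apply_proj h, ← hθ'.apply_proj h, heq _ (proj_mem h n x)]

/-- The functional on homology induced by a cocycle. -/
def Homology.functional (d : V →ₗ[k] V) (θ : Module.Dual k V) (hθ : ∀ x, θ (d x) = 0) :
    Module.Dual k (Homology d) :=
  Submodule.liftQ _ (θ ∘ₗ (LinearMap.ker d).subtype) (by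
    rintro ⟨x, hx⟩ ⟨y, hy⟩
    exact (congrArg θ hy).symm.trans (hθ y))

/-- Functionals on homology are induced by cocycles. -/
theorem IsComplex.exists_functional (h : IsComplex gr d) (n : ℤ) (φ : Module.Dual k (Homology d)) :
    ∃ θ : Module.Dual k V, VanishesOff gr n θ ∧ (∀ x, θ (d x) = 0) ∧
      ∀ z : LinearMap.ker d, (z : V) ∈ gr n → θ z = φ (Homology.mk d z) := by
  obtain ⟨θ, hθ⟩ := LinearMap.exists_extend
    (φ ∘ₗ Submodule.mkQ ((LinearMap.range d).comap (LinearMap.ker d).subtype))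
  have hθ' : ∀ z : LinearMap.ker d, θ z = φ (Homology.mk d z) := fun z => LinearMap.congr_fun hθ z
  refine ⟨θ ∘ₗ proj h.internal n, vanishesOff_comp_proj _ _ _, fun x => ?_, fun z hz => ?_⟩
  · have e : proj h.internal n (d x) = d (proj h.internal (n - 1) x) := by
      rw [d_proj h, sub_add_cancel]
    have h0 : (Homology.mk d ⟨d (proj h.internal (n - 1) x), h.d_d _⟩) = 0 :=
      (Submodule.Quotient.mk_eq_zero _).2 ⟨_, rfl⟩
    rw [LinearMap.comp_apply, e]
    refine (hθ' ⟨d (proj h.internal (n - 1) x), h.d_d _⟩).trans ?_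
    rw [h0, map_zero]
  · rw [LinearMap.comp_apply, proj_of_mem _ hz, hθ']

/-- A functional that vanishes on the cycles is a coboundary. -/
theorem IsComplex.exists_eq_comp_d (h : IsComplex gr d) {n : ℤ} {θ : Module.Dual k V}
    (hθ : VanishesOff gr n θ) (hz : ∀ z ∈ gr n, d z = 0 → θ z = 0) :
    ∃ θ' : Module.Dual k V, VanishesOff gr (n + 1) θ' ∧ ∀ x, θ x = θ' (d x) := by
  have hker : LinearMap.ker d ≤ LinearMap.ker θ := by
    intro z hzd
    rw [LinearMap.mem_ker, ← hθ.apply_proj h.internal]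
    exact hz _ (proj_mem _ _ _) (by rw [d_proj h, LinearMap.mem_ker.1 hzd, map_zero])
  obtain ⟨θ', hθ'⟩ := LinearMap.exists_extend
    ((LinearMap.ker d).liftQ θ hker ∘ₗ (d.quotKerEquivRange).symm.toLinearMap)
  have key : ∀ x, θ' (d x) = θ x := by
    intro x
    refine (LinearMap.congr_fun hθ' ⟨d x, x, rfl⟩).trans ?_
    have : d.quotKerEquivRange.symm ⟨d x, x, rfl⟩ = Submodule.Quotient.mk x :=
      (LinearEquiv.symm_apply_eq _).2 rfl
    rw [LinearMap.comp_apply, LinearEquiv.coe_coe, this]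
    rfl
  refine ⟨θ' ∘ₗ proj h.internal (n + 1), vanishesOff_comp_proj _ _ _, fun x => ?_⟩
  rw [LinearMap.comp_apply, ← d_proj h, key, hθ.apply_proj]

theorem exists_vanishesOff_ne_zero (h : DirectSum.IsInternal gr) {n : ℤ} {z : V} (hz : z ∈ gr n)
    (hz0 : z ≠ 0) : ∃ θ : Module.Dual k V, VanishesOff gr n θ ∧ θ z ≠ 0 := by
  obtain ⟨θ, hθ⟩ := not_forall.1 (mt (Module.forall_dual_apply_eq_zero_iff k z).1 hz0)
  exact ⟨θ ∘ₗ proj h n, vanishesOff_comp_proj h n θ, by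
    rwa [LinearMap.comp_apply, proj_of_mem h hz]⟩

/-- A direct sum is one-dimensional if and only if one summand is one-dimensional and all others
vanish. -/
theorem rank_directSum_eq_one_iff {ι : Type*} {F : ι → Type*} [∀ i, AddCommGroup (F i)]
    [∀ i, Module k (F i)] : Module.rank k (⨁ i, F i) = 1 ↔
      ∃ i, Module.rank k (F i) = 1 ∧ ∀ j, j ≠ i → Subsingleton (F j) := by
  classical
  simp only [Module.rank_eq_one_iff_finrank_eq_one]
  constructor
  · intro h
    obtain ⟨x, hx, hx'⟩ := finrank_eq_one_iff'.1 h
    obtain ⟨i, hi⟩ : ∃ i, x i ≠ 0 := by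
      by_contra! h0
      exact hx (DFinsupp.ext h0)
    refine ⟨i, finrank_eq_one_iff'.2 ⟨x i, hi, fun y => ?_⟩, fun j hj =>
      subsingleton_of_forall_eq 0 fun y => ?_⟩
    · obtain ⟨c, hc⟩ := hx' (DirectSum.lof k ι F i y)
      refine ⟨c, ?_⟩
      have := congrArg (fun z => z i) hc
      simp only [DirectSum.lof_eq_of, DirectSum.of_eq_same] at this
      exact this
    · obtain ⟨c, hc⟩ := hx' (DirectSum.lof k ι F j y)
      have h1 := congrArg (fun z => z i) hc
      have h2 := congrArg (fun z => z j) hc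
      simp only [DirectSum.lof_eq_of, DirectSum.of_eq_same,
        DirectSum.of_eq_of_ne _ _ _ (Ne.symm hj)] at h1 h2
      have h3 : c • x i = 0 := h1
      have h4 : c • x j = y := h2
      rw [← h4, (smul_eq_zero.1 h3).resolve_right hi, zero_smul]
  · rintro ⟨i, hi, hj⟩
    obtain ⟨y, hy, hy'⟩ := finrank_eq_one_iff'.1 hi
    refine finrank_eq_one_iff'.2 ⟨DirectSum.lof k ι F i y, fun h0 => hy ?_, fun x => ?_⟩
    · have := congrArg (fun z => z i) h0
      simp only [DirectSum.lof_eq_of, DirectSum.of_eq_same] at this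
      exact this
    · obtain ⟨c, hc⟩ := hy' (x i)
      refine ⟨c, DFinsupp.ext fun j => ?_⟩
      by_cases hji : j = i
      · subst hji
        change c • (DirectSum.lof k ι F j y) j = x j
        rw [DirectSum.lof_eq_of, DirectSum.of_eq_same, hc]
      · have := hj j hji
        exact Subsingleton.elim _ _

theorem rank_dual_eq_one_iff : Module.rank k (Module.Dual k V) = 1 ↔ Module.rank k V = 1 := by
  rw [Module.rank_eq_one_iff_finrank_eq_one, Module.rank_eq_one_iff_finrank_eq_one,
    Subspace.dual_finrank_eq]

theorem subsingleton_dual_iff : Subsingleton (Module.Dual k V) ↔ Subsingleton V := by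
  constructor
  · intro h
    refine subsingleton_of_forall_eq 0 fun x => ?_
    exact (Module.forall_dual_apply_eq_zero_iff k x).1 fun φ => by
      rw [Subsingleton.elim φ 0, LinearMap.zero_apply]
  · intro h
    exact ⟨fun φ ψ => LinearMap.ext fun x => by rw [Subsingleton.elim x 0, map_zero, map_zero]⟩

/-- The total dimension of a graded vector space is one if and only if this holds for its graded
dual. -/
theorem rank_directSum_dual_eq_one_iff (h : DirectSum.IsInternal gr) {F : ℤ → Type*}
    [∀ n, AddCommGroup (F n)] [∀ n, Module k (F n)]
    (e : ∀ n, F n ≃ₗ[k] Module.Dual k (gr (-n))) :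
    Module.rank k (⨁ n, F n) = 1 ↔ Module.rank k V = 1 := by
  rw [(decomp h).rank_eq, rank_directSum_eq_one_iff, rank_directSum_eq_one_iff]
  have h1 : ∀ n, Module.rank k (F n) = 1 ↔ Module.rank k (gr (-n)) = 1 := fun n => by
    rw [← rank_dual_eq_one_iff (V := gr (-n)), Module.rank_eq_one_iff_finrank_eq_one,
      Module.rank_eq_one_iff_finrank_eq_one, (e n).finrank_eq]
  have h2 : ∀ n, Subsingleton (F n) ↔ Subsingleton (gr (-n)) := fun n => by
    rw [← subsingleton_dual_iff (k := k) (V := gr (-n)), (e n).toEquiv.subsingleton_congr]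
  simp only [h1, h2]
  constructor
  · rintro ⟨i, hi, hj⟩
    refine ⟨-i, hi, fun j hji => ?_⟩
    have := hj (-j) (fun h => hji (by omega))
    rwa [neg_neg] at this
  · rintro ⟨i, hi, hj⟩
    refine ⟨-i, by rwa [neg_neg], fun j hji => hj (-j) (fun h => hji (by omega))⟩

end UniversalCoefficients

section DualPairing

variable {k : Type v} [Field k] {A : DGAlgebra.{v, w} k} {L : DGRightModule.{v, w, w'} A}

/-- The pairing `ev` identifies `A` as a left module with the graded dual of the right module
`L`, up to a sign in the differential. -/
structure IsDualPairing (ev : A →ₗ[k] Module.Dual k L) : Prop where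
  mul : ∀ a b z, ev (a * b) z = ev b (MulOpposite.op a • z)
  vanishesOff : ∀ n, ∀ a ∈ A.gr n, VanishesOff L.gr (-n) (ev a)
  exists_eq : ∀ n θ, VanishesOff L.gr (-n) θ → ∃ a ∈ A.gr n, ev a = θ
  inj : ∀ n, ∀ a ∈ A.gr n, ev a = 0 → a = 0
  d : ∀ m, ∀ z ∈ L.gr m, ∀ a, ev a (L.d z) = -(m.negOnePow • ev (A.d a) z)

namespace IsDualPairing

variable {ev : A →ₗ[k] Module.Dual k L} (hev : IsDualPairing ev)
include hev

theorem apply_d {a : A} (ha : A.d a = 0) (z : L) : ev a (L.d z) = 0 :=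
  graded_induction (p := fun z => ev a (L.d z) = 0) L.isComplex.internal z
    (fun m z hz => by rw [hev.d m z hz, ha, map_zero, LinearMap.zero_apply, smul_zero, neg_zero])
    (fun x y hx hy => by rw [map_add, map_add, hx, hy, add_zero])

theorem d_apply (a : A) {z : L} (hz : L.d z = 0) : ev (A.d a) z = 0 := by
  obtain ⟨s, hs⟩ := exists_eq_sum_proj L.isComplex.internal z
  rw [hs, map_sum]
  refine Finset.sum_eq_zero fun m _ => ?_
  have h := hev.d m _ (proj_mem L.isComplex.internal m z) a
  rw [d_proj L.isComplex, hz, map_zero, map_zero, eq_comm, neg_eq_zero, Units.smul_def] at h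
  have h' := congrArg (fun x => ((m.negOnePow : ℤˣ) : ℤ) • x) h
  simp only [smul_zero, smul_smul, Int.units_coe_mul_self, one_smul] at h'
  exact h'

theorem eq_zero_of_forall {n : ℤ} {z : L} (hz : z ∈ L.gr (-n)) (h : ∀ a ∈ A.gr n, ev a z = 0) :
    z = 0 := by
  by_contra h0
  obtain ⟨θ, hθ, hθz⟩ := exists_vanishesOff_ne_zero L.isComplex.internal hz h0
  obtain ⟨a, ha, rfl⟩ := hev.exists_eq n θ hθ
  exact hθz (h a ha)

/-- The pairing in homology. -/
noncomputable def homologyPairing : Homology A.d →ₗ[k] Module.Dual k (Homology L.d) :=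
  Submodule.liftQ _
    { toFun := fun a => Homology.functional L.d (ev a) (hev.apply_d (LinearMap.mem_ker.1 a.2))
      map_add' := fun a b => Submodule.linearMap_qext _ (LinearMap.ext fun z => by
        change ev (a + b : A) z = ev a z + ev b z
        rw [map_add]; rfl)
      map_smul' := fun c a => Submodule.linearMap_qext _ (LinearMap.ext fun z => by
        change ev (c • (a : A)) z = c • ev a z
        rw [map_smul]; rfl) }
    (by
      rintro ⟨a, ha⟩ ⟨b, hb⟩
      refine Submodule.linearMap_qext _ (LinearMap.ext fun z => ?_)
      change ev a z = 0
      have hb' : A.d b = a := hb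
      rw [← hb']
      exact hev.d_apply b (LinearMap.mem_ker.1 z.2))

/-- Passing to homology preserves dual pairings. -/
theorem homology : IsDualPairing (A := A.homology) (L := L.homology) hev.homologyPairing where
  mul a b z := by
    obtain ⟨a, rfl⟩ := Submodule.Quotient.mk_surjective _ a
    obtain ⟨b, rfl⟩ := Submodule.Quotient.mk_surjective _ b
    obtain ⟨z, rfl⟩ := Submodule.Quotient.mk_surjective _ z
    refine (congrArg (fun x => hev.homologyPairing x _) (A.homology_mk_mul a b)).trans ?_
    refine Eq.trans ?_ (congrArg (fun x => hev.homologyPairing (Homology.mk A.d b) x)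
      (L.homologyAct_mk z a)).symm
    exact hev.mul a b z
  vanishesOff := by
    rintro n _ ⟨a, ha, rfl⟩ m hm _ ⟨z, hz, rfl⟩
    exact hev.vanishesOff n a ha m hm z hz
  exists_eq := by
    intro n θ hθ
    obtain ⟨θ', hθ', hd, hθθ'⟩ := L.isComplex.exists_functional (-n) θ
    obtain ⟨a, ha, rfl⟩ := hev.exists_eq n θ' hθ'
    have hda : A.d a = 0 := by
      refine hev.inj (n + 1) _ (A.isComplex.d_mem n a ha) (LinearMap.ext fun z => ?_)
      refine graded_induction (p := fun z => ev (A.d a) z = 0) L.isComplex.internal z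
        (fun m z hz => ?_) (fun x y hx hy => by rw [map_add, hx, hy, add_zero])
      have h := hev.d m z hz a
      rw [hd, eq_comm, neg_eq_zero, Units.smul_def] at h
      have h' := congrArg (fun x => ((m.negOnePow : ℤˣ) : ℤ) • x) h
      simp only [smul_zero, smul_smul, Int.units_coe_mul_self, one_smul] at h'
      exact h'
    refine ⟨Homology.mk A.d ⟨a, hda⟩, ⟨⟨a, hda⟩, ha, rfl⟩, ?_⟩
    refine VanishesOff.ext (gr := Homology.gr L.gr L.d) (n := -n) (Homology.isInternal L.isComplex)
      ?_ hθ ?_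
    · rintro m hm _ ⟨z, hz, rfl⟩
      exact hev.vanishesOff n a ha m hm z hz
    · rintro _ ⟨z, hz, rfl⟩
      exact hθθ' z hz
  inj := by
    rintro n _ ⟨a, ha, rfl⟩ h
    obtain ⟨θ, hθ, hθd⟩ := L.isComplex.exists_eq_comp_d (hev.vanishesOff n a ha) fun z _ hz =>
      LinearMap.congr_fun h (Homology.mk L.d ⟨z, hz⟩)
    rw [show -n + 1 = -(n - 1) by ring] at hθ
    obtain ⟨b, hb, rfl⟩ := hev.exists_eq (n - 1) θ hθ
    have hdb := A.isComplex.d_mem _ _ hb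
    rw [sub_add_cancel] at hdb
    have key : (a : A) + n.negOnePow • A.d b = 0 := by
      refine hev.inj n _ (Submodule.add_mem _ ha (by
        rw [Units.smul_def]; exact zsmul_mem hdb _)) ?_
      refine VanishesOff.ext L.isComplex.internal (n := -n) ?_ (fun _ _ _ _ => rfl) ?_
      · intro m hm z hz
        rw [map_add, map_sign_smul, LinearMap.add_apply, hev.vanishesOff n a ha m hm z hz,
          Units.smul_def, LinearMap.smul_apply, hev.vanishesOff n _ hdb m hm z hz, smul_zero,
          add_zero]
      · intro z hz
        rw [map_add, map_sign_smul, LinearMap.add_apply, hθd, hev.d _ z hz, Int.negOnePow_neg,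
          Units.smul_def, Units.smul_def, LinearMap.smul_apply, neg_add_cancel]
        rfl
    refine (Submodule.Quotient.mk_eq_zero _).2 ⟨-(n.negOnePow • b), ?_⟩
    rw [map_neg, map_sign_smul]
    exact (eq_neg_of_add_eq_zero_left key).symm
  d m z hz a := by
    change hev.homologyPairing a 0 = -(m.negOnePow • hev.homologyPairing 0 z)
    rw [map_zero, map_zero]
    exact (neg_eq_zero.2 (smul_zero m.negOnePow)).symm

end IsDualPairing

end DualPairing

/-! ### Ext as the dual of Tor -/

section Ext

variable {k : Type v} [Field k] {A : DGAlgebra.{v, w} k}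

theorem homD_apply {P : DGModule.{v, w, p} A} {N : DGModule.{v, w, w'} A} (n : ℤ) (f : P →ₗ[k] N)
    (x : P) : homD P N n f x = N.d (f x) - n.negOnePow • f (P.d x) := by
  simp only [homD, LinearMap.sub_apply, Units.smul_def, LinearMap.smul_apply]
  rfl

theorem homD_mem {P : DGModule.{v, w, p} A} {N : DGModule.{v, w, w'} A} {n : ℤ} {f : P →ₗ[k] N}
    (hf : f ∈ homDeg P N n) : homD P N n f ∈ homDeg P N (n + 1) := by
  constructor
  · intro m x hx
    rw [homD_apply, ← add_assoc]
    refine Submodule.sub_mem _ (N.isComplex.d_mem _ _ (hf.1 m x hx)) ?_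
    rw [Units.smul_def]
    have := hf.1 _ _ (P.isComplex.d_mem m x hx)
    rw [show m + 1 + n = m + n + 1 by ring] at this
    exact zsmul_mem this _
  · intro m a ha x
    rw [homD_apply, homD_apply, hf.2 m a ha, map_sign_smul, N.leibniz m a _ ha, P.leibniz m a _ ha,
      map_add, map_sign_smul, hf.2 m a ha, hf.2 (m + 1) _ (A.isComplex.d_mem m a ha),
      smul_sub, smul_add, smul_add, smul_sub, smul_comm a n.negOnePow (f (P.d x)),
      smul_smul, smul_smul, smul_smul, smul_smul]
    simp only [← Int.negOnePow_add]
    rw [show n + n * (m + 1) = n * m + (n + n) by ring, Int.negOnePow_add (n * m) (n + n),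
      Int.negOnePow_even (n + n) ⟨n, rfl⟩, mul_one, show (n + 1) * m = n * m + m by ring,
      smul_smul, ← Int.negOnePow_add, show n + m + n * m = n * m + m + n by ring]
    abel

/-- The map multiplying elements of degree `m` by `(-1)^(n m)`. -/
noncomputable def parityPow (A : DGAlgebra.{v, w} k) (n : ℤ) : A →ₗ[k] A :=
  open Classical in if Even n then LinearMap.id else parity A.isComplex.internal

theorem parityPow_of_mem (n : ℤ) {m : ℤ} {a : A} (ha : a ∈ A.gr m) :
    parityPow A n a = (n * m).negOnePow • a := by
  unfold parityPow
  split
  · rename_i h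
    rw [Int.negOnePow_even _ (h.mul_right m), one_smul, LinearMap.id_apply]
  · rename_i h
    rw [parity_of_mem _ ha]
    congr 1
    rw [Int.negOnePow_eq_iff]
    rw [Int.not_even_iff_odd] at h
    obtain ⟨c, rfl⟩ := h
    exact ⟨-(c * m), by ring⟩

theorem parityPow_mul (n : ℤ) {m : ℤ} {a : A} (ha : a ∈ A.gr m) (b : A) :
    parityPow A n (a * b) = (n * m).negOnePow • (a * parityPow A n b) := by
  refine graded_induction (p := fun b => parityPow A n (a * b) =
    (n * m).negOnePow • (a * parityPow A n b)) A.isComplex.internal b (fun j b hb => ?_)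
    (fun x y hx hy => by rw [mul_add, map_add, hx, hy, map_add, mul_add, smul_add])
  rw [parityPow_of_mem n (A.mul_mem _ _ _ _ ha hb), parityPow_of_mem n hb, mul_add,
    Int.negOnePow_add, mul_smul, Units.smul_def (n * j).negOnePow b, mul_smul_comm,
    ← Units.smul_def]

variable {L : DGRightModule.{v, w, w'} A} {ev : A →ₗ[k] Module.Dual k L}
  {P : DGModule.{v, w, p} A} {ι : Type p} (e : Module.Basis ι A P) (T : Twisting A ι)

variable (ev) in
/-- The functional on `L ⊗_A P` given by a homomorphism `P → A` of degree `n`: its value on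
`z ⊗ e i` is the value of `f (e i)` on `z`, up to the sign that makes it compatible with the
action of `A`. -/
noncomputable def homFunctional (n : ℤ) : (P →ₗ[k] A) →ₗ[k] Module.Dual k (ι →₀ L) :=
  (Finsupp.lsum (R := k) (M := L) (N := k) k).toLinearMap ∘ₗ LinearMap.pi fun i =>
    (((n * T.deg i).negOnePow : ℤˣ) : ℤ) • ev ∘ₗ LinearMap.applyₗ (e i)

theorem homFunctional_single (n : ℤ) (f : P →ₗ[k] A) (i : ι) (z : L) :
    homFunctional ev e T n f (Finsupp.single i z) =
      (n * T.deg i).negOnePow • ev (f (e i)) z := by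
  simp only [homFunctional, LinearMap.comp_apply, LinearEquiv.coe_coe, Finsupp.lsum_single]
  rfl

variable (he : ∀ i, e i ∈ P.gr (T.deg i)) (hev : IsDualPairing ev)

include he hev

/-- The value of the functional on `z ⊗ y`. -/
theorem homFunctional_coordAct {n : ℤ} {f : P →ₗ[k] A} (hf : f ∈ homDeg P A.self n) {j : ℤ} {y : P}
    (hy : y ∈ P.gr j) (z : L) : homFunctional ev e T n f (L.coordAct z (e.repr y)) =
      (n * j).negOnePow • ev (f y) z := by
  have h1 : L.coordAct z (e.repr y) =
      ∑ i ∈ (e.repr y).support, Finsupp.single i (MulOpposite.op (e.repr y i) • z) := by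
    conv_lhs => rw [← Finsupp.sum_single (e.repr y), Finsupp.sum, map_sum]
    simp only [L.coordAct_single]
  have h2 : f y = ∑ i ∈ (e.repr y).support, f (e.repr y i • e i) := by
    conv_lhs => rw [← e.linearCombination_repr y, Finsupp.linearCombination_apply, Finsupp.sum,
      map_sum]
  rw [h1, h2, map_sum, map_sum, LinearMap.sum_apply, Finset.smul_sum]
  refine Finset.sum_congr rfl fun i _ => ?_
  have hi := repr_mem e he hy i
  rw [homFunctional_single, hf.2 _ _ hi, map_sign_smul,
    Units.smul_def (n * (j - T.deg i)).negOnePow, LinearMap.smul_apply,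
    ← Units.smul_def, smul_smul, ← Int.negOnePow_add, ← hev.mul]
  congr 1
  rw [Int.negOnePow_eq_iff]
  exact ⟨n * T.deg i - n * j, by ring⟩

theorem vanishesOff_homFunctional {n : ℤ} {f : P →ₗ[k] A} (hf : f ∈ homDeg P A.self n) :
    VanishesOff (T.gr L) (-n) (homFunctional ev e T n f) := by
  intro m hm t ht
  rw [← Finsupp.sum_single t, Finsupp.sum, map_sum]
  refine Finset.sum_eq_zero fun i _ => ?_
  rw [homFunctional_single, hev.vanishesOff _ _ (hf.1 _ _ (he i)) _ _ _ (ht i), smul_zero]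
  omega

/-- The isomorphism of `Hom_A(P, A)` with the graded dual of `L ⊗_A P` is compatible with the
differentials up to sign. -/
theorem homFunctional_homD (hT : ∀ i, T.D i = e.repr (P.d (e i))) {n : ℤ} {f : P →ₗ[k] A}
    (hf : f ∈ homDeg P A.self n) (t : ι →₀ L) :
    homFunctional ev e T (n + 1) (homD P A.self n f) t =
      n.negOnePow • homFunctional ev e T n f (T.d L t) := by
  have hL := T.isComplex L
  have h : homFunctional ev e T (n + 1) (homD P A.self n f) =
      ((n.negOnePow : ℤˣ) : ℤ) • (homFunctional ev e T n f ∘ₗ T.d L) := by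
    refine VanishesOff.ext hL.internal (n := -(n + 1))
      (vanishesOff_homFunctional e T he hev (homD_mem hf)) ?_ ?_
    · intro m hm t ht
      rw [LinearMap.smul_apply, LinearMap.comp_apply,
        vanishesOff_homFunctional e T he hev hf _ _ _ (hL.d_mem m t ht), smul_zero]
      omega
    · intro t ht
      rw [← Finsupp.sum_single t, Finsupp.sum, map_sum, map_sum]
      refine Finset.sum_congr rfl fun i _ => ?_
      have hti := ht i
      rw [LinearMap.smul_apply, LinearMap.comp_apply, ← Units.smul_def, Twisting.d, twD_single,
        map_add, hT, parity_of_mem _ hti, map_sign_smul,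
        Units.smul_def (-(n + 1) - T.deg i).negOnePow,
        LinearMap.smul_apply, map_zsmul,
        homFunctional_coordAct e T he hev hf (P.isComplex.d_mem _ _ (he i)), homFunctional_single,
        homFunctional_single, homD_apply, hev.d _ _ hti, map_sub, LinearMap.sub_apply,
        map_sign_smul, Units.smul_def n.negOnePow (ev _), LinearMap.smul_apply]
      simp only [← Units.smul_def]
      rw [smul_add, smul_neg, smul_neg, smul_sub, smul_smul, smul_smul, smul_smul, smul_smul,
        smul_smul]
      simp only [← Int.negOnePow_add]
      have e1 : (n + n * T.deg i + (-(n + 1) - T.deg i)).negOnePow =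
          -((n + 1) * T.deg i).negOnePow := by
        rw [← Int.negOnePow_succ, Int.negOnePow_eq_iff]
        exact ⟨-1 - T.deg i, by ring⟩
      have e2 : (n + (-(n + 1) - T.deg i) + n * (T.deg i + 1)).negOnePow =
          -((n + 1) * T.deg i + n).negOnePow := by
        rw [← Int.negOnePow_succ, Int.negOnePow_eq_iff]
        exact ⟨-1 - T.deg i, by ring⟩
      rw [e1, e2, Units.neg_smul, Units.neg_smul, neg_neg, sub_eq_add_neg]
  rw [h, LinearMap.smul_apply, LinearMap.comp_apply, Units.smul_def]

theorem homFunctional_inj {n : ℤ} {f : P →ₗ[k] A} (hf : f ∈ homDeg P A.self n)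
    (h : homFunctional ev e T n f = 0) : f = 0 := by
  have h0 : ∀ i, f (e i) = 0 := fun i => by
    refine hev.inj _ _ (hf.1 _ _ (he i)) (LinearMap.ext fun z => ?_)
    have h1 := homFunctional_single (ev := ev) e T n f i z
    rw [h, LinearMap.zero_apply, eq_comm, Units.smul_def] at h1
    have h2 := congrArg (fun x => (((n * T.deg i).negOnePow : ℤˣ) : ℤ) • x) h1
    simp only [smul_zero, smul_smul, Int.units_coe_mul_self, one_smul] at h2
    exact h2
  refine LinearMap.ext fun y => basis_induction e (p := fun y => f y = 0) y (map_zero f)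
    (fun a i => ?_) (fun x y hx hy => by rw [map_add, hx, hy, add_zero])
  refine graded_induction (p := fun a => f (a • e i) = 0) A.isComplex.internal a
    (fun m a ha => ?_) (fun a b ha hb => by rw [add_smul, map_add, ha, hb, add_zero])
  rw [hf.2 m a ha, h0, smul_zero, smul_zero]

theorem exists_homFunctional_eq {n : ℤ} {θ : Module.Dual k (ι →₀ L)}
    (hθ : VanishesOff (T.gr L) (-n) θ) :
    ∃ f ∈ homDeg P A.self n, homFunctional ev e T n f = θ := by
  have hg : ∀ i, ∃ g ∈ A.gr (T.deg i + n),
      ev g = (((n * T.deg i).negOnePow : ℤˣ) : ℤ) • θ ∘ₗ Finsupp.lsingle i := fun i => by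
    refine hev.exists_eq _ _ fun m hm z hz => ?_
    rw [LinearMap.smul_apply, LinearMap.comp_apply, Finsupp.lsingle_apply,
      hθ (m + T.deg i) (by omega) _ (T.single_mem (by simpa using hz)), smul_zero]
  choose g hg hg' using hg
  let f : P →ₗ[k] A := Finsupp.lsum (R := k) (M := A) (N := A) k
    (fun i => LinearMap.mulRight k (g i) ∘ₗ parityPow A n) ∘ₗ
      (e.repr.toLinearMap.restrictScalars k)
  have hf : ∀ y, f y = (e.repr y).sum fun i a => parityPow A n a * g i := fun y => rfl
  have hfe : ∀ i, f (e i) = g i := fun i => by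
    rw [hf, e.repr_self, Finsupp.sum_single_index (by rw [map_zero, zero_mul]),
      parityPow_of_mem n A.one_mem, mul_zero, Int.negOnePow_zero, one_smul, one_mul]
  have hfae : ∀ a i, f (a • e i) = parityPow A n a * g i := fun a i => by
    rw [hf, map_smul, e.repr_self, Finsupp.smul_single, smul_eq_mul, mul_one,
      Finsupp.sum_single_index (by rw [map_zero, zero_mul])]
  refine ⟨f, ⟨fun m y hy => ?_, fun m a ha y => ?_⟩, ?_⟩
  · rw [hf]
    refine Submodule.sum_mem _ fun i _ => ?_
    have hi := repr_mem e he hy i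
    have := A.mul_mem _ _ _ _ hi (hg i)
    rw [show m - T.deg i + (T.deg i + n) = m + n by ring] at this
    simp only
    rw [parityPow_of_mem n hi, Units.smul_def, smul_mul_assoc]
    exact zsmul_mem this _
  · refine basis_induction e (p := fun y => f (a • y) = (n * m).negOnePow • (a • f y)) y
      (by rw [smul_zero, map_zero, smul_zero, smul_zero]) (fun b i => ?_)
      (fun x y hx hy => by rw [smul_add, map_add, hx, hy, map_add, smul_add, smul_add])
    rw [smul_smul, hfae, hfae, parityPow_mul n ha, Units.smul_def, smul_mul_assoc, mul_assoc,
      Units.smul_def]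
    rfl
  · refine Finsupp.lhom_ext fun i z => ?_
    rw [homFunctional_single, hfe, hg', LinearMap.smul_apply, Units.smul_def, smul_smul,
      Int.units_coe_mul_self, one_smul]
    rfl

/-- `Ext^n(k, A)` is the dual of the component of degree `-n` of `Tor(k, L)`. -/
theorem exists_homHomology_equiv (hT : ∀ i, T.D i = e.repr (P.d (e i))) (n : ℤ) :
    Nonempty ((↥(homCocycles P A.self n) ⧸
      (homCoboundaries P A.self n).comap (homCocycles P A.self n).subtype) ≃ₗ[k]
        Module.Dual k (Homology.gr (T.gr L) (T.d L) (-n))) := by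
  have hL := T.isComplex L
  have hcoc : ∀ f : homCocycles P A.self n, ∀ t, homFunctional ev e T n f (T.d L t) = 0 := by
    intro f t
    have h := homFunctional_homD e T he hev hT f.2.1 t
    rw [show homD P A.self n f = 0 from f.2.2, map_zero, LinearMap.zero_apply, eq_comm,
      Units.smul_def] at h
    have h2 := congrArg (fun x => ((n.negOnePow : ℤˣ) : ℤ) • x) h
    simp only [smul_zero, smul_smul, Int.units_coe_mul_self, one_smul] at h2
    exact h2
  let Ψ : homCocycles P A.self n →ₗ[k] Module.Dual k (Homology.gr (T.gr L) (T.d L) (-n)) :=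
    { toFun := fun f => Homology.functional (T.d L) (homFunctional ev e T n f) (hcoc f) ∘ₗ
        Submodule.subtype _
      map_add' := fun f g => LinearMap.ext fun ⟨x, hx⟩ => by
        obtain ⟨z, -, rfl⟩ := hx
        change homFunctional ev e T n (f + g : P →ₗ[k] A) z =
          homFunctional ev e T n f z + homFunctional ev e T n g z
        rw [map_add]; rfl
      map_smul' := fun c f => LinearMap.ext fun ⟨x, hx⟩ => by
        obtain ⟨z, -, rfl⟩ := hx
        change homFunctional ev e T n (c • f : P →ₗ[k] A) z = c • homFunctional ev e T n f z
        rw [map_smul]; rfl }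
  have hΨ : ∀ f (z : LinearMap.ker (T.d L)) (hz : (z : ι →₀ L) ∈ T.gr L (-n)),
      Ψ f ⟨Homology.mk _ z, z, hz, rfl⟩ = homFunctional ev e T n f z := fun f z hz => rfl
  have hsurj : Function.Surjective Ψ := by
    intro φ
    obtain ⟨φ', hφ'⟩ := LinearMap.exists_extend φ
    obtain ⟨θ, hθ, hθd, hθφ⟩ := hL.exists_functional (-n) φ'
    obtain ⟨f, hf, rfl⟩ := exists_homFunctional_eq e T he hev hθ
    have hfd : homD P A.self n f = 0 := by
      refine homFunctional_inj e T he hev (homD_mem hf) (LinearMap.ext fun t => ?_)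
      rw [homFunctional_homD e T he hev hT hf, hθd, smul_zero, LinearMap.zero_apply]
    refine ⟨⟨f, hf, hfd⟩, LinearMap.ext fun ⟨x, hx⟩ => ?_⟩
    obtain ⟨z, hz, rfl⟩ := hx
    refine (hΨ _ z hz).trans ((hθφ z hz).trans ?_)
    exact LinearMap.congr_fun hφ' ⟨Homology.mk _ z, z, hz, rfl⟩
  have hker : (homCoboundaries P A.self n).comap (homCocycles P A.self n).subtype =
      LinearMap.ker Ψ := by
    ext f
    constructor
    · rintro ⟨g, hg, hgf⟩
      refine LinearMap.mem_ker.2 (LinearMap.ext fun ⟨x, hx⟩ => ?_)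
      obtain ⟨z, hz, rfl⟩ := hx
      refine (hΨ f z hz).trans ?_
      have h := homFunctional_homD e T he hev hT hg z
      rw [sub_add_cancel, LinearMap.mem_ker.1 z.2, map_zero, smul_zero, hgf] at h
      exact h
    · intro hf
      obtain ⟨θ, hθ, hθd⟩ := hL.exists_eq_comp_d (vanishesOff_homFunctional e T he hev f.2.1)
        fun z hz hzd => (hΨ f ⟨z, hzd⟩ hz).symm.trans
          (LinearMap.congr_fun (LinearMap.mem_ker.1 hf) _)
      rw [show -n + 1 = -(n - 1) by ring] at hθ
      obtain ⟨g, hg, rfl⟩ := exists_homFunctional_eq e T he hev hθ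
      have hgD := homD_mem hg
      rw [sub_add_cancel] at hgD
      refine ⟨((((n - 1).negOnePow : ℤˣ) : ℤ) • g), zsmul_mem hg _, ?_⟩
      rw [map_zsmul]
      refine sub_eq_zero.1 (homFunctional_inj e T he hev
        (Submodule.sub_mem _ (zsmul_mem hgD _) f.2.1) (LinearMap.ext fun t => ?_))
      have h := homFunctional_homD e T he hev hT hg t
      rw [sub_add_cancel] at h
      rw [map_sub, map_zsmul, LinearMap.sub_apply, LinearMap.smul_apply, h, Units.smul_def,
        smul_smul, Int.units_coe_mul_self, one_smul, ← hθd]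
      exact sub_self _
  exact ⟨(Submodule.quotEquivOfEq _ _ hker).trans (LinearMap.quotKerEquivOfSurjective Ψ hsurj)⟩

omit he

theorem rank_homHomology_eq_one_iff (hP : P.IsSemifree) :
    Module.rank k (HomHomology P A.self) = 1 ↔ Module.rank k (Homology (tensorD L P)) = 1 := by
  obtain ⟨ι, e, T, hT, he⟩ := hP.exists_twisting
  have hT' : T.D = fun i => e.repr (P.d (e i)) := funext hT
  have h1 : Module.finrank k (Homology (tensorD L P)) = Module.finrank k (Homology (T.d L)) :=
    (homologyEquiv (tensorEquiv L e) fun t => by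
      rw [Twisting.d, hT']; exact tensorEquiv_d L e t).finrank_eq
  rw [Module.rank_eq_one_iff_finrank_eq_one (M := Homology (tensorD L P)), h1,
    ← Module.rank_eq_one_iff_finrank_eq_one]
  exact rank_directSum_dual_eq_one_iff
    (F := fun n => ↥(homCocycles P A.self n) ⧸
      (homCoboundaries P A.self n).comap (homCocycles P A.self n).subtype)
    (Homology.isInternal (T.isComplex L)) fun n =>
      (exists_homHomology_equiv e T he hev hT n).some

/-- If `L` is a predual of `A`, then `dim Ext_A(k, A) = 1` if and only if `dim Tor^A(k, L) = 1`. -/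
theorem isGorenstein_iff (ε : A.Augmentation) :
    ε.IsGorenstein ↔ DimTorEq ε.fieldModule L 1 :=
  and_congr_right fun _ => forall_congr' fun R => rank_homHomology_eq_one_iff hev R.isSemifree

end Ext

/-! ### Quasi-free modules and homology -/

section

variable {k : Type v} [Field k] {A : DGAlgebra.{v, w} k} {L : DGRightModule.{v, w, w'} A}

theorem DGRightModule.act_mem_ker {ω : L} (hd : L.d ω = 0) {a : A} (ha : A.d a = 0) :
    L.d (L.act ω a) = 0 :=
  L.op_smul_mem_ker ⟨ω, hd⟩ ⟨a, ha⟩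

theorem DGRightModule.isQuasiFree_homology_iff : L.homology.IsQuasiFree ↔ L.IsQuasiFree := by
  have key : ∀ (ω : L) (hd : L.d ω = 0), IsQuasiIso A.homology.d L.homology.d
      (L.homology.act (Homology.mk L.d ⟨ω, hd⟩)) ↔ IsQuasiIso A.d L.d (L.act ω) := by
    intro ω hd
    have hact : ∀ (a : A) (ha : A.d a = 0), L.homology.act (Homology.mk L.d ⟨ω, hd⟩)
        (Homology.mk A.d ⟨a, ha⟩) =
          Homology.mk L.d ⟨L.act ω a, L.act_mem_ker hd ha⟩ :=
      fun a ha => L.homologyAct_mk ⟨ω, hd⟩ ⟨a, ha⟩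
    constructor
    · intro h
      constructor
      · intro a ha hωa
        obtain ⟨b, hb⟩ := h.inj (Homology.mk A.d ⟨a, ha⟩) rfl ⟨0, by
          rw [hact, map_zero]; exact (Homology.mk_eq_zero_iff.2 hωa).symm⟩
        exact Homology.mk_eq_zero_iff.1 (show Homology.mk A.d ⟨a, ha⟩ = 0 from hb.symm)
      · intro z hz
        obtain ⟨a, -, y, hy⟩ := h.surj (Homology.mk L.d ⟨z, hz⟩) rfl
        obtain ⟨⟨a, ha⟩, rfl⟩ := Submodule.Quotient.mk_surjective _ a
        refine ⟨a, ha, ?_⟩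
        have h2 : (0 : Homology L.d) = Homology.mk L.d ⟨z, hz⟩ -
            Homology.mk L.d ⟨L.act ω a, L.act_mem_ker hd ha⟩ :=
          hy.trans (congrArg (Homology.mk L.d ⟨z, hz⟩ - ·) (hact a ha))
        exact Homology.mk_eq_mk_iff.1 (sub_eq_zero.1 h2.symm)
    · intro h
      constructor
      · intro a _ ha
        obtain ⟨y, hy⟩ := ha
        obtain ⟨⟨a, ha⟩, rfl⟩ := Submodule.Quotient.mk_surjective _ a
        refine ⟨0, ?_⟩
        have h2 : (0 : Homology L.d) = Homology.mk L.d ⟨L.act ω a, L.act_mem_ker hd ha⟩ :=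
          hy.trans (hact a ha)
        exact (Homology.mk_eq_zero_iff.2
          (h.inj a ha (Homology.mk_eq_zero_iff.1 h2.symm))).symm
      · intro z _
        obtain ⟨⟨z, hz⟩, rfl⟩ := Submodule.Quotient.mk_surjective _ z
        obtain ⟨a, ha, hza⟩ := h.surj z hz
        refine ⟨Homology.mk A.d ⟨a, ha⟩, rfl, 0, ?_⟩
        have h2 : Homology.mk L.d ⟨z, hz⟩ =
            Homology.mk L.d ⟨L.act ω a, L.act_mem_ker hd ha⟩ :=
          Homology.mk_eq_mk_iff.2 hza
        exact (sub_eq_zero.2 (h2.trans (hact a ha).symm)).symm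
  constructor
  · rintro ⟨n, _, ⟨⟨ω, hd⟩, hω, rfl⟩, -, hq⟩
    exact ⟨n, ω, hω, hd, (key ω hd).1 hq⟩
  · rintro ⟨n, ω, hω, hd, hq⟩
    exact ⟨n, Homology.mk L.d ⟨ω, hd⟩, ⟨⟨ω, hd⟩, hω, rfl⟩, rfl, (key ω hd).2 hq⟩

theorem DGAlgebra.IsConnected.homology (hA : A.IsConnected) : A.homology.IsConnected where
  gr_neg n hn := by
    refine (Submodule.eq_bot_iff _).2 ?_
    rintro _ ⟨⟨x, hx⟩, hxn, rfl⟩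
    have h0 : x ∈ A.gr n := hxn
    rw [hA.gr_neg n hn, Submodule.mem_bot] at h0
    subst h0
    exact map_zero _
  gr_zero := by
    rintro _ ⟨⟨x, hx⟩, hx0, rfl⟩ -
    obtain ⟨c, rfl⟩ := hA.gr_zero x hx0 hx
    exact ⟨c, rfl⟩

theorem isBoundedBelow_of_homology {gr : ℤ → Submodule k L} {d : L →ₗ[k] L} (n₀ : ℤ)
    (h : ∀ n < n₀, Homology.gr gr d n = ⊥) : IsBoundedBelow gr d := by
  refine ⟨n₀, fun n hn x hx hdx => ?_⟩
  have h1 : Homology.mk d ⟨x, hdx⟩ ∈ Homology.gr gr d n := ⟨⟨x, hdx⟩, hx, rfl⟩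
  rw [h n hn, Submodule.mem_bot] at h1
  exact Homology.mk_eq_zero_iff.1 h1

end

/-! ### Poincaré duality -/

/-- Two vector spaces each isomorphic to the dual of the other are finite-dimensional, by the
Erdős–Kaplansky theorem. -/
theorem finite_of_equiv_dual {k : Type v} [Field k] {V W : Type w} [AddCommGroup V] [Module k V]
    [AddCommGroup W] [Module k W] (e : V ≃ₗ[k] Module.Dual k W) (e' : W ≃ₗ[k] Module.Dual k V) :
    Module.Finite k V := by
  have key : ∀ {V W : Type w} [AddCommGroup V] [Module k V] [AddCommGroup W] [Module k W],
      (W ≃ₗ[k] Module.Dual k V) → ¬Module.Finite k V →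
        Cardinal.lift.{v} (Module.rank k V) < Cardinal.lift.{v} (Module.rank k W) := by
    intro V W _ _ _ _ e h
    have h1 := lift_rank_lt_rank_dual (K := k) (V := V)
      (not_lt.1 fun h' => h (Module.rank_lt_aleph0_iff.1 h'))
    have h2 := ((ULift.moduleEquiv : ULift.{v} W ≃ₗ[k] W).trans e).rank_eq
    rw [rank_ulift] at h2
    rwa [h2]
  by_contra h
  refine lt_asymm (key e' h) (key e fun hW => h ?_)
  exact Module.Finite.equiv e.symm

namespace IsDualPairing

variable {k : Type v} [Field k] {A : DGAlgebra.{v, w} k} {L : DGRightModule.{v, w, w'} A}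
  {ev : A →ₗ[k] Module.Dual k L} (hev : IsDualPairing ev)

include hev

/-- The component of degree `n` of `A` is the dual of the component of degree `-n` of `L`. -/
theorem exists_gr_equiv (n : ℤ) : ∃ D : A.gr n ≃ₗ[k] Module.Dual k (L.gr (-n)),
    ∀ a z, D a z = ev (a : A) z := by
  let D : A.gr n →ₗ[k] Module.Dual k (L.gr (-n)) :=
    (L.gr (-n)).subtype.dualMap ∘ₗ ev ∘ₗ (A.gr n).subtype
  refine ⟨LinearEquiv.ofBijective D ⟨?_, fun θ => ?_⟩, fun a z => rfl⟩
  · refine (injective_iff_map_eq_zero D).2 fun a ha => Subtype.ext (hev.inj n a a.2 ?_)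
    exact VanishesOff.ext L.isComplex.internal (hev.vanishesOff n a a.2) (fun _ _ _ _ => rfl)
      fun z hz => LinearMap.congr_fun ha ⟨z, hz⟩
  · obtain ⟨θ', hθ'⟩ := LinearMap.exists_extend θ
    obtain ⟨a, ha, haθ⟩ := hev.exists_eq n _
      (vanishesOff_comp_proj L.isComplex.internal (-n) θ')
    refine ⟨⟨a, ha⟩, LinearMap.ext fun z => ?_⟩
    change ev a z = θ z
    rw [haθ, LinearMap.comp_apply, proj_of_mem _ z.2]
    exact LinearMap.congr_fun hθ' z

/-- As `A` has no components of negative degree, its dual has none of positive degree. -/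
theorem gr_eq_bot (hA : A.IsConnected) {n : ℤ} (hn : 0 < n) : L.gr n = ⊥ := by
  refine (Submodule.eq_bot_iff _).2 fun z hz => hev.eq_zero_of_forall (n := -n)
    (by rwa [neg_neg]) fun a ha => ?_
  rw [hA.gr_neg _ (by omega), Submodule.mem_bot] at ha
  rw [ha, map_zero, LinearMap.zero_apply]

/-- On `ω u`, a functional sees only the component of `u` of complementary degree. -/
theorem ev_act_eq_ev_proj_mul {i n : ℤ} {ω : L} (hω : ω ∈ L.gr (-n)) (u : A) {γ : A}
    (hγ : γ ∈ A.gr (n - i)) :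
    ev γ (L.act ω u) = ev (proj A.isComplex.internal i u * γ) ω := by
  refine graded_induction (p := fun u => ev γ (L.act ω u) =
    ev (proj A.isComplex.internal i u * γ) ω) A.isComplex.internal u (fun m u hu => ?_)
    (fun x y hx hy => by rw [map_add, map_add, hx, hy, map_add, add_mul, map_add,
      LinearMap.add_apply])
  refine (hev.mul u γ ω).symm.trans ?_
  by_cases hm : m = i
  · rw [← hm, proj_of_mem _ hu]
  · rw [proj_of_mem_ne _ hm hu, zero_mul, map_zero, LinearMap.zero_apply]
    exact hev.vanishesOff _ _ (A.mul_mem _ _ _ _ hu hγ) _ (by omega) _ hω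

theorem isQuasiFree_of_isPoincareDualityAlgebra (hd : A.d = 0) (hLd : L.d = 0)
    (h : IsPoincareDualityAlgebra A.gr) : L.IsQuasiFree := by
  obtain ⟨n, hn, hoff, α, hα, hgr, hΦ⟩ := h
  have hαn : α ∈ A.gr n := hgr ▸ Submodule.mem_span_singleton_self α
  obtain ⟨D, hD⟩ := hev.exists_gr_equiv n
  obtain ⟨ω, hω⟩ : ∃ ω : L.gr (-n), ev α ω = 1 := by
    obtain ⟨z, hz⟩ : ∃ z, D ⟨α, hαn⟩ z ≠ 0 := by
      by_contra! h0
      have := D.map_eq_zero_iff.1 (LinearMap.ext h0)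
      exact hα (congrArg Subtype.val this)
    refine ⟨(D ⟨α, hαn⟩ z)⁻¹ • z, ?_⟩
    rw [← hD ⟨α, hαn⟩, map_smul, smul_eq_mul, inv_mul_cancel₀ hz]
  refine ⟨-n, ω, ω.2, by rw [hLd]; rfl, ⟨fun u _ hu => ?_, fun z _ => ?_⟩⟩
  · -- all components of an element annihilating `ω` vanish
    rw [hLd, LinearMap.range_zero, Submodule.mem_bot] at hu
    obtain ⟨s, hs⟩ := exists_eq_sum_proj A.isComplex.internal u
    rw [hs]
    refine Submodule.sum_mem _ fun i _ => ?_
    have hi := proj_mem A.isComplex.internal i u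
    suffices h0 : proj A.isComplex.internal i u = 0 by rw [h0]; exact Submodule.zero_mem _
    by_cases hin : i < 0 ∨ n < i
    · rwa [hoff i hin, Submodule.mem_bot] at hi
    · obtain ⟨Φ, hΦ⟩ := hΦ i (n - i) (by omega) (by omega) (by ring)
      have : (⟨_, hi⟩ : A.gr i) = 0 := Φ.map_eq_zero_iff.1 (LinearMap.ext fun γ => by
        have h1 := hev.ev_act_eq_ev_proj_mul ω.2 u γ.2
        rw [hu, map_zero, hΦ ⟨_, hi⟩ γ, map_smul, LinearMap.smul_apply, hω, smul_eq_mul,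
          mul_one] at h1
        exact h1.symm)
      exact congrArg Subtype.val this
  · refine graded_induction (p := fun z => ∃ u, A.d u = 0 ∧ z - L.act ω u ∈ LinearMap.range L.d)
      L.isComplex.internal z (fun m z hz => ?_) ?_
    · by_cases hm : -m < 0 ∨ n < -m
      · -- here `A.gr (-m)` vanishes, hence so does the dual space `L.gr m`
        have : z = 0 := hev.eq_zero_of_forall (n := -m) (by rwa [neg_neg]) fun a ha => by
          rw [hoff _ hm, Submodule.mem_bot] at ha
          rw [ha, map_zero, LinearMap.zero_apply]
        refine ⟨0, map_zero _, ?_⟩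
        rw [this, map_zero, sub_zero]
        exact Submodule.zero_mem _
      · -- the element `β` pairing with each `γ` as `z` does satisfies `ω β = z`
        obtain ⟨Φ, hΦ⟩ := hΦ (n + m) (-m) (by omega) (by omega) (by ring)
        obtain ⟨β, hβ⟩ := Φ.surjective ((ev.flip z) ∘ₗ (A.gr (-m)).subtype)
        refine ⟨β, by rw [hd]; rfl, ?_⟩
        have hmem := L.smul_mem _ _ _ _ ω.2 β.2
        rw [show -n + (n + m) = m by ring] at hmem
        have : z - L.act ω (β : A) = 0 := hev.eq_zero_of_forall (n := -m)
          (by rw [neg_neg]; exact Submodule.sub_mem _ hz hmem) fun γ hγ => by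
            have h1 := LinearMap.congr_fun hβ ⟨γ, hγ⟩
            have h2 : ev γ (L.act ω (β : A)) = Φ β ⟨γ, hγ⟩ := by
              refine (hev.mul β γ ω).symm.trans ?_
              rw [hΦ β ⟨γ, hγ⟩, map_smul, LinearMap.smul_apply, hω, smul_eq_mul, mul_one]
            rw [map_sub, h2, h1]
            exact sub_self _
        rw [this]
        exact Submodule.zero_mem _
    · rintro x y ⟨a, ha, hxa⟩ ⟨b, hb, hyb⟩
      refine ⟨a + b, by rw [map_add, ha, hb, add_zero], ?_⟩
      rw [map_add, add_sub_add_comm]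
      exact Submodule.add_mem _ hxa hyb

theorem isPoincareDualityAlgebra_of_isQuasiFree [Nontrivial A] (hA : A.IsConnected)
    (hd : A.d = 0) (hLd : L.d = 0) (h : L.IsQuasiFree) : IsPoincareDualityAlgebra A.gr := by
  obtain ⟨m, ω, hω, -, hq⟩ := h
  -- the degree of `ω` is `-n`, where `n` will be the top degree of `A`
  obtain ⟨n, rfl⟩ : ∃ n, m = -n := ⟨-m, (neg_neg m).symm⟩
  have hinj : ∀ u, L.act ω u = 0 → u = 0 := fun u hu => by
    have := hq.inj u (by rw [hd]; rfl) (by rw [hu]; exact Submodule.zero_mem _)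
    rwa [hd, LinearMap.range_zero, Submodule.mem_bot] at this
  have hsurj : ∀ z, ∃ u, L.act ω u = z := fun z => by
    obtain ⟨u, -, hu⟩ := hq.surj z (by rw [hLd]; rfl)
    rw [hLd, LinearMap.range_zero, Submodule.mem_bot] at hu
    exact ⟨u, (sub_eq_zero.1 hu).symm⟩
  have hmem : ∀ i, ∀ a ∈ A.gr i, L.act ω a ∈ L.gr (-n + i) := fun i a ha =>
    L.smul_mem _ _ _ _ hω ha
  have hω0 : ω ≠ 0 := fun h0 => one_ne_zero (hinj 1 (by rw [h0, map_zero]; rfl))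
  -- multiplication by `ω` in each degree
  have hE : ∀ i j, i + j = n → ∃ E : A.gr i ≃ₗ[k] L.gr (-j), ∀ a, (E a : L) = L.act ω a := by
    intro i j hij
    have e1 : -n + i = -j := by omega
    let E : A.gr i →ₗ[k] L.gr (-j) := (L.act ω).restrict fun a ha => e1 ▸ hmem i a ha
    refine ⟨LinearEquiv.ofBijective E ⟨?_, fun z => ?_⟩, fun a => rfl⟩
    · exact (injective_iff_map_eq_zero E).2 fun a ha =>
        Subtype.ext (hinj a (congrArg Subtype.val ha))
    · obtain ⟨u, hu⟩ := hsurj z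
      refine ⟨⟨_, proj_mem A.isComplex.internal i u⟩, Subtype.ext ?_⟩
      have h1 : ∀ u, L.act ω (proj A.isComplex.internal i u) =
          proj L.isComplex.internal (-j) (L.act ω u) := fun u => by
        refine graded_induction (p := fun u => L.act ω (proj A.isComplex.internal i u) =
          proj L.isComplex.internal (-j) (L.act ω u)) A.isComplex.internal u (fun l u hu => ?_)
          (fun x y hx hy => by simp only [map_add, hx, hy])
        by_cases hl : l = i
        · subst hl
          rw [proj_of_mem _ hu, proj_of_mem _ (e1 ▸ hmem l u hu)]
        · rw [proj_of_mem_ne _ hl hu, proj_of_mem_ne _ (by omega) (hmem l u hu), map_zero]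
      refine (h1 u).trans ?_
      rw [hu, proj_of_mem _ z.2]
  have hn : 0 ≤ n := by
    by_contra h0
    rw [hev.gr_eq_bot hA (by omega : 0 < -n), Submodule.mem_bot] at hω
    exact hω0 hω
  obtain ⟨α, hα, hαω⟩ : ∃ α ∈ A.gr n, ev α ω = 1 := by
    obtain ⟨a, ha, ha0⟩ : ∃ a ∈ A.gr n, ev a ω ≠ 0 := by
      by_contra! h0
      exact hω0 (hev.eq_zero_of_forall hω h0)
    refine ⟨(ev a ω)⁻¹ • a, Submodule.smul_mem _ _ ha, ?_⟩
    rw [map_smul, LinearMap.smul_apply, smul_eq_mul, inv_mul_cancel₀ ha0]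
  -- `A.gr n` is one-dimensional, being the dual of `L.gr (-n) = k ω`
  have hspan : ∀ x ∈ A.gr n, x = ev x ω • α := fun x hx => by
    refine sub_eq_zero.1 (hev.inj n _ (Submodule.sub_mem _ hx (Submodule.smul_mem _ _ hα)) ?_)
    refine VanishesOff.ext L.isComplex.internal
      (hev.vanishesOff n _ (Submodule.sub_mem _ hx (Submodule.smul_mem _ _ hα)))
      (fun _ _ _ _ => rfl) fun z hz => ?_
    obtain ⟨E, hE⟩ := hE 0 n (zero_add n)
    obtain ⟨b, hb⟩ := E.surjective ⟨z, hz⟩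
    obtain ⟨c, hc⟩ := hA.gr_zero b b.2 (by rw [hd]; rfl)
    have hz' : z = c • ω := by
      rw [← show (E b : L) = z from congrArg Subtype.val hb, hE, hc, map_smul]
      exact congrArg (c • ·) (one_smul _ ω)
    rw [hz', map_smul, map_sub, LinearMap.sub_apply, map_smul, LinearMap.smul_apply, hαω,
      smul_eq_mul (a := ev x ω), mul_one, sub_self, smul_zero]
    rfl
  refine ⟨n, hn, fun i hi => ?_, α, ?_, le_antisymm (fun x hx => ?_) ?_, fun i j _ _ hij => ?_⟩
  · rcases hi with hi | hi
    · exact hA.gr_neg i hi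
    · refine (Submodule.eq_bot_iff _).2 fun a ha => hinj a ?_
      have := hmem i a ha
      rwa [hev.gr_eq_bot hA (by omega), Submodule.mem_bot] at this
  · rintro rfl
    rw [map_zero] at hαω
    exact zero_ne_one hαω
  · rw [hspan x hx]
    exact Submodule.smul_mem _ _ (Submodule.mem_span_singleton_self α)
  · exact (Submodule.span_singleton_le_iff_mem _ _).2 hα
  · obtain ⟨E, hEi⟩ := hE i j hij
    obtain ⟨E', -⟩ := hE j i (by omega)
    obtain ⟨D, hD⟩ := hev.exists_gr_equiv j
    obtain ⟨D', -⟩ := hev.exists_gr_equiv i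
    -- `A.gr j` is the dual of `L.gr (-j)`, which is isomorphic to `A.gr i`, and conversely
    have : Module.Finite k (A.gr i) :=
      finite_of_equiv_dual (D'.trans E'.dualMap) (D.trans E.dualMap)
    refine ⟨(Module.evalEquiv k (A.gr i)).trans (D.trans E.dualMap).dualMap, fun β γ => ?_⟩
    have hβγ := A.mul_mem _ _ _ _ β.2 γ.2
    rw [hij] at hβγ
    refine (hspan _ hβγ).trans (congrArg (· • α) ?_)
    refine (hev.mul β γ ω).trans ?_
    change _ = D γ (E β)
    rw [hD, hEi]
    rfl

end IsDualPairing

/-! ### Singular chains and cochains -/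

section Simplicial

open CategoryTheory Simplicial

universe u

variable (k : Type v) [Field k] (S : SSet.{u})

/-- The evaluation of cochains on chains. -/
noncomputable def chainPairing : cochainAlgebra k S →ₗ[k] Module.Dual k (chainModule k S) where
  toFun f := Chain.ev (show boundedCochains k S from f).1
  map_add' f g := LinearMap.ext fun z => Chain.ev_add _ _ z
  map_smul' c f := Finsupp.lhom_ext fun x e => by
    refine (Chain.ev_single _ x e).trans ?_
    refine Eq.trans ?_ (congrArg (c • ·) (Chain.ev_single _ x e)).symm
    change e * (c * _) = c * (e * _)
    ring

variable {k S} in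
theorem Chain.ev_eq_zero {f : FullCochain k S} {n : ℤ} (hf : ∀ l : ℕ, (l : ℤ) ≠ n → ∀ σ, f l σ = 0)
    {m : ℤ} (hm : m ≠ -n) {z : Chain k S} (hz : z ∈ Chain.gr k S m) : Chain.ev f z = 0 := by
  refine Chain.gr_induction (p := fun z => Chain.ev f z = 0) z hz (map_zero _)
    (fun z w hz hw => by rw [map_add, hz, hw, add_zero]) fun x c hx => ?_
  rw [Chain.ev_single, hf _ (by omega), mul_zero]

theorem isDualPairing_chainPairing : IsDualPairing (chainPairing k S) where
  mul f g z := (Chain.ev_cap (show boundedCochains k S from f).1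
    (show boundedCochains k S from g).1 z).symm
  vanishesOff n f hf m hm z hz := Chain.ev_eq_zero hf hm hz
  exists_eq n θ hθ := by
    have hθ' : ∀ l : ℕ, (l : ℤ) ≠ n → ∀ σ : S _⦋l⦌, θ (Finsupp.single ⟨l, σ⟩ 1) = 0 :=
      fun l hl σ => hθ (-l) (by omega) _ (Chain.single_mem _ _ _ rfl)
    let f : FullCochain k S := fun l σ => θ (Finsupp.single ⟨l, σ⟩ 1)
    refine ⟨(⟨f, n.toNat, fun l hl σ => hθ' l (by omega) σ⟩ : boundedCochains k S), hθ', ?_⟩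
    refine Finsupp.lhom_ext fun x c => (Chain.ev_single f x c).trans ?_
    have : (Finsupp.single x c : Chain k S) = c • Finsupp.single x 1 := by
      rw [Finsupp.smul_single, smul_eq_mul, mul_one]
    exact ((congrArg θ this).trans (map_smul θ c _)).symm
  inj n f _ h := Subtype.ext (FullCochain.ext fun l σ => by
    have h1 := LinearMap.congr_fun h (Finsupp.single ⟨l, σ⟩ 1)
    have h2 := (Chain.ev_single (show boundedCochains k S from f).1 ⟨l, σ⟩ (1 : k)).symm.trans h1
    rw [one_mul] at h2
    exact h2)
  d m z hz f := by
    refine (Chain.ev_differential (show boundedCochains k S from f).1 z).trans (congrArg _ ?_)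
    refine Chain.gr_induction (p := fun z => Chain.ev (FullCochain.sign (FullCochain.coboundary
      (show boundedCochains k S from f).1)) z = m.negOnePow • Chain.ev (FullCochain.coboundary
      (show boundedCochains k S from f).1) z) z hz (by rw [map_zero, map_zero, smul_zero])
      (fun z w h1 h2 => by rw [map_add, map_add, h1, h2, smul_add]) ?_
    rintro ⟨n, σ⟩ c rfl
    rw [Chain.ev_single, Chain.ev_single, FullCochain.sign, Units.smul_def, Int.negOnePow_neg,
      Int.coe_negOnePow_natCast, zsmul_eq_mul]
    push_cast
    ring

variable {k S} in
/-- A cocycle of degree `0` takes the same value at both ends of an edge. -/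
theorem FullCochain.apply_δ_eq {f : FullCochain k S} (hf : FullCochain.coboundary f = 0)
    (σ : S _⦋1⦌) : f 0 (S.δ 0 σ) = f 0 (S.δ 1 σ) := by
  have h := FullCochain.coboundary_succ f 0 σ
  rw [hf, FullCochain.zero_apply, Finset.sum_range_succ, Finset.sum_range_one] at h
  rw [← face_eq, ← face_eq]
  refine sub_eq_zero.1 (Eq.trans ?_ h.symm)
  rw [pow_zero, one_mul, pow_one, neg_one_mul, sub_eq_add_neg]
  rfl

/-- The cochain algebra is connected as soon as any two vertices are joined by an edge. -/
theorem isConnected_cochainAlgebra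
    (hS : ∀ x y : S _⦋0⦌, ∃ σ : S _⦋1⦌, S.δ 0 σ = x ∧ S.δ 1 σ = y) :
    (cochainAlgebra k S).IsConnected where
  gr_neg n hn := (Submodule.eq_bot_iff _).2 fun f hf =>
    Subtype.ext (FullCochain.ext fun l σ => hf l (by omega) σ)
  gr_zero f hf hd := by
    have hd' : FullCochain.coboundary (show boundedCochains k S from f).1 = 0 :=
      congrArg Subtype.val hd
    have hconst : ∀ x y : S _⦋0⦌, (show boundedCochains k S from f).1 0 x =
        (show boundedCochains k S from f).1 0 y := fun x y => by
      obtain ⟨σ, rfl, rfl⟩ := hS x y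
      exact FullCochain.apply_δ_eq hd' σ
    obtain ⟨c, hc⟩ : ∃ c, ∀ x : S _⦋0⦌, (show boundedCochains k S from f).1 0 x = c := by
      rcases isEmpty_or_nonempty (S _⦋0⦌) with h | ⟨⟨x⟩⟩
      · exact ⟨0, fun x => h.elim x⟩
      · exact ⟨_, fun y => hconst y x⟩
    refine ⟨c, Subtype.ext (FullCochain.ext fun l σ => ?_)⟩
    change _ = c * (1 : FullCochain k S) l σ
    rw [FullCochain.one_apply]
    rcases Nat.eq_zero_or_pos l with rfl | hl
    · simpa using hc σ
    · rw [if_neg (by omega), mul_zero]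
      exact hf l (by omega) σ

variable (X : Type u) [TopologicalSpace X]

theorem isConnected_singularCochains [PathConnectedSpace X] :
    (singularCochains k X).IsConnected := by
  refine isConnected_cochainAlgebra k _ fun x y => ?_
  obtain ⟨x, rfl⟩ := TopCat.toSSetObj₀Equiv.symm.surjective x
  obtain ⟨y, rfl⟩ := TopCat.toSSetObj₀Equiv.symm.surjective y
  let γ : Path (X := X) y x := PathConnectedSpace.somePath y x
  let g : TopCat.I.{u} ⟶ TopCat.of X :=
    TopCat.ofHom ⟨fun t => γ t.down, by fun_prop⟩
  -- the face `δ 0` of a path is its end, and `δ 1` is its start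
  refine ⟨TopCat.toSSetObj₁Equiv.symm g, ?_, ?_⟩
  · rw [TopCat.δ_zero_toSSetObj₁Equiv.symm]
    exact congrArg _ γ.target
  · rw [TopCat.δ_one_toSSetObj₁Equiv.symm]
    exact congrArg _ γ.source

end Simplicial

end Gor

/-- For a based path connected space `X` with `H_n(X) = 0` for `n > N`, the following are
equivalent: `X` is Gorenstein at `k`; `dim Tor^{H^*(X)}(k, H_*(X)) = 1`; `H^*(X)` is a Poincaré
duality algebra. -/
theorem theorem1 (k : Type*) [Field k] (X : Type*) [TopologicalSpace X]
    [PathConnectedSpace X] (x₀ : X) (N : ℕ)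
    (hN : ∀ n : ℕ, N < n → (Gor.singularHomology k X).gr (-(n : ℤ)) = ⊥) :
    List.TFAE
      [(Gor.singularAugmentation k x₀).IsGorenstein,
        Gor.DimTorEq (Gor.singularAugmentation k x₀).homology.fieldModule
          (Gor.singularHomology k X) 1,
        Gor.IsPoincareDualityAlgebra (Gor.singularCohomology k X).gr] := by
  have hev := Gor.isDualPairing_chainPairing k (TopCat.toSSet.obj (TopCat.of X))
  have hA := Gor.isConnected_singularCochains k X
  have hbot : ∀ n < -(N : ℤ), (Gor.singularHomology k X).gr n = ⊥ := fun n hn => by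
    have := hN (-n).toNat (by omega)
    rwa [show -((-n).toNat : ℤ) = n by omega] at this
  have hL : Gor.IsBoundedBelow (Gor.singularChains k X).gr (Gor.singularChains k X).d :=
    Gor.isBoundedBelow_of_homology _ hbot
  have hHL : Gor.IsBoundedBelow (Gor.singularHomology k X).gr (Gor.singularHomology k X).d :=
    ⟨-N, fun n hn x hx _ => by
      rw [hbot n hn, Submodule.mem_bot] at hx
      rw [hx]
      exact Submodule.zero_mem _⟩
  have : Nontrivial (Gor.cochainAlgebra k (TopCat.toSSet.obj (TopCat.of X))).homology :=
    (Gor.singularAugmentation k x₀).homology.toAlgHom.toRingHom.domain_nontrivial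
  have h1 : (Gor.singularAugmentation k x₀).IsGorenstein ↔
      (Gor.singularChains k X).IsQuasiFree :=
    (Gor.isGorenstein_iff hev _).trans (Gor.dimTorEq_one_iff hA _ hL)
  have h2 : Gor.DimTorEq (Gor.singularAugmentation k x₀).homology.fieldModule
      (Gor.singularHomology k X) 1 ↔ (Gor.singularHomology k X).IsQuasiFree :=
    Gor.dimTorEq_one_iff hA.homology _ hHL
  have h3 : Gor.IsPoincareDualityAlgebra (Gor.singularCohomology k X).gr ↔
      (Gor.singularHomology k X).IsQuasiFree :=
    ⟨hev.homology.isQuasiFree_of_isPoincareDualityAlgebra rfl rfl,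
      hev.homology.isPoincareDualityAlgebra_of_isQuasiFree hA.homology rfl rfl⟩
  have h4 : (Gor.singularHomology k X).IsQuasiFree ↔ (Gor.singularChains k X).IsQuasiFree :=
    Gor.DGRightModule.isQuasiFree_homology_iff
  tfae_have 1 ↔ 2 := by rw [h1, h2, h4]
  tfae_have 2 ↔ 3 := by rw [h2, h3]
  tfae_finish
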